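/- **Setting.** Let $M$ be a smooth $n$-manifold, $A\to M$ a smooth real vector bundle of finite rank, and let $E=A\oplus A^*$ carry the canonical symmetric bilinear form $\langle X+\xi,Y+\eta\rangle=\xi(Y)+\eta(X)$. Let $\mathcal A=\bigoplus_k\mathcal A^k$ be the graded algebra of functions on $T^*[2]A[1]$ with its canonical Poisson bracket $\{\,,\}$ of degree $-2$ (the big bracket). In the local canonical coordinates $(x^i,\tau^\alpha,p_i,\theta_\alpha)$ given by a chart $(x^i)$ of $M$ and a local frame $(e_\alpha)$ of $A$ with dual frame $(\epsilon^\alpha)$, elements of $\mathcal A$ are polynomials in $\tau^\alpha,\theta_\alpha$ (odd, degree $1$) and $p_i$ (even, degree $2$) with smooth coefficients, and the nonzero brackets of coordinates are $\{x^i,p_j\}=-\{p_j,x^i\}=\delta^i_j$ and $\{\tau^\alpha,\theta_\beta\}=\{\theta_\beta,\tau^\alpha\}=\delta^\alpha_\beta$. Sections of $E$ are identified with elements of $\mathcal A^1$ by $X+\xi\mapsto X^\alpha\theta_\alpha+\xi_\alpha\tau^\alpha$. Let $((A,\mu),(A^*,\gamma))$ be a Lie bialgebroid: $\mu,\gamma\in\mathcal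 A^3$ are locally of the form $\mu=\rho^i_\alpha p_i\tau^\alpha+\frac12C^\delta_{\alpha\beta}\tau^\alpha\tau^\beta\theta_\delta$ and $\gamma=r^{i\alpha}p_i\theta_\alpha+\frac12Q^{\alpha\beta}_\delta\theta_\alpha\theta_\beta\tau^\delta$, and $\{\mu,\mu\}=\{\mu,\gamma\}=\{\gamma,\gamma\}=0$. The brackets are the derived brackets $[X,Y]^\mu=\{\{X,\mu\},Y\}$ on $\Gamma A$, $[\xi,\eta]^\gamma=\{\{\xi,\gamma\},\eta\}$ on $\Gamma A^*$ and $[u,v]=\{\{u,\mu+\gamma\},v\}$ on $\Gamma E$. The torsion of an endomorphism $K$ with respect to a bracket $[\,,]$ is $T K(u,v)=[Ku,Kv]-K\big([Ku,v]+[u,Kv]-K[u,v]\big)$; write $T_\mu$, $T_\gamma$, $T_{\mu+\gamma}$ for the three brackets. Let $N:A\to A$ be a smooth vector bundle endomorphism, with $Ne_\beta=N^\alpha_\beta e_\alpha$, let ${}^tN$ be its transpose, and let $\mathcal N$ be the skew-symmetric endomorphism $X+\xi\mapsto NX-{}^tN\xi$ of $E$. As elements of $\mathcal A^2$, locally, $N=N^\alpha_\beta\tau^\beta\theta_\alpha$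 and $\widetilde{\mathcal N}=\frac12\langle\mathcal N e_a,e_b\rangle\tau^a\tau^b$, where $(e_a)=(e_\alpha,\epsilon^\alpha)$ is the frame of $E$ and $(\tau^a)=(\tau^\alpha,\theta_\alpha)$ are the dual coordinates. Likewise, one sets, locally, $\widetilde t=\frac12t^\alpha_{\beta\delta}\tau^\beta\tau^\delta\theta_\alpha$ for $t\in\Gamma(\wedge^2A^*\otimes A)$, $\widetilde t=\frac12t_\alpha^{\beta\delta}\theta_\beta\theta_\delta\tau^\alpha$ for $t\in\Gamma(\wedge^2A\otimes A^*)$, and $\widetilde T=\frac16\langle T(e_a,e_b),e_d\rangle\tau^a\tau^b\tau^d$ when $\langle T(u,v),w\rangle$ is a skew-symmetric $3$-tensor on $E$. **Theorem 4.2.** (i) The element $\{\{\widetilde{\mathcal N},\mu+\gamma\},\widetilde{\mathcal N}\}$ is in $\mathcal A^3$, and $$\{\{\widetilde{\mathcal N},\mu+\gamma\},\widetilde{\mathcal N}\}=\{\{N,\mu+\gamma\},N\}.$$ (ii) Suppose that $N$ is proportional to an almost cps structure on $A$, i.e. $N=\kappa J$ with $\kappa\in\mathbb R$ and $J$ a vector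 bundle endomorphism of $A$ with $J^2=\varepsilon\,\mathrm{Id}_A$, $\varepsilon\in\{-1,1,0\}$. Then $\langle T_{\mu+\gamma}\mathcal N(u,v),w\rangle$ is $C^\infty$-linear and skew-symmetric in $u,v,w$, the functions $\widetilde{T_{\mu+\gamma}\mathcal N}$, $\widetilde{T_\mu N}$, $\widetilde{T_\gamma{}^tN}$ are in $\mathcal A^3$, and $$\widetilde{T_{\mu+\gamma}\mathcal N}=\widetilde{T_\mu N}+\widetilde{T_\gamma{}^tN}.$$ Explicitly, for all sections $X+\xi$, $Y+\eta$, $Z+\zeta$ of $A\oplus A^*$ (also local ones), $$\begin{aligned}\langle T_{\mu+\gamma}\mathcal N(X+\xi,Y+\eta),Z+\zeta\rangle={}&\langle T_\mu N(X,Y),\zeta\rangle+\langle T_\mu N(Y,Z),\xi\rangle+\langle T_\mu N(Z,X),\eta\rangle\\&+\langle T_\gamma{}^tN(\xi,\eta),Z\rangle+\langle T_\gamma{}^tN(\eta,\zeta),X\rangle+\langle T_\gamma{}^tN(\zeta,\xi),Y\rangle.\end{aligned}$$ -/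

import Mathlib

open scoped Manifold ContDiff TensorProduct Matrix
open Bundle Module

noncomputable section

namespace BigBracket

/-- The fibre of the algebra of functions on `T*[2]A[1]` in local canonical coordinates
`(x^i, τ^α, p_i, θ_α)` when `x` is frozen: polynomials in the even momenta `p_i`, tensored with the
exterior algebra on the odd coordinates `τ^α` (index `Sum.inl α`) and `θ_α` (index `Sum.inr α`). -/
def FiberAlg (n r : ℕ) : Type :=
  MvPolynomial (Fin n) ℝ ⊗[ℝ] ExteriorAlgebra ℝ (Fin r ⊕ Fin r → ℝ)

namespace FiberAlg

variable {n r : ℕ}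

instance : Ring (FiberAlg n r) :=
  inferInstanceAs (Ring (MvPolynomial (Fin n) ℝ ⊗[ℝ] ExteriorAlgebra ℝ (Fin r ⊕ Fin r → ℝ)))

instance : Algebra ℝ (FiberAlg n r) :=
  inferInstanceAs (Algebra ℝ (MvPolynomial (Fin n) ℝ ⊗[ℝ] ExteriorAlgebra ℝ (Fin r ⊕ Fin r → ℝ)))

/-- The identification with the tensor product. -/
def equiv : FiberAlg n r ≃ₐ[ℝ]
    MvPolynomial (Fin n) ℝ ⊗[ℝ] ExteriorAlgebra ℝ (Fin r ⊕ Fin r → ℝ) := AlgEquiv.refl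

/-- The momentum coordinate `p_i`. -/
def p (i : Fin n) : FiberAlg n r := equiv.symm (MvPolynomial.X i ⊗ₜ 1)

/-- The odd coordinates: `odd (inl α) = τ^α`, `odd (inr α) = θ_α`. -/
def odd (a : Fin r ⊕ Fin r) : FiberAlg n r :=
  equiv.symm (1 ⊗ₜ ExteriorAlgebra.ι ℝ (Pi.single a 1))

/-- The odd coordinate `τ^α`, dual to the vector `e_α` of a frame of `A`. -/
def τ (α : Fin r) : FiberAlg n r := odd (Sum.inl α)

/-- The odd coordinate `θ_α`, conjugate to `τ^α`. -/
def θ (α : Fin r) : FiberAlg n r := odd (Sum.inr α)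

/-- `∂/∂p_i`. -/
def dp (i : Fin n) : FiberAlg n r →ₗ[ℝ] FiberAlg n r :=
  equiv.symm.toLinearMap ∘ₗ
    LinearMap.rTensor _ (MvPolynomial.pderiv i).toLinearMap ∘ₗ equiv.toLinearMap

/-- The left derivative with respect to an odd coordinate. -/
def dLeft (a : Fin r ⊕ Fin r) : FiberAlg n r →ₗ[ℝ] FiberAlg n r :=
  equiv.symm.toLinearMap ∘ₗ
    LinearMap.lTensor _ (CliffordAlgebra.contractLeft (Q := 0) (LinearMap.proj a)) ∘ₗ
      equiv.toLinearMap

/-- The right derivative with respect to an odd coordinate. -/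
def dRight (a : Fin r ⊕ Fin r) : FiberAlg n r →ₗ[ℝ] FiberAlg n r :=
  equiv.symm.toLinearMap ∘ₗ
    LinearMap.lTensor _ ((CliffordAlgebra.contractRight (Q := 0)).flip (LinearMap.proj a)) ∘ₗ
      equiv.toLinearMap

/-- The value at the origin (all momenta and odd coordinates set to zero). -/
def body : FiberAlg n r →ₗ[ℝ] ℝ :=
  (TensorProduct.lid ℝ ℝ).toLinearMap ∘ₗ TensorProduct.map
    (MvPolynomial.aeval (0 : Fin n → ℝ)).toLinearMap
      (ExteriorAlgebra.algebraMapInv).toLinearMap ∘ₗ equiv.toLinearMap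

/-- The monomial `p^d τ^{a₁} ⋯ τ^{a_s} θ_{b₁} ⋯ θ_{b_t}`. -/
def monomial (d : Fin n →₀ ℕ) (a b : List (Fin r)) : FiberAlg n r :=
  equiv.symm (MvPolynomial.monomial d 1 ⊗ₜ 1) * (a.map τ).prod * (b.map θ).prod

end FiberAlg

section Coordinates

variable {n : ℕ} {M : Type*} [TopologicalSpace M] [ChartedSpace (EuclideanSpace ℝ (Fin n)) M]
variable (F : Type*) [NormedAddCommGroup F] [NormedSpace ℝ F]
  (A : M → Type*) [TopologicalSpace (TotalSpace F A)] [∀ x, TopologicalSpace (A x)]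
  [∀ x, AddCommGroup (A x)] [∀ x, Module ℝ (A x)] [FiberBundle F A]

/-- The data defining local canonical coordinates `(x^i, τ^α, p_i, θ_α)` on `T*[2]A[1]`: a smooth
chart of `M` and a smooth local frame of `A` over the domain of that chart. -/
structure Coords where
  /-- the chart, with components `x^i` -/
  chart : OpenPartialHomeomorph M (EuclideanSpace ℝ (Fin n))
  chart_mem : chart ∈ IsManifold.maximalAtlas (𝓡 n) ∞ M
  /-- the local frame `(e_α)` (only its values over the domain of the chart matter) -/
  frame : Fin (finrank ℝ F) → (x : M) → A x
  isFrame : IsLocalFrameOn (𝓡 n) F ∞ frame chart.source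

variable {F A}

namespace Coords

/-- The coordinate domain. -/
def U (c : Coords (n := n) F A) : TopologicalSpace.Opens M := ⟨c.chart.source, c.chart.open_source⟩

/-- The algebra `C^∞(U)` of the coordinate domain `U`. -/
abbrev Fn (c : Coords (n := n) F A) : Type _ := C^∞⟮𝓡 n, c.U; 𝓘(ℝ, ℝ), ℝ⟯

/-- The partial derivative `∂f/∂x^i` at `m` of a function defined near `m`. -/
def deriv (c : Coords (n := n) F A) (i : Fin n) (f : M → ℝ) (m : M) : ℝ :=
  fderiv ℝ (f ∘ c.chart.symm) (c.chart m) (EuclideanSpace.single i 1)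

open Classical in
/-- Extension by zero of a function on the coordinate domain. -/
def ext (c : Coords (n := n) F A) (f : c.Fn) (m : M) : ℝ := if h : m ∈ c.U then f ⟨m, h⟩ else 0

theorem ext_apply (c : Coords (n := n) F A) (f : c.Fn) (m : c.U) : c.ext f m = f m := by
  simp [ext]

theorem contMDiffOn_ext (c : Coords (n := n) F A) (f : c.Fn) :
    ContMDiffOn (𝓡 n) 𝓘(ℝ, ℝ) ∞ (c.ext f) c.chart.source := by
  intro m hm
  refine ContMDiffAt.contMDiffWithinAt ?_
  have h := contMDiffAt_subtype_iff (I := 𝓡 n) (I' := 𝓘(ℝ, ℝ)) (n := ∞) (U := c.U)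
    (f := c.ext f) (x := ⟨m, hm⟩)
  refine h.1 ?_
  have e : (fun x : c.U => c.ext f x) = f := funext fun x => c.ext_apply f x
  rw [e]
  exact f.contMDiff _

theorem contDiffOn_ext_symm (c : Coords (n := n) F A) (f : c.Fn) :
    ContDiffOn ℝ ∞ (c.ext f ∘ c.chart.symm) c.chart.target := by
  rw [← contMDiffOn_iff_contDiffOn]
  exact (c.contMDiffOn_ext f).comp (contMDiffOn_symm_of_mem_maximalAtlas c.chart_mem)
    c.chart.mapsTo_symm

theorem contMDiff_deriv (c : Coords (n := n) F A) (i : Fin n) (f : c.Fn) :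
    ContMDiff (𝓡 n) 𝓘(ℝ, ℝ) ∞ (fun m : c.U => c.deriv i (c.ext f) m) := by
  intro m
  refine contMDiffAt_subtype_iff.2 ?_
  have h1 : ContDiffOn ℝ ∞ (fun y => fderiv ℝ (c.ext f ∘ c.chart.symm) y
      (EuclideanSpace.single i 1)) c.chart.target :=
    ((c.contDiffOn_ext_symm f).fderiv_of_isOpen c.chart.open_target (by simp)).clm_apply
      contDiffOn_const
  have h2 := (contMDiffOn_iff_contDiffOn.2 h1).comp
    (contMDiffOn_of_mem_maximalAtlas c.chart_mem) c.chart.mapsTo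
  exact h2.contMDiffAt (c.chart.open_source.mem_nhds m.2)

/-- The coordinate vector field `∂/∂x^i` as an operator on `C^∞(U)`. -/
def partialX (c : Coords (n := n) F A) (i : Fin n) : c.Fn →ₗ[ℝ] c.Fn where
  toFun f := ⟨fun m => c.deriv i (c.ext f) m, c.contMDiff_deriv i f⟩
  map_add' f g := by
    ext m
    have hd : ∀ f : c.Fn, DifferentiableAt ℝ (c.ext f ∘ c.chart.symm) (c.chart m) := fun f =>
      ((c.contDiffOn_ext_symm f).contDiffAt
        (c.chart.open_target.mem_nhds (c.chart.map_source m.2))).differentiableAt (by simp)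
    have e : c.ext (f + g) ∘ c.chart.symm = c.ext f ∘ c.chart.symm + c.ext g ∘ c.chart.symm := by
      funext y
      by_cases h : c.chart.symm y ∈ c.U <;> simp [ext, h]
    change c.deriv i (c.ext (f + g)) m = c.deriv i (c.ext f) m + c.deriv i (c.ext g) m
    simp only [deriv]
    rw [e, fderiv_add (hd f) (hd g)]
    rfl
  map_smul' r f := by
    ext m
    have hd : DifferentiableAt ℝ (c.ext f ∘ c.chart.symm) (c.chart m) :=
      ((c.contDiffOn_ext_symm f).contDiffAt
        (c.chart.open_target.mem_nhds (c.chart.map_source m.2))).differentiableAt (by simp)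
    have e : c.ext (r • f) ∘ c.chart.symm = r • (c.ext f ∘ c.chart.symm) := by
      funext y
      by_cases h : c.chart.symm y ∈ c.U <;> simp [ext, h]
    change c.deriv i (c.ext (r • f)) m = r * c.deriv i (c.ext f) m
    simp only [deriv]
    rw [e, fderiv_const_smul hd]
    rfl

/-- The algebra of functions on the part of `T*[2]A[1]` over the coordinate domain `U`:
`C^∞(U)[p_1, …, p_n] ⊗ Λ(τ^α, θ_α)`. -/
abbrev Loc (c : Coords (n := n) F A) : Type _ := c.Fn ⊗[ℝ] FiberAlg n (finrank ℝ F)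

/-- `∂/∂x^i`, acting on coefficients. -/
def dx (c : Coords (n := n) F A) (i : Fin n) : c.Loc →ₗ[ℝ] c.Loc :=
  LinearMap.rTensor _ (c.partialX i)

/-- `∂/∂p_i`. -/
def dp (c : Coords (n := n) F A) (i : Fin n) : c.Loc →ₗ[ℝ] c.Loc :=
  LinearMap.lTensor _ (FiberAlg.dp i)

/-- Left derivative with respect to an odd coordinate. -/
def dLeft (c : Coords (n := n) F A) (a : Fin (finrank ℝ F) ⊕ Fin (finrank ℝ F)) :
    c.Loc →ₗ[ℝ] c.Loc := LinearMap.lTensor _ (FiberAlg.dLeft a)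

/-- Right derivative with respect to an odd coordinate. -/
def dRight (c : Coords (n := n) F A) (a : Fin (finrank ℝ F) ⊕ Fin (finrank ℝ F)) :
    c.Loc →ₗ[ℝ] c.Loc := LinearMap.lTensor _ (FiberAlg.dRight a)

/-- The canonical Poisson bracket of degree `-2` (the big bracket) in canonical coordinates; the
nonvanishing brackets of coordinates are `{x^i, p_j} = δ^i_j = -{p_j, x^i}` and
`{τ^α, θ_β} = δ^α_β = {θ_β, τ^α}`. -/
def bracket (c : Coords (n := n) F A) (f g : c.Loc) : c.Loc :=
  ∑ i, (c.dx i f * c.dp i g - c.dp i f * c.dx i g) +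
  ∑ α, (c.dRight (Sum.inl α) f * c.dLeft (Sum.inr α) g +
    c.dRight (Sum.inr α) f * c.dLeft (Sum.inl α) g)

/-- The odd coordinates as local functions: `τ^α` for `inl α`, `θ_α` for `inr α`. They are the
coordinates dual to the frame `(e_α, ε^α)` of `A ⊕ A*`. -/
def odd (c : Coords (n := n) F A) (a : Fin (finrank ℝ F) ⊕ Fin (finrank ℝ F)) : c.Loc :=
  1 ⊗ₜ FiberAlg.odd a

/-- The local function `τ^α`. -/
def τ (c : Coords (n := n) F A) (α : Fin (finrank ℝ F)) : c.Loc := c.odd (Sum.inl α)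

/-- The local function `θ_α`. -/
def θ (c : Coords (n := n) F A) (α : Fin (finrank ℝ F)) : c.Loc := c.odd (Sum.inr α)

/-- Functions of bidegree `(k, l)`, where `x, θ, τ, p` have bidegrees
`(0,0), (1,0), (0,1), (1,1)`. -/
def bideg (c : Coords (n := n) F A) (k l : ℕ) : Submodule ℝ c.Loc :=
  Submodule.span ℝ {w | ∃ (f : c.Fn) (d : Fin n →₀ ℕ) (a b : List (Fin (finrank ℝ F))),
    d.degree + b.length = k ∧ d.degree + a.length = l ∧ w = f ⊗ₜ FiberAlg.monomial d a b}

/-- Functions of (total) degree `k`. -/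
def deg (c : Coords (n := n) F A) (k : ℕ) : Submodule ℝ c.Loc :=
  ⨆ ij ∈ Finset.HasAntidiagonal.antidiagonal k, c.bideg ij.1 ij.2

/-- Freezing `x = m`. -/
def eval (c : Coords (n := n) F A) (m : c.U) : c.Loc →ₗ[ℝ] FiberAlg n (finrank ℝ F) :=
  (TensorProduct.lid ℝ (FiberAlg n (finrank ℝ F))).toLinearMap ∘ₗ LinearMap.rTensor _
    ({ toFun := fun f => f m
       map_add' := fun _ _ => rfl
       map_smul' := fun _ _ => rfl } : c.Fn →ₗ[ℝ] ℝ)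

/-! ### Sections over the coordinate domain, given by their components in the frame -/

/-- Sections of `A` over `U`, `X = X^α e_α`. -/
abbrev SecA (c : Coords (n := n) F A) : Type _ := Fin (finrank ℝ F) → c.Fn

/-- Sections of `A*` over `U`, `ξ = ξ_α ε^α`. -/
abbrev SecAdual (c : Coords (n := n) F A) : Type _ := Fin (finrank ℝ F) → c.Fn

/-- Sections of the double `A ⊕ A*` over `U`. -/
abbrev SecE (c : Coords (n := n) F A) : Type _ := c.SecA × c.SecAdual

/-- The canonical symmetric bilinear form `⟨X + ξ, Y + η⟩ = ξ(Y) + η(X)` of `A ⊕ A*`. -/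
def pairE (c : Coords (n := n) F A) (u v : c.SecE) : c.Fn := u.2 ⬝ᵥ v.1 + v.2 ⬝ᵥ u.1

/-- The frame `(e_α, ε^α)` of `A ⊕ A*`. -/
def frameE (c : Coords (n := n) F A) : Fin (finrank ℝ F) ⊕ Fin (finrank ℝ F) → c.SecE
  | Sum.inl α => (Pi.single α 1, 0)
  | Sum.inr α => (0, Pi.single α 1)

/-- A section of `A ⊕ A*` as a function of degree one: `X + ξ ↦ X^α θ_α + ξ_α τ^α`. -/
def ofSec (c : Coords (n := n) F A) (u : c.SecE) : c.Loc :=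
  ∑ α, u.1 α • c.θ α + ∑ α, u.2 α • c.τ α

/-- The coefficient of an odd coordinate in the linear part of a local function. -/
def coeffOdd (c : Coords (n := n) F A) (a : Fin (finrank ℝ F) ⊕ Fin (finrank ℝ F)) :
    c.Loc →ₗ[ℝ] c.Fn :=
  (TensorProduct.rid ℝ c.Fn).toLinearMap ∘ₗ LinearMap.lTensor _ (FiberAlg.body ∘ₗ FiberAlg.dLeft a)

/-- The section of `A ⊕ A*` corresponding to a function of degree one, inverse to `ofSec`. -/
def toSec (c : Coords (n := n) F A) (w : c.Loc) : c.SecE :=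
  (fun α => c.coeffOdd (Sum.inr α) w, fun α => c.coeffOdd (Sum.inl α) w)

/-- The derived (Dorfman) bracket `[u, v] = {{u, Θ}, v}` on sections of `A ⊕ A*`. -/
def dorfman (c : Coords (n := n) F A) (Θ : c.Loc) (u v : c.SecE) : c.SecE :=
  c.toSec (c.bracket (c.bracket (c.ofSec u) Θ) (c.ofSec v))

/-- The derived bracket `[X, Y]^μ = {{X, μ}, Y}` on sections of `A`. -/
def bracketA (c : Coords (n := n) F A) (μ : c.Loc) (X Y : c.SecA) : c.SecA :=
  (c.dorfman μ (X, 0) (Y, 0)).1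

/-- The derived bracket `[ξ, η]^γ = {{ξ, γ}, η}` on sections of `A*`. -/
def bracketAdual (c : Coords (n := n) F A) (γ : c.Loc) (ξ η : c.SecAdual) : c.SecAdual :=
  (c.dorfman γ (0, ξ) (0, η)).2

/-- The function `½ ⟨𝒩 e_a, e_b⟩ τ^a τ^b` associated with a skew-symmetric endomorphism of
`A ⊕ A*`, where `(e_a)` is the frame of `A ⊕ A*` and `(τ^a)` its dual coordinates. -/
def tildeE₂ (c : Coords (n := n) F A) (N : c.SecE → c.SecE) : c.Loc :=
  (1 / 2 : ℝ) • ∑ a, ∑ b, c.pairE (N (c.frameE a)) (c.frameE b) • (c.odd a * c.odd b)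

/-- The function `⅙ ⟨T(e_a, e_b), e_d⟩ τ^a τ^b τ^d` associated with `T : ∧²E → E`, `E = A ⊕ A*`,
such that `⟨T(u, v), w⟩` is a skew-symmetric 3-tensor. -/
def tildeE₃ (c : Coords (n := n) F A) (T : c.SecE → c.SecE → c.SecE) : c.Loc :=
  (1 / 6 : ℝ) • ∑ a, ∑ b, ∑ d, c.pairE (T (c.frameE a) (c.frameE b)) (c.frameE d) •
    (c.odd a * c.odd b * c.odd d)

/-- The function `½ t^α_{βδ} τ^β τ^δ θ_α` associated with `t ∈ ∧²A* ⊗ A`. -/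
def tildeA (c : Coords (n := n) F A) (t : c.SecA → c.SecA → c.SecA) : c.Loc :=
  (1 / 2 : ℝ) • ∑ β, ∑ δ, ∑ α, t (Pi.single β 1) (Pi.single δ 1) α • (c.τ β * c.τ δ * c.θ α)

/-- The function `½ t_α^{βδ} θ_β θ_δ τ^α` associated with `t ∈ ∧²A ⊗ A*`. -/
def tildeAdual (c : Coords (n := n) F A) (t : c.SecAdual → c.SecAdual → c.SecAdual) : c.Loc :=
  (1 / 2 : ℝ) • ∑ β, ∑ δ, ∑ α, t (Pi.single β 1) (Pi.single δ 1) α • (c.θ β * c.θ δ * c.τ α)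

end Coords

/-- The Nijenhuis torsion
`T(u, v) = [Nu, Nv] - N([Nu, v] + [u, Nv] - N[u, v])` of an endomorphism for a bracket. -/
def torsion {S : Type*} [AddCommGroup S] (br : S → S → S) (N : S → S) (u v : S) : S :=
  br (N u) (N v) - N (br (N u) v + br u (N v) - N (br u v))

/-! ### Global functions on `T*[2]A[1]` -/

/-- The change of canonical coordinates from `c = (x, τ, p, θ)` to `c' = (x', τ', p', θ')` at the
point `m`, as the algebra homomorphism which expresses the coordinates of `c'` by those of `c`:
with `e_β = T^α_β e'_α` and `S = T⁻¹`,
`τ'^α = T^α_β τ^β`, `θ'_α = S^β_α θ_β`,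
`p'_j = (∂x^i/∂x'^j) (p_i + S^δ_α (∂T^α_β/∂x^i) τ^β θ_δ)`. -/
structure IsCoordChange (c c' : Coords (n := n) F A) (m : M)
    (ψ : FiberAlg n (finrank ℝ F) →ₐ[ℝ] FiberAlg n (finrank ℝ F)) : Prop where
  map_τ : ∀ α, ψ (FiberAlg.τ α) =
    ∑ β, c'.isFrame.coeff α m (c.frame β m) • FiberAlg.τ β
  map_θ : ∀ α, ψ (FiberAlg.θ α) =
    ∑ β, c.isFrame.coeff β m (c'.frame α m) • FiberAlg.θ β
  map_p : ∀ j, ψ (FiberAlg.p j) =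
    ∑ i, c'.deriv j (fun x => c.chart x i) m •
      (FiberAlg.p i + ∑ β, ∑ δ,
        (∑ α, c.isFrame.coeff δ m (c'.frame α m) *
          c.deriv i (fun x => c'.isFrame.coeff α x (c.frame β x)) m) •
        (FiberAlg.τ β * FiberAlg.θ δ))

variable (F A) in
/-- Families of local functions on `T*[2]A[1]`, one for each system of canonical coordinates. -/
abbrev Family : Type _ := ∀ c : Coords (n := n) F A, c.Loc

namespace Family

/-- The big bracket, computed in each system of canonical coordinates. -/
def bracket (f g : Family (n := n) F A) : Family (n := n) F A := fun c => c.bracket (f c) (g c)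

/-- The family is a function on `T*[2]A[1]`: any two of its coordinate expressions are related by
the change of canonical coordinates, at every point where both are defined. -/
def IsGlobal (f : Family (n := n) F A) : Prop :=
  ∀ (c c' : Coords (n := n) F A) (m : M) (h : m ∈ c.U) (h' : m ∈ c'.U),
    ∃ ψ, IsCoordChange c c' m ψ ∧ ψ (c'.eval ⟨m, h'⟩ (f c')) = c.eval ⟨m, h⟩ (f c)

end Family

variable (F A) in
/-- `𝒜^k`: the functions of degree `k` on `T*[2]A[1]`. -/
def 𝒜 (k : ℕ) : Set (Family (n := n) F A) := {f | f.IsGlobal ∧ ∀ c, f c ∈ c.deg k}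

variable (F A) in
/-- `𝒜^{k,l}`: the functions of bidegree `(k, l)` on `T*[2]A[1]`. -/
def 𝒜bi (k l : ℕ) : Set (Family (n := n) F A) := {f | f.IsGlobal ∧ ∀ c, f c ∈ c.bideg k l}

/-- `((A, μ), (A*, γ))` is a Lie bialgebroid: `μ` has the form
`ρ^i_α p_i τ^α + ½ C^δ_{αβ} τ^α τ^β θ_δ` and `{μ, μ} = 0` (a Lie algebroid structure on `A`), `γ` has
the form `r^{iα} p_i θ_α + ½ Q^{αβ}_δ θ_α θ_β τ^δ` and `{γ, γ} = 0` (a Lie algebroid structure on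
`A*`), and `{μ, γ} = 0` (compatibility). -/
structure IsLieBialgebroid (μ γ : Family (n := n) F A) : Prop where
  mem_μ : μ ∈ 𝒜bi F A 1 2
  mem_γ : γ ∈ 𝒜bi F A 2 1
  bracket_μ_μ : μ.bracket μ = 0
  bracket_μ_γ : μ.bracket γ = 0
  bracket_γ_γ : γ.bracket γ = 0

end Coordinates

/-! ### Vector bundle endomorphisms -/

section Endomorphisms


variable {n : ℕ} {M : Type*} [TopologicalSpace M] [ChartedSpace (EuclideanSpace ℝ (Fin n)) M]
variable (F : Type*) [NormedAddCommGroup F] [NormedSpace ℝ F]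
  (A : M → Type*) [TopologicalSpace (TotalSpace F A)]
  [∀ x, TopologicalSpace (A x)]
  [∀ x, AddCommGroup (A x)] [∀ x, Module ℝ (A x)]
  [FiberBundle F A] [VectorBundle ℝ F A]

variable {F A} in
/-- In a frame, the components of a fibrewise linear image of a smooth section are smooth. -/
theorem contMDiffOn_coeff [FiniteDimensional ℝ F] [ContMDiffVectorBundle ∞ F A (𝓡 n)]
    (c : Coords (n := n) F A) {s : (x : M) → A x}
    (hs : ContMDiffOn (𝓡 n) ((𝓡 n).prod 𝓘(ℝ, F)) ∞ (fun x => TotalSpace.mk' F x (s x))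
      c.chart.source) (α : Fin (finrank ℝ F)) :
    ContMDiffOn (𝓡 n) 𝓘(ℝ, ℝ) ∞ (fun x => c.isFrame.coeff α x (s x)) c.chart.source := by
  intro x₀ hx₀
  refine ContMDiffAt.contMDiffWithinAt ?_
  let e := trivializationAt F A x₀
  have hxe : x₀ ∈ e.baseSet := FiberBundle.mem_baseSet_trivializationAt' x₀
  have hnhds := c.chart.open_source.mem_nhds hx₀
  -- the section and the frame read in the trivialization
  have hsec : ∀ t : (x : M) → A x,
      ContMDiffOn (𝓡 n) ((𝓡 n).prod 𝓘(ℝ, F)) ∞ (fun x => TotalSpace.mk' F x (t x))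
        c.chart.source →
      ContMDiffAt (𝓡 n) 𝓘(ℝ, F) ∞ (fun x => (e ⟨x, t x⟩).2) x₀ := fun t ht =>
    (e.contMDiffAt_section_iff hxe).1 (ht.contMDiffAt hnhds)
  let ε : Fin (finrank ℝ F) → ((Fin (finrank ℝ F) → ℝ) →L[ℝ] ℝ) :=
    fun β => ContinuousLinearMap.proj β
  let L : M → ((Fin (finrank ℝ F) → ℝ) →L[ℝ] F) :=
    fun x => ∑ β, (ε β).smulRight (e ⟨x, c.frame β x⟩).2
  have hL : ContMDiffAt (𝓡 n) 𝓘(ℝ, (Fin (finrank ℝ F) → ℝ) →L[ℝ] F) ∞ L x₀ := by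
    refine contMDiffAt_finsetSum fun β _ => ?_
    have h1 := hsec _ (c.isFrame.contMDiffOn β)
    exact ((ContinuousLinearMap.smulRightL ℝ (Fin (finrank ℝ F) → ℝ) F (ε β)).contMDiff
      |>.contMDiffAt).comp x₀ h1
  have hLapp : ∀ x ∈ e.baseSet, ∀ v, L x v = (e ⟨x, ∑ β, v β • c.frame β x⟩).2 := by
    intro x hx v
    have h2 : ∀ w : A x, (e ⟨x, w⟩).2 = e.linearEquivAt ℝ x hx w := fun w => rfl
    simp only [h2, map_sum, map_smul, L, ε, sum_apply,
      ContinuousLinearMap.smulRight_apply, ContinuousLinearMap.proj_apply]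
  have key : ∀ x ∈ e.baseSet, ∀ hx : x ∈ c.chart.source, ∃ E : (Fin (finrank ℝ F) → ℝ) ≃L[ℝ] F,
      (E : (Fin (finrank ℝ F) → ℝ) →L[ℝ] F) = L x ∧
      ∀ w : A x, E.symm (e ⟨x, w⟩).2 = fun α => c.isFrame.coeff α x w := by
    intro x hxb hx
    let E : (Fin (finrank ℝ F) → ℝ) ≃L[ℝ] F :=
      ((c.isFrame.toBasisAt hx).equivFun.symm.trans
        (e.linearEquivAt ℝ x hxb)).toContinuousLinearEquiv
    have hE : ∀ v, E v = L x v := by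
      intro v
      rw [hLapp x hxb]
      change e.linearEquivAt ℝ x hxb ((c.isFrame.toBasisAt hx).equivFun.symm v) = _
      rw [Basis.equivFun_symm_apply]
      simp only [IsLocalFrameOn.toBasisAt_coe]
      rfl
    refine ⟨E, ContinuousLinearMap.ext hE, fun w => ?_⟩
    rw [ContinuousLinearEquiv.symm_apply_eq, hE, hLapp x hxb]
    have h3 : ∀ β, c.isFrame.coeff β x w = (c.isFrame.toBasisAt hx).repr w β := fun β => by
      simp [IsLocalFrameOn.coeff, hx]
    have h4 := (c.isFrame.toBasisAt hx).sum_repr w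
    simp only [IsLocalFrameOn.toBasisAt_coe] at h4
    simp only [h3, h4]
  obtain ⟨E, hE, -⟩ := key x₀ hxe hx₀
  have hinv : ContMDiffAt (𝓡 n) 𝓘(ℝ, F →L[ℝ] (Fin (finrank ℝ F) → ℝ)) ∞
      (fun x => ContinuousLinearMap.inverse (L x)) x₀ := by
    have h5 := contDiffAt_map_inverse (n := ∞) E
    rw [hE] at h5
    exact h5.contMDiffAt.comp x₀ hL
  have h6 := ((ContinuousLinearMap.proj (R := ℝ) (φ := fun _ : Fin (finrank ℝ F) => ℝ)
    α).contMDiff (n := ∞) |>.contMDiffAt).comp x₀ (hinv.clm_apply (hsec s hs))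
  refine h6.congr_of_eventuallyEq ?_
  filter_upwards [hnhds, e.open_baseSet.mem_nhds hxe] with x hx hxb
  obtain ⟨E', hE', hE''⟩ := key x hxb hx
  change _ = ContinuousLinearMap.inverse (L x) (e ⟨x, s x⟩).2 α
  rw [← hE', ContinuousLinearMap.inverse_equiv]
  exact (congrFun (hE'' (s x)) α).symm

variable [∀ x, IsTopologicalAddGroup (A x)] [∀ x, ContinuousSMul ℝ (A x)]

/-- Smooth endomorphisms of the vector bundle `A` (over the identity of `M`): smooth sections of
the bundle `End A`. -/
abbrev EndA : Type _ := Cₛ^∞⟮𝓡 n; F →L[ℝ] F, fun x : M => A x →L[ℝ] A x⟯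

variable {F A}

/-- `N² = ε Id` with `ε = -1`, `1` or `0`. -/
def IsAlmostCps (J : EndA (n := n) F A) : Prop :=
  ∃ ε : ℝ, (ε = -1 ∨ ε = 1 ∨ ε = 0) ∧ ∀ (x : M) (v : A x), J x (J x v) = ε • v

/-- `N` is a real multiple of an almost cps structure. -/
def IsProportionalToAlmostCps (N : EndA (n := n) F A) : Prop :=
  ∃ (κ : ℝ) (J : EndA (n := n) F A), IsAlmostCps J ∧ ∀ (x : M) (v : A x), N x v = κ • J x v

variable [FiniteDimensional ℝ F] [ContMDiffVectorBundle ∞ F A (𝓡 n)]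

namespace EndA

/-- The matrix `(N^α_β)` of `N` in a frame: `N e_β = N^α_β e_α`. -/
def mat (N : EndA (n := n) F A) (c : Coords (n := n) F A) :
    Matrix (Fin (finrank ℝ F)) (Fin (finrank ℝ F)) c.Fn :=
  fun α β => ⟨fun m => c.isFrame.coeff α m (N m (c.frame β m)), fun m =>
    contMDiffAt_subtype_iff.2 ((contMDiffOn_coeff c
      (N.contMDiff.contMDiffOn.clm_bundle_apply (c.isFrame.contMDiffOn β)) α).contMDiffAt
        (c.chart.open_source.mem_nhds m.2))⟩

/-- `N` acting on sections of `A`. -/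
def onA (N : EndA (n := n) F A) (c : Coords (n := n) F A) (X : c.SecA) : c.SecA := N.mat c *ᵥ X

/-- The transpose `ᵗN` acting on sections of `A*`. -/
def transpose (N : EndA (n := n) F A) (c : Coords (n := n) F A) (ξ : c.SecAdual) : c.SecAdual :=
  (N.mat c)ᵀ *ᵥ ξ

/-- The skew-symmetric endomorphism `𝒩 = diag(N, -ᵗN)` of `A ⊕ A*`, acting on sections. -/
def double (N : EndA (n := n) F A) (c : Coords (n := n) F A) (u : c.SecE) : c.SecE :=
  (N.onA c u.1, -N.transpose c u.2)

/-- The function `N = N^α_β τ^β θ_α` associated with `N ∈ A* ⊗ A`. -/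
def fn (N : EndA (n := n) F A) : Family (n := n) F A :=
  fun c => ∑ α, ∑ β, N.mat c α β • (c.τ β * c.θ α)

/-- The function `𝒩̃` associated with the skew-symmetric endomorphism `𝒩` of `A ⊕ A*`. -/
def doubleFn (N : EndA (n := n) F A) : Family (n := n) F A := fun c => c.tildeE₂ (N.double c)

/-- The torsion `T_Θ 𝒩` of `𝒩` on `A ⊕ A*` with respect to the derived bracket of `Θ`. -/
def torsionDouble (Θ : Family (n := n) F A) (N : EndA (n := n) F A) (c : Coords (n := n) F A) :
    c.SecE → c.SecE → c.SecE := torsion (c.dorfman (Θ c)) (N.double c)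

/-- The torsion `T_μ N` of `N` on `(A, μ)`. -/
def torsionA (μ : Family (n := n) F A) (N : EndA (n := n) F A) (c : Coords (n := n) F A) :
    c.SecA → c.SecA → c.SecA := torsion (c.bracketA (μ c)) (N.onA c)

/-- The torsion `T_γ ᵗN` of `ᵗN` on `(A*, γ)`. -/
def torsionAdual (γ : Family (n := n) F A) (N : EndA (n := n) F A) (c : Coords (n := n) F A) :
    c.SecAdual → c.SecAdual → c.SecAdual := torsion (c.bracketAdual (γ c)) (N.transpose c)

/-- The function associated with `T_Θ 𝒩`. -/
def torsionDoubleFn (Θ : Family (n := n) F A) (N : EndA (n := n) F A) : Family (n := n) F A :=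
  fun c => c.tildeE₃ (N.torsionDouble Θ c)

/-- The function associated with `T_μ N`. -/
def torsionAFn (μ : Family (n := n) F A) (N : EndA (n := n) F A) : Family (n := n) F A :=
  fun c => c.tildeA (N.torsionA μ c)

/-- The function associated with `T_γ ᵗN`. -/
def torsionAdualFn (γ : Family (n := n) F A) (N : EndA (n := n) F A) : Family (n := n) F A :=
  fun c => c.tildeAdual (N.torsionAdual γ c)

end EndA

end Endomorphisms

end BigBracket

end

/-! Write Θ = μ + γ and D = {N, ·}. In a frame, 𝒩̃ and N^α_β τ^β θ_α are the same function
(`tildeE₂_endDouble`). So the equality in (i) is immediate, and what remains is that {{N, Θ}, N} =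
-D²Θ is a global function of degree 3. The bracket has bidegree (-1, -1) and N has bidegree (1, 1),
hence D preserves bidegrees. It also preserves global functions. Since N contains no momenta, D
restricts at each point to a derivation of the fibre algebra, determined by the value and the first
partial derivatives of the matrix of N. Two coordinate systems then need to be compared only on the
generators τ, θ, p (`FiberAlg.map_matDer`, `Family.IsGlobal.fn_bracket`).

Part (ii) rests on two facts. First, D is a derivation of the bracket
(`SuperCalculus.poisson_poisson`), which is the only case of the graded Jacobi identity that is
needed. Second, D acts on functions of degree one, that is on sections of A ⊕ A*, as -𝒩
(`bracket_endFn_ofSec`). If N = κJ, then 𝒩² = l with l = κ²ε. Applying the Leibniz rule twice to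
{{u, Θ}, v} gives T𝒩(u, v) = {{u, W}, v} with W = ½(D²Θ - lΘ) (`ofSec_torsion`). Moreover D commutes
with ∂/∂p_i, and ∂Θ/∂p_i has degree one, where D² = l. Therefore W contains no momenta
(`dp_torsionGen`). It is a cubic form in the odd coordinates, its derived bracket differentiates no
coefficient, and so T𝒩 is a skew-symmetric 3-tensor. Euler's identity, used three times, shows that
the associated function is -W (`tildeE₃_eq`).

Finally W is linear in Θ and D preserves bidegrees, so W is the sum of a term from μ and a term from
γ. Putting γ = 0 or μ = 0 in the same formula identifies these terms with the torsions of N and of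
ᵗN. This also shows that the torsion functions are global. The explicit formula is the expansion
over A and A*: the components with all three arguments of one kind vanish, and the mixed ones are
brought to standard form by cyclic symmetry (`pairE_torsion`). -/

noncomputable section

namespace BigBracket

/-! ### Differential calculus and supercommutativity of the fibre algebra. -/

namespace FiberAlg

variable {n r : ℕ}

/-- Induction on the generators of `FiberAlg`. -/
theorem induction {C : FiberAlg n r → Prop} (scalar : ∀ t : ℝ, C (algebraMap ℝ _ t))
    (p : ∀ i, C (p i)) (odd : ∀ a, C (odd a)) (add : ∀ x y, C x → C y → C (x + y))
    (mul : ∀ x y, C x → C y → C (x * y)) (x : FiberAlg n r) : C x := by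
  have hP : ∀ q : MvPolynomial (Fin n) ℝ, C (equiv.symm (q ⊗ₜ 1)) := by
    intro q
    induction q using MvPolynomial.induction_on with
    | C t => exact scalar t
    | add q q' h h' =>
      rw [TensorProduct.add_tmul, map_add]
      exact add _ _ h h'
    | mul_X q i h =>
      have e : (q * MvPolynomial.X i) ⊗ₜ[ℝ] (1 : ExteriorAlgebra ℝ (Fin r ⊕ Fin r → ℝ)) =
          (q ⊗ₜ 1) * (MvPolynomial.X i ⊗ₜ 1) := by
        rw [Algebra.TensorProduct.tmul_mul_tmul, one_mul]
      rw [e, map_mul]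
      exact mul _ _ h (p i)
  have hE : ∀ y : ExteriorAlgebra ℝ (Fin r ⊕ Fin r → ℝ),
      C (equiv.symm ((1 : MvPolynomial (Fin n) ℝ) ⊗ₜ y)) := by
    intro y
    induction y using ExteriorAlgebra.induction with
    | algebraMap t =>
      rw [Algebra.algebraMap_eq_smul_one, TensorProduct.tmul_smul, map_smul,
        ← Algebra.TensorProduct.one_def, map_one, ← Algebra.algebraMap_eq_smul_one]
      exact scalar t
    | ι v =>
      have e : equiv.symm ((1 : MvPolynomial (Fin n) ℝ) ⊗ₜ ExteriorAlgebra.ι ℝ v) =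
          ∑ a, algebraMap ℝ (FiberAlg n r) (v a) * FiberAlg.odd a := by
        conv_lhs => rw [pi_eq_sum_univ' v]
        simp only [map_sum, map_smul, TensorProduct.tmul_sum, TensorProduct.tmul_smul,
          ← Algebra.smul_def, FiberAlg.odd]
      rw [e]
      refine Finset.sum_induction _ C (fun x y => add x y) (by simpa using scalar 0)
        fun a _ => mul _ _ (scalar _) (odd a)
    | mul y z h h' =>
      have e : (1 : MvPolynomial (Fin n) ℝ) ⊗ₜ[ℝ] (y * z) = (1 ⊗ₜ y) * (1 ⊗ₜ z) := by
        rw [Algebra.TensorProduct.tmul_mul_tmul, one_mul]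
      rw [e, map_mul]
      exact mul _ _ h h'
    | add y z h h' =>
      rw [TensorProduct.tmul_add, map_add]
      exact add _ _ h h'
  have key : ∀ z : MvPolynomial (Fin n) ℝ ⊗[ℝ] ExteriorAlgebra ℝ (Fin r ⊕ Fin r → ℝ),
      C (equiv.symm z) := by
    intro z
    induction z with
    | zero => simpa using scalar 0
    | tmul q y =>
      have e : q ⊗ₜ[ℝ] y = (q ⊗ₜ 1) * (1 ⊗ₜ y) := by
        rw [Algebra.TensorProduct.tmul_mul_tmul, one_mul, mul_one]
      rw [e, map_mul]
      exact mul _ _ (hP q) (hE y)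
    | add y z h h' =>
      rw [map_add]
      exact add _ _ h h'
  exact key x

/-- The parity automorphism: `-1` on the odd coordinates, `1` on the momenta. -/
def parity : FiberAlg n r →ₐ[ℝ] FiberAlg n r :=
  (equiv.symm.toAlgHom.comp (Algebra.TensorProduct.map (AlgHom.id ℝ _)
    (CliffordAlgebra.involute (Q := 0)))).comp equiv.toAlgHom

theorem parity_tmul (q : MvPolynomial (Fin n) ℝ) (y : ExteriorAlgebra ℝ (Fin r ⊕ Fin r → ℝ)) :
    parity (equiv.symm (q ⊗ₜ y)) =
      equiv.symm (q ⊗ₜ[ℝ] CliffordAlgebra.involute (Q := 0) y) := rfl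

theorem dLeft_tmul (a : Fin r ⊕ Fin r) (q : MvPolynomial (Fin n) ℝ)
    (y : ExteriorAlgebra ℝ (Fin r ⊕ Fin r → ℝ)) :
    dLeft a (equiv.symm (q ⊗ₜ y)) =
      equiv.symm (q ⊗ₜ[ℝ] CliffordAlgebra.contractLeft (Q := 0) (LinearMap.proj a) y) := rfl

theorem dRight_tmul (a : Fin r ⊕ Fin r) (q : MvPolynomial (Fin n) ℝ)
    (y : ExteriorAlgebra ℝ (Fin r ⊕ Fin r → ℝ)) :
    dRight a (equiv.symm (q ⊗ₜ y)) =
      equiv.symm (q ⊗ₜ[ℝ] CliffordAlgebra.contractRight (Q := 0) y (LinearMap.proj a)) := rfl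

theorem dp_tmul (i : Fin n) (q : MvPolynomial (Fin n) ℝ)
    (y : ExteriorAlgebra ℝ (Fin r ⊕ Fin r → ℝ)) :
    dp i (equiv.symm (q ⊗ₜ y)) = equiv.symm (MvPolynomial.pderiv i q ⊗ₜ[ℝ] y) := rfl

theorem tmul_mul_tmul (q q' : MvPolynomial (Fin n) ℝ)
    (y y' : ExteriorAlgebra ℝ (Fin r ⊕ Fin r → ℝ)) :
    (equiv.symm (q ⊗ₜ[ℝ] y) * equiv.symm (q' ⊗ₜ[ℝ] y') : FiberAlg n r) =
      equiv.symm ((q * q') ⊗ₜ[ℝ] (y * y')) := by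
  rw [← map_mul, Algebra.TensorProduct.tmul_mul_tmul]

theorem tmul_induction {C : FiberAlg n r → Prop} (zero : C 0)
    (tmul : ∀ q y, C (equiv.symm (q ⊗ₜ y))) (add : ∀ x y, C x → C y → C (x + y))
    (x : FiberAlg n r) : C x :=
  TensorProduct.induction_on (motive := fun z => C (equiv.symm z)) (equiv x) zero tmul add

/-- Contraction is governed by its rule for left multiplication by a vector, so the graded Leibniz
rule follows by splitting vectors off the left factor one at a time. -/
theorem _root_.CliffordAlgebra.contractLeft_mul {R V : Type*} [CommRing R] [AddCommGroup V]
    [Module R V] {Q : QuadraticForm R V} (d : Module.Dual R V) (x y : CliffordAlgebra Q) :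
    CliffordAlgebra.contractLeft d (x * y) = CliffordAlgebra.contractLeft d x * y +
      CliffordAlgebra.involute x * CliffordAlgebra.contractLeft d y := by
  induction x using CliffordAlgebra.left_induction with
  | algebraMap t =>
    rw [CliffordAlgebra.contractLeft_algebraMap_mul, CliffordAlgebra.contractLeft_algebraMap,
      AlgHom.commutes, zero_mul, zero_add]
  | add x x' h h' =>
    rw [add_mul, map_add, h, h', map_add, map_add, add_mul, add_mul]
    abel
  | ι_mul x v h =>
    rw [mul_assoc, CliffordAlgebra.contractLeft_ι_mul, h, CliffordAlgebra.contractLeft_ι_mul,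
      map_mul, CliffordAlgebra.involute_ι]
    simp only [sub_mul, mul_add, smul_mul_assoc, neg_mul, mul_assoc]
    abel

theorem _root_.CliffordAlgebra.involute_contractLeft {R V : Type*} [CommRing R] [AddCommGroup V]
    [Module R V] {Q : QuadraticForm R V} (d : Module.Dual R V) (x : CliffordAlgebra Q) :
    CliffordAlgebra.involute (CliffordAlgebra.contractLeft d x) =
      -CliffordAlgebra.contractLeft d (CliffordAlgebra.involute x) := by
  induction x using CliffordAlgebra.left_induction with
  | algebraMap t => simp
  | add x x' h h' =>
    simp only [map_add, h, h']
    abel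
  | ι_mul x v h =>
    simp only [CliffordAlgebra.contractLeft_ι_mul, map_sub, map_smul, map_mul,
      CliffordAlgebra.involute_ι, h, neg_mul, map_neg]
    simp

/-- A factor removed from the right end instead of the left end has passed all the remaining
factors, which costs the sign of their parity. This lets right derivatives be eliminated from the
bracket. -/
theorem _root_.CliffordAlgebra.contractRight_eq_involute_contractLeft {R V : Type*} [CommRing R]
    [AddCommGroup V] [Module R V] {Q : QuadraticForm R V} (d : Module.Dual R V)
    (x : CliffordAlgebra Q) :
    CliffordAlgebra.contractRight x d =
      CliffordAlgebra.involute (CliffordAlgebra.contractLeft d x) := by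
  induction x using CliffordAlgebra.right_induction with
  | algebraMap t => simp
  | add x x' h h' => simp only [map_add, LinearMap.add_apply, h, h']
  | mul_ι v x h =>
    rw [CliffordAlgebra.contractRight_mul_ι, CliffordAlgebra.contractLeft_mul, h, map_add, map_mul,
      map_mul, CliffordAlgebra.involute_involute, CliffordAlgebra.contractLeft_ι, AlgHom.commutes,
      CliffordAlgebra.involute_ι, ← Algebra.commutes, ← Algebra.smul_def]
    simp only [mul_neg]
    abel

theorem parity_parity (x : FiberAlg n r) : parity (parity x) = x := by
  induction x using tmul_induction with
  | zero => simp
  | tmul q y => rw [parity_tmul, parity_tmul, CliffordAlgebra.involute_involute]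
  | add x y h h' => simp only [map_add, h, h']

@[simp] theorem parity_p (i : Fin n) : parity (p i : FiberAlg n r) = p i := by
  rw [p, parity_tmul, map_one]

@[simp] theorem parity_odd (a : Fin r ⊕ Fin r) : parity (odd a : FiberAlg n r) = -odd a := by
  rw [odd, parity_tmul, ExteriorAlgebra.ι, CliffordAlgebra.involute_ι, TensorProduct.tmul_neg,
    map_neg]

theorem dRight_eq (a : Fin r ⊕ Fin r) (x : FiberAlg n r) : dRight a x = parity (dLeft a x) := by
  induction x using tmul_induction with
  | zero => simp
  | tmul q y =>
    rw [dRight_tmul, dLeft_tmul, parity_tmul,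
      CliffordAlgebra.contractRight_eq_involute_contractLeft]
  | add x y h h' => simp only [map_add, h, h']

theorem dLeft_mul (a : Fin r ⊕ Fin r) (x y : FiberAlg n r) :
    dLeft a (x * y) = dLeft a x * y + parity x * dLeft a y := by
  induction x using tmul_induction with
  | zero => simp
  | add x x' h h' =>
    simp only [map_add, add_mul, h, h']
    abel
  | tmul q z =>
    induction y using tmul_induction with
    | zero => simp
    | add x x' h h' =>
      simp only [map_add, mul_add, h, h']
      abel
    | tmul q' z' =>
      simp only [tmul_mul_tmul, dLeft_tmul, parity_tmul]
      rw [CliffordAlgebra.contractLeft_mul, TensorProduct.tmul_add, map_add]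

theorem dp_mul (i : Fin n) (x y : FiberAlg n r) : dp i (x * y) = dp i x * y + x * dp i y := by
  induction x using tmul_induction with
  | zero => simp
  | add x x' h h' =>
    simp only [map_add, add_mul, h, h']
    abel
  | tmul q z =>
    induction y using tmul_induction with
    | zero => simp
    | add x x' h h' =>
      simp only [map_add, mul_add, h, h']
      abel
    | tmul q' z' =>
      simp only [tmul_mul_tmul, dp_tmul]
      rw [Derivation.leibniz, TensorProduct.add_tmul, map_add, smul_eq_mul, smul_eq_mul,
        mul_comm q', add_comm]

theorem parity_dLeft (a : Fin r ⊕ Fin r) (x : FiberAlg n r) :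
    parity (dLeft a x) = -dLeft a (parity x) := by
  induction x using tmul_induction with
  | zero => simp
  | add x x' h h' =>
    simp only [map_add, h, h']
    abel
  | tmul q z =>
    rw [dLeft_tmul, parity_tmul, parity_tmul, dLeft_tmul, CliffordAlgebra.involute_contractLeft,
      TensorProduct.tmul_neg, map_neg]

theorem parity_dp (i : Fin n) (x : FiberAlg n r) : parity (dp i x) = dp i (parity x) := by
  induction x using tmul_induction with
  | zero => simp
  | add x x' h h' => simp only [map_add, h, h']
  | tmul q z => rfl

theorem dp_dLeft (i : Fin n) (a : Fin r ⊕ Fin r) (x : FiberAlg n r) :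
    dp i (dLeft a x) = dLeft a (dp i x) := by
  induction x using tmul_induction with
  | zero => simp
  | add x x' h h' => simp only [map_add, h, h']
  | tmul q z => rfl

theorem dp_dp (i j : Fin n) (x : FiberAlg n r) : dp i (dp j x) = dp j (dp i x) := by
  induction x using tmul_induction with
  | zero => simp
  | add x x' h h' => simp only [map_add, h, h']
  | tmul q z =>
    rw [dp_tmul, dp_tmul, dp_tmul, dp_tmul]
    congr 2
    induction q using MvPolynomial.induction_on with
    | C t => simp
    | add q q' h h' => simp only [map_add, h, h']
    | mul_X q k h =>
      simp only [Derivation.leibniz, map_add, MvPolynomial.pderiv_X, smul_eq_mul, h]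
      simp only [Pi.single_apply]
      split_ifs <;> simp <;> ring

theorem dLeft_dLeft (a b : Fin r ⊕ Fin r) (x : FiberAlg n r) :
    dLeft a (dLeft b x) = -dLeft b (dLeft a x) := by
  induction x using tmul_induction with
  | zero => simp
  | add x x' h h' =>
    simp only [map_add, h, h']
    abel
  | tmul q z =>
    simp only [dLeft_tmul]
    rw [CliffordAlgebra.contractLeft_comm, TensorProduct.tmul_neg, map_neg]

@[simp] theorem dLeft_one (a : Fin r ⊕ Fin r) : dLeft a (1 : FiberAlg n r) = 0 := by
  have h := dLeft_mul a (1 : FiberAlg n r) 1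
  simpa using h

@[simp] theorem dp_one (i : Fin n) : dp i (1 : FiberAlg n r) = 0 := by
  have h := dp_mul i (1 : FiberAlg n r) 1
  simpa using h

@[simp] theorem dLeft_p (a : Fin r ⊕ Fin r) (i : Fin n) : dLeft a (p i : FiberAlg n r) = 0 := by
  rw [p, dLeft_tmul, CliffordAlgebra.contractLeft_one, TensorProduct.tmul_zero, map_zero]

@[simp] theorem dLeft_odd (a b : Fin r ⊕ Fin r) :
    dLeft a (odd b : FiberAlg n r) = if a = b then 1 else 0 := by
  rw [odd, dLeft_tmul, ExteriorAlgebra.ι, CliffordAlgebra.contractLeft_ι, LinearMap.proj_apply,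
    Pi.single_apply]
  split_ifs
  · rw [map_one, ← Algebra.TensorProduct.one_def, map_one]
  · rw [map_zero, TensorProduct.tmul_zero, map_zero]

@[simp] theorem dp_p (i j : Fin n) : dp i (p j : FiberAlg n r) = if i = j then 1 else 0 := by
  rw [p, dp_tmul, MvPolynomial.pderiv_X, Pi.single_apply]
  by_cases h : i = j
  · subst h
    rw [if_pos rfl, if_pos rfl, ← Algebra.TensorProduct.one_def, map_one]
  · rw [if_neg (Ne.symm h), if_neg h, TensorProduct.zero_tmul, map_zero]

@[simp] theorem dp_odd (i : Fin n) (a : Fin r ⊕ Fin r) : dp i (odd a : FiberAlg n r) = 0 := by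
  rw [odd, dp_tmul, ← map_one (algebraMap ℝ (MvPolynomial (Fin n) ℝ)), Derivation.map_algebraMap,
    TensorProduct.zero_tmul, map_zero]

theorem p_mul (i : Fin n) (x : FiberAlg n r) : p i * x = x * p i := by
  induction x using tmul_induction with
  | zero => simp
  | add x x' h h' => simp only [mul_add, add_mul, h, h']
  | tmul q z => rw [p, tmul_mul_tmul, tmul_mul_tmul, mul_comm, one_mul, mul_one]

theorem odd_mul (a : Fin r ⊕ Fin r) (x : FiberAlg n r) : odd a * x = parity x * odd a := by
  have hE : ∀ y : ExteriorAlgebra ℝ (Fin r ⊕ Fin r → ℝ), ∀ v,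
      ExteriorAlgebra.ι ℝ v * y =
        CliffordAlgebra.involute (Q := 0) y * ExteriorAlgebra.ι ℝ v := by
    intro y v
    induction y using ExteriorAlgebra.induction with
    | algebraMap t =>
      rw [AlgHom.commutes]
      exact (Algebra.commutes _ _).symm
    | ι w =>
      rw [ExteriorAlgebra.ι, CliffordAlgebra.involute_ι, neg_mul, eq_neg_iff_add_eq_zero]
      exact ExteriorAlgebra.ι_add_mul_swap v w
    | mul y z h h' => rw [map_mul, ← mul_assoc, h, mul_assoc, h', mul_assoc]
    | add y z h h' => rw [map_add, mul_add, h, h', add_mul]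
  induction x using tmul_induction with
  | zero => simp
  | add x x' h h' => simp only [map_add, mul_add, add_mul, h, h']
  | tmul q z => rw [odd, parity_tmul, tmul_mul_tmul, tmul_mul_tmul, hE, one_mul, mul_one]

/-- Twice the even part of `y` is central, twice the odd part of `y` supercommutes. -/
theorem add_parity_mul (y : FiberAlg n r) : ∀ x : FiberAlg n r,
    (y + parity y) * x = x * (y + parity y) ∧ (y - parity y) * x = parity x * (y - parity y) := by
  induction y using induction with
  | scalar t =>
    intro x
    rw [AlgHom.commutes, sub_self, ← map_add, Algebra.commutes, zero_mul, mul_zero]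
    exact ⟨rfl, rfl⟩
  | p i =>
    intro x
    simp [mul_add, add_mul, p_mul]
  | odd a =>
    intro x
    simp [mul_add, add_mul, odd_mul]
  | add y z h h' =>
    intro x
    have e : y + z + parity (y + z) = (y + parity y) + (z + parity z) := by
      rw [map_add]; abel
    have e' : y + z - parity (y + z) = (y - parity y) + (z - parity z) := by
      rw [map_add]; abel
    rw [e, e']
    generalize hu : y + parity y = u at h
    generalize hv : y - parity y = v at h
    generalize hu' : z + parity z = u' at h'
    generalize hv' : z - parity z = v' at h'
    rw [add_mul, add_mul, mul_add, mul_add, (h x).1, (h x).2, (h' x).1, (h' x).2]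
    exact ⟨rfl, rfl⟩
  | mul y z h h' =>
    intro x
    -- The even part of a product is even·even + odd·odd, the odd part even·odd + odd·even. Each
    -- factor on the right is twice a homogeneous part, whence the coefficient ½.
    have e : y * z + parity (y * z) = (2⁻¹ : ℝ) •
        ((y + parity y) * (z + parity z) + (y - parity y) * (z - parity z)) := by
      rw [eq_inv_smul_iff₀ two_ne_zero, two_smul, map_mul]
      noncomm_ring
    have e' : y * z - parity (y * z) = (2⁻¹ : ℝ) •
        ((y + parity y) * (z - parity z) + (y - parity y) * (z + parity z)) := by
      rw [eq_inv_smul_iff₀ two_ne_zero, two_smul, map_mul]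
      noncomm_ring
    rw [e, e', smul_mul_assoc, smul_mul_assoc, mul_smul_comm, mul_smul_comm]
    generalize y + parity y = u at h
    generalize y - parity y = v at h
    generalize z + parity z = u' at h'
    generalize z - parity z = v' at h'
    constructor
    · rw [add_mul, mul_add, mul_assoc, (h' x).1, ← mul_assoc, (h x).1, mul_assoc,
        mul_assoc v, (h' x).2, ← mul_assoc v, (h _).2, parity_parity, mul_assoc]
    · rw [add_mul, mul_add, mul_assoc, (h' x).2, ← mul_assoc, (h _).1, mul_assoc,
        mul_assoc v, (h' x).1, ← mul_assoc v, (h _).2, mul_assoc]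

end FiberAlg

end BigBracket

end

/-! ### Abstract graded Poisson calculus and the Hamiltonian vector field of a momentum-free even
function. -/

noncomputable section

namespace BigBracket

/-- The calculus of a supercommutative algebra with even derivations `dEven i` and odd (left)
derivations `dOdd a` which are the coordinate derivatives of even and odd coordinates, where the odd
coordinates come in conjugate pairs `inl α`, `inr α`. -/
structure SuperCalculus (n r : ℕ) (L : Type*) [Ring L] [Algebra ℝ L] where
  /-- the parity automorphism -/
  parity : L →ₐ[ℝ] L
  /-- the derivatives with respect to the even coordinates -/
  dEven : Fin n → L →ₗ[ℝ] L
  /-- the left derivatives with respect to the odd coordinates -/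
  dOdd : Fin r ⊕ Fin r → L →ₗ[ℝ] L
  parity_parity (x : L) : parity (parity x) = x
  even_mul {y : L} (hy : parity y = y) (x : L) : y * x = x * y
  odd_mul {y : L} (hy : parity y = -y) (x : L) : y * x = parity x * y
  dEven_mul (i : Fin n) (x y : L) : dEven i (x * y) = dEven i x * y + x * dEven i y
  dOdd_mul (a : Fin r ⊕ Fin r) (x y : L) : dOdd a (x * y) = dOdd a x * y + parity x * dOdd a y
  parity_dEven (i : Fin n) (x : L) : parity (dEven i x) = dEven i (parity x)
  parity_dOdd (a : Fin r ⊕ Fin r) (x : L) : parity (dOdd a x) = -dOdd a (parity x)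
  dEven_dEven (i j : Fin n) (x : L) : dEven i (dEven j x) = dEven j (dEven i x)
  dEven_dOdd (i : Fin n) (a : Fin r ⊕ Fin r) (x : L) : dEven i (dOdd a x) = dOdd a (dEven i x)
  dOdd_dOdd (a b : Fin r ⊕ Fin r) (x : L) : dOdd a (dOdd b x) = -dOdd b (dOdd a x)

namespace SuperCalculus

variable {n r : ℕ} {L : Type*} [Ring L] [Algebra ℝ L] (S : SuperCalculus n r L)

/-- The Hamiltonian vector field of an even function `f` which does not depend on the momenta;
`f' i` are its derivatives along the base. -/
def ham (f : L) (f' : Fin n → L) : L →ₗ[ℝ] L :=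
  ∑ i, LinearMap.mulLeft ℝ (f' i) ∘ₗ S.dEven i +
    ∑ a, LinearMap.mulLeft ℝ (S.parity (S.dOdd a f)) ∘ₗ S.dOdd a.swap

theorem ham_apply (f : L) (f' : Fin n → L) (y : L) : S.ham f f' y =
    ∑ i, f' i * S.dEven i y + ∑ a, S.parity (S.dOdd a f) * S.dOdd a.swap y := by
  simp [ham]

/-- The base coefficients `f' i` are even and commute with `x`. The coefficients built from odd
derivatives of `f` are odd, and the sign from moving them past `x` cancels the sign in the graded
Leibniz rule of `dOdd`. -/
theorem ham_mul {f : L} {f' : Fin n → L} (hf : S.parity f = f) (hf' : ∀ i, S.parity (f' i) = f' i)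
    (x y : L) : S.ham f f' (x * y) = S.ham f f' x * y + x * S.ham f f' y := by
  have h : ∀ a, S.parity (S.parity (S.dOdd a f)) = -S.parity (S.dOdd a f) := fun a => by
    rw [S.parity_parity, S.parity_dOdd, neg_neg, hf]
  simp only [ham_apply, S.dEven_mul, S.dOdd_mul, mul_add, add_mul, Finset.sum_add_distrib,
    Finset.sum_mul, Finset.mul_sum, ← mul_assoc]
  have h1 : ∀ i, f' i * x = x * f' i := fun i => S.even_mul (hf' i) x
  have h2 : ∀ a, S.parity (S.dOdd a f) * S.parity x = x * S.parity (S.dOdd a f) := fun a => by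
    rw [S.odd_mul (h a), S.parity_parity]
  simp only [h1, h2]
  abel

/-- `d i` are the coordinate derivatives of further even coordinates. -/
structure IsHorizontal (d : Fin n → L →ₗ[ℝ] L) : Prop where
  d_mul (i : Fin n) (x y : L) : d i (x * y) = d i x * y + x * d i y
  parity_d (i : Fin n) (x : L) : S.parity (d i x) = d i (S.parity x)
  d_d (i j : Fin n) (x : L) : d i (d j x) = d j (d i x)
  d_dEven (i j : Fin n) (x : L) : d i (S.dEven j x) = S.dEven j (d i x)
  d_dOdd (i : Fin n) (a : Fin r ⊕ Fin r) (x : L) : d i (S.dOdd a x) = S.dOdd a (d i x)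

/-- The canonical Poisson bracket of degree `-2`. -/
def poisson (d : Fin n → L →ₗ[ℝ] L) (f g : L) : L :=
  ∑ i, (d i f * S.dEven i g - S.dEven i f * d i g) +
    ∑ a, S.parity (S.dOdd a f) * S.dOdd a.swap g

variable {S} {d : Fin n → L →ₗ[ℝ] L}

theorem poisson_add_left (f f' g : L) :
    S.poisson d (f + f') g = S.poisson d f g + S.poisson d f' g := by
  simp only [poisson, map_add, add_mul, Finset.sum_add_distrib, Finset.sum_sub_distrib]
  abel

theorem poisson_add_right (f g g' : L) :
    S.poisson d f (g + g') = S.poisson d f g + S.poisson d f g' := by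
  simp only [poisson, map_add, mul_add, Finset.sum_add_distrib, Finset.sum_sub_distrib]
  abel

theorem poisson_smul_left (t : ℝ) (f g : L) : S.poisson d (t • f) g = t • S.poisson d f g := by
  simp only [poisson, map_smul, smul_mul_assoc, Finset.smul_sum, smul_add, smul_sub]

theorem poisson_smul_right (t : ℝ) (f g : L) : S.poisson d f (t • g) = t • S.poisson d f g := by
  simp only [poisson, map_smul, mul_smul_comm, Finset.smul_sum, smul_add, smul_sub]

theorem poisson_neg_left (f g : L) : S.poisson d (-f) g = -S.poisson d f g := by
  simpa using poisson_smul_left (S := S) (d := d) (-1) f g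

theorem poisson_neg_right (f g : L) : S.poisson d f (-g) = -S.poisson d f g := by
  simpa using poisson_smul_right (S := S) (d := d) (-1) f g

theorem sum_swap {G : Type*} [AddCommMonoid G] (u : Fin r ⊕ Fin r → G) :
    ∑ a : Fin r ⊕ Fin r, u a.swap = ∑ a, u a :=
  (Equiv.sumComm (Fin r) (Fin r)).sum_comp u

theorem poisson_eq_ham {N : L} (hp : ∀ i, S.dEven i N = 0)
    (f : L) : S.poisson d N f = S.ham N (fun i => d i N) f := by
  simp only [poisson, ham_apply, hp, zero_mul, sub_zero]

theorem parity_poisson {N : L} (hN : S.parity N = N) (hp : ∀ i, S.dEven i N = 0)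
    (hd : S.IsHorizontal d) (f : L) :
    S.parity (S.poisson d N f) = S.poisson d N (S.parity f) := by
  simp only [poisson_eq_ham hp, ham_apply, map_add, map_sum, map_mul, S.parity_dEven, hd.parity_d,
    S.parity_dOdd, hN, map_neg, neg_neg, mul_neg, neg_mul]

theorem poisson_mul {N : L} (hN : S.parity N = N) (hp : ∀ i, S.dEven i N = 0)
    (hd : S.IsHorizontal d) (f g : L) :
    S.poisson d N (f * g) = S.poisson d N f * g + f * S.poisson d N g := by
  simp only [poisson_eq_ham hp]
  exact S.ham_mul hN (fun i => by rw [hd.parity_d, hN]) f g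

/-- Only the parities of the derivatives of `N` matter: they can be moved across derivatives of an
arbitrary `f`, and exchanging the members of each conjugate pair then matches the two sums. -/
theorem poisson_antisymm {N : L} (hN : S.parity N = N) (hp : ∀ i, S.dEven i N = 0)
    (hd : S.IsHorizontal d) (f : L) :
    S.poisson d f N = -S.poisson d N f := by
  have h1 : ∀ i, S.dEven i f * d i N = d i N * S.dEven i f := fun i =>
    (S.even_mul (by rw [hd.parity_d, hN]) _).symm
  have h2 : ∀ a, S.parity (S.dOdd a f) * S.dOdd a.swap N = S.dOdd a.swap N * S.dOdd a f :=
    fun a => (S.odd_mul (by rw [S.parity_dOdd, hN]) _).symm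
  have h3 : ∀ a, S.parity (S.dOdd a N) = -S.dOdd a N := fun a => by rw [S.parity_dOdd, hN]
  have h4 := sum_swap fun a => S.dOdd a N * S.dOdd a.swap f
  simp only [Sum.swap_swap] at h4
  simp only [poisson, hp, mul_zero, zero_mul, zero_sub, sub_zero, h1, h2, h3, neg_mul,
    Finset.sum_neg_distrib, h4]
  abel

theorem poisson_dEven {N : L} (hp : ∀ i, S.dEven i N = 0)
    (hd : S.IsHorizontal d) (i : Fin n) (f : L) :
    S.dEven i (S.poisson d N f) = S.poisson d N (S.dEven i f) := by
  simp only [poisson_eq_ham hp, ham_apply, map_add, map_sum, S.dEven_mul, ← S.parity_dEven,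
    S.dEven_dOdd, ← hd.d_dEven, hp, map_zero, zero_mul, zero_add, S.dEven_dEven i]

/-- A coordinate derivative fails to commute with {N, ·} only through the coefficients of this
vector field, which yields the bracket with the derivative of `N`. For momentum derivatives this
defect is zero. -/
theorem poisson_d {N : L} (hp : ∀ i, S.dEven i N = 0)
    (hd : S.IsHorizontal d) (i : Fin n) (f : L) :
    S.poisson d N (d i f) = d i (S.poisson d N f) - S.poisson d (d i N) f := by
  have hp' : ∀ j, S.dEven j (d i N) = 0 := fun j => by rw [← hd.d_dEven, hp, map_zero]
  simp only [poisson_eq_ham hp, poisson_eq_ham hp', ham_apply, map_add, map_sum, hd.d_mul,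
    ← hd.parity_d, hd.d_dOdd, hd.d_dEven, hd.d_d i, Finset.sum_add_distrib]
  abel

theorem poisson_dOdd {N : L} (hN : S.parity N = N) (hp : ∀ i, S.dEven i N = 0)
    (hd : S.IsHorizontal d) (a : Fin r ⊕ Fin r) (f : L) :
    S.poisson d N (S.dOdd a f) = S.dOdd a (S.poisson d N f) - S.poisson d (S.dOdd a N) f := by
  have hp' : ∀ j, S.dEven j (S.dOdd a N) = 0 := fun j => by rw [S.dEven_dOdd, hp, map_zero]
  have h1 : ∀ j, S.parity (d j N) = d j N := fun j => by rw [hd.parity_d, hN]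
  simp only [poisson_eq_ham hp, poisson_eq_ham hp', ham_apply, map_add, map_sum, S.dOdd_mul,
    ← S.dEven_dOdd, h1, hd.d_dOdd, S.parity_dOdd, hN, Finset.sum_add_distrib,
    map_neg, neg_mul, mul_neg, neg_neg, S.dOdd_dOdd a, Finset.sum_neg_distrib]
  abel

/-- The Hamiltonian vector field of an even function which does not depend on the momenta is a
derivation of the Poisson bracket. -/
theorem poisson_poisson {N : L} (hN : S.parity N = N) (hp : ∀ i, S.dEven i N = 0)
    (hd : S.IsHorizontal d) (f g : L) :
    S.poisson d N (S.poisson d f g) =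
      S.poisson d (S.poisson d N f) g + S.poisson d f (S.poisson d N g) := by
  have hdN : ∀ i, S.parity (d i N) = d i N := fun i => by rw [hd.parity_d, hN]
  have hpdN : ∀ i j, S.dEven j (d i N) = 0 := fun i j => by rw [← hd.d_dEven, hp, map_zero]
  have hpoN : ∀ a j, S.dEven j (S.dOdd a N) = 0 := fun a j => by rw [S.dEven_dOdd, hp, map_zero]
  have hodd : ∀ a i, S.parity (S.dOdd a (d i N)) = -S.dOdd a (d i N) := fun a i => by
    rw [S.parity_dOdd, hdN]
  have heven : ∀ a b, S.parity (S.dOdd a (S.dOdd b N)) = S.dOdd a (S.dOdd b N) := fun a b => by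
    rw [S.parity_dOdd, S.parity_dOdd, hN, map_neg, neg_neg]
  -- The brackets with first derivatives of `N` are written out, so that the error terms below
  -- become sums over second derivatives of `N`.
  have hB : ∀ i h, S.poisson d (d i N) h = ∑ j, d j (d i N) * S.dEven j h -
      ∑ a, S.dOdd a (d i N) * S.dOdd a.swap h := fun i h => by
    simp only [poisson_eq_ham (hpdN i), ham_apply, hodd, neg_mul, Finset.sum_neg_distrib]
    abel
  have hC : ∀ a h, S.poisson d (S.dOdd a N) h = ∑ j, S.dOdd a (d j N) * S.dEven j h +
      ∑ b, S.dOdd b (S.dOdd a N) * S.dOdd b.swap h := fun a h => by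
    simp only [poisson_eq_ham (hpoN a), ham_apply, heven, hd.d_dOdd]
  -- The Leibniz rule and the commutators with the coordinate derivatives give the claim up to an
  -- error in which `N` is differentiated twice.
  have main : ∀ f g, S.poisson d N (S.poisson d f g) =
      S.poisson d (S.poisson d N f) g + S.poisson d f (S.poisson d N g) -
      (∑ i, (S.poisson d (d i N) f * S.dEven i g - S.dEven i f * S.poisson d (d i N) g) +
        ∑ a, (S.parity (S.poisson d (S.dOdd a N) f) * S.dOdd a.swap g +
          S.parity (S.dOdd a f) * S.poisson d (S.dOdd a.swap N) g)) := by
    intro f g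
    have e : ∀ u v, S.poisson d u v = ∑ i, (d i u * S.dEven i v - S.dEven i u * d i v) +
      ∑ a, S.parity (S.dOdd a u) * S.dOdd a.swap v := fun u v => rfl
    have hsum : ∀ (u : Fin n → L), S.poisson d N (∑ i, u i) = ∑ i, S.poisson d N (u i) := by
      intro u
      simp only [poisson_eq_ham hp, map_sum]
    have hsum' : ∀ (u : Fin r ⊕ Fin r → L),
        S.poisson d N (∑ i, u i) = ∑ i, S.poisson d N (u i) := by
      intro u
      simp only [poisson_eq_ham hp, map_sum]
    have hsub : ∀ u v, S.poisson d N (u - v) = S.poisson d N u - S.poisson d N v := by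
      intro u v
      simp only [poisson_eq_ham hp, map_sub]
    rw [e f g, e (S.poisson d N f) g, e f (S.poisson d N g), poisson_add_right, hsum, hsum']
    simp only [hsub, poisson_mul hN hp hd, poisson_d hp hd, poisson_dOdd hN hp hd,
      poisson_dEven hp hd, ← parity_poisson hN hp hd, map_sub, sub_mul, mul_sub,
      Finset.sum_add_distrib, Finset.sum_sub_distrib]
    abel
  rw [main, sub_eq_self]
  -- The error cancels in pairs by the symmetry of second derivatives: base-base terms in `k1`,
  -- mixed ones in `k2` and `k3`, and odd-odd ones, with their anticommuting derivatives, in `k4`.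
  have k1 : ∑ i, ∑ j, d j (d i N) * S.dEven j f * S.dEven i g =
      ∑ i, ∑ j, S.dEven i f * (d j (d i N) * S.dEven j g) := by
    rw [Finset.sum_comm]
    refine Finset.sum_congr rfl fun i _ => Finset.sum_congr rfl fun j _ => ?_
    rw [← mul_assoc, ← S.even_mul (y := d j (d i N)) (by rw [hd.parity_d, hdN]), hd.d_d]
  have k2 : ∑ i, ∑ a, S.dOdd a (d i N) * S.dOdd a.swap f * S.dEven i g =
      ∑ a, ∑ i, S.parity (S.dOdd a f) * (S.dOdd a.swap (d i N) * S.dEven i g) := by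
    rw [Finset.sum_comm, ← sum_swap]
    refine Finset.sum_congr rfl fun a _ => Finset.sum_congr rfl fun i _ => ?_
    rw [← mul_assoc, Sum.swap_swap, S.odd_mul (hodd _ i)]
  have k3 : ∑ i, ∑ a, S.dEven i f * (S.dOdd a (d i N) * S.dOdd a.swap g) =
      -∑ a, ∑ i, S.parity (S.dOdd a (d i N) * S.dEven i f) * S.dOdd a.swap g := by
    rw [Finset.sum_comm, ← Finset.sum_neg_distrib]
    refine Finset.sum_congr rfl fun a _ => ?_
    rw [← Finset.sum_neg_distrib]
    refine Finset.sum_congr rfl fun i _ => ?_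
    rw [map_mul, hodd, neg_mul, S.odd_mul (hodd a i) (S.parity _), S.parity_parity, neg_mul,
      neg_neg, mul_assoc]
  have k4 : ∑ a, ∑ b, S.parity (S.dOdd b (S.dOdd a N) * S.dOdd b.swap f) * S.dOdd a.swap g =
      -∑ a, ∑ b, S.parity (S.dOdd a f) * (S.dOdd b (S.dOdd a.swap N) * S.dOdd b.swap g) := by
    rw [Finset.sum_comm, ← Finset.sum_neg_distrib, ← sum_swap]
    refine Finset.sum_congr rfl fun a _ => ?_
    rw [← Finset.sum_neg_distrib]
    refine Finset.sum_congr rfl fun b _ => ?_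
    rw [map_mul, heven, Sum.swap_swap, ← mul_assoc, ← S.even_mul (heven _ _), S.dOdd_dOdd, neg_mul,
      neg_mul]
  simp only [hB, hC, map_add, map_sum, add_mul, sub_mul, mul_add, mul_sub, Finset.sum_add_distrib,
    Finset.sum_sub_distrib, Finset.sum_mul, Finset.mul_sum, k1, k2, k3, k4]
  abel

/-! ### Extension of scalars -/

/-- The extension of scalars of a calculus to `R ⊗ L`. -/
def baseChange (R : Type*) [CommRing R] [Algebra ℝ R] (S : SuperCalculus n r L) :
    SuperCalculus n r (R ⊗[ℝ] L) where
  parity := Algebra.TensorProduct.map (AlgHom.id ℝ R) S.parity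
  dEven i := LinearMap.lTensor R (S.dEven i)
  dOdd a := LinearMap.lTensor R (S.dOdd a)
  parity_parity x := by
    induction x with
    | zero => simp
    | add x y h h' => simp only [map_add, h, h']
    | tmul t z => simp [S.parity_parity]
  even_mul {y} hy x := by
    -- The condition that `y` is even is not inherited by the summands of a tensor. The statement
    -- for `y + parity y` is additive in `y`, so it can be checked on pure tensors; for even `y` it
    -- is twice the claim.
    have key : ∀ y x : R ⊗[ℝ] L,
        (y + Algebra.TensorProduct.map (AlgHom.id ℝ R) S.parity y) * x =
          x * (y + Algebra.TensorProduct.map (AlgHom.id ℝ R) S.parity y) := by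
      intro y x
      induction y with
      | zero => simp
      | add y y' h h' =>
        rw [map_add, add_add_add_comm, add_mul, mul_add, h, h']
      | tmul t z =>
        rw [Algebra.TensorProduct.map_tmul, AlgHom.id_apply, ← TensorProduct.tmul_add]
        induction x with
        | zero => simp
        | add x x' h h' => rw [mul_add, add_mul, h, h']
        | tmul t' z' =>
          rw [Algebra.TensorProduct.tmul_mul_tmul, Algebra.TensorProduct.tmul_mul_tmul, mul_comm,
            S.even_mul (by rw [map_add, S.parity_parity, add_comm])]
    have h := key y x
    rw [hy, ← two_smul ℝ, smul_mul_assoc, mul_smul_comm] at h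
    exact smul_right_injective _ (two_ne_zero (α := ℝ)) h
  odd_mul {y} hy x := by
    -- The same device with `y - parity y`, which equals 2y for odd `y`.
    have key : ∀ y x : R ⊗[ℝ] L,
        (y - Algebra.TensorProduct.map (AlgHom.id ℝ R) S.parity y) * x =
          Algebra.TensorProduct.map (AlgHom.id ℝ R) S.parity x *
            (y - Algebra.TensorProduct.map (AlgHom.id ℝ R) S.parity y) := by
      intro y x
      induction y with
      | zero => simp
      | add y y' h h' =>
        rw [map_add, add_sub_add_comm, add_mul, mul_add, h, h']
      | tmul t z =>
        rw [Algebra.TensorProduct.map_tmul, AlgHom.id_apply, ← TensorProduct.tmul_sub]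
        induction x with
        | zero => simp
        | add x x' h h' => rw [mul_add, map_add, add_mul, h, h']
        | tmul t' z' =>
          rw [Algebra.TensorProduct.map_tmul, AlgHom.id_apply,
            Algebra.TensorProduct.tmul_mul_tmul, Algebra.TensorProduct.tmul_mul_tmul, mul_comm,
            S.odd_mul (by rw [map_sub, S.parity_parity, neg_sub])]
    have h := key y x
    rw [hy, sub_neg_eq_add, ← two_smul ℝ, smul_mul_assoc, mul_smul_comm] at h
    exact smul_right_injective _ (two_ne_zero (α := ℝ)) h
  dEven_mul i x y := by
    induction x with
    | zero => simp
    | add x x' h h' =>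
      simp only [map_add, add_mul, h, h']
      abel
    | tmul t z =>
      induction y with
      | zero => simp
      | add y y' h h' =>
        simp only [map_add, mul_add, h, h']
        abel
      | tmul t' z' => simp [S.dEven_mul, TensorProduct.tmul_add]
  dOdd_mul a x y := by
    induction x with
    | zero => simp
    | add x x' h h' =>
      simp only [map_add, add_mul, h, h']
      abel
    | tmul t z =>
      induction y with
      | zero => simp
      | add y y' h h' =>
        simp only [map_add, mul_add, h, h']
        abel
      | tmul t' z' => simp [S.dOdd_mul, TensorProduct.tmul_add]
  parity_dEven i x := by
    induction x with
    | zero => simp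
    | add x y h h' => simp only [map_add, h, h']
    | tmul t z => simp [S.parity_dEven]
  parity_dOdd a x := by
    induction x with
    | zero => simp
    | add x y h h' =>
      simp only [map_add, h, h']
      abel
    | tmul t z => simp [S.parity_dOdd, TensorProduct.tmul_neg]
  dEven_dEven i j x := by
    induction x with
    | zero => simp
    | add x y h h' => simp only [map_add, h, h']
    | tmul t z => simp [S.dEven_dEven i j]
  dEven_dOdd i a x := by
    induction x with
    | zero => simp
    | add x y h h' => simp only [map_add, h, h']
    | tmul t z => simp [S.dEven_dOdd i a]
  dOdd_dOdd a b x := by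
    induction x with
    | zero => simp
    | add x y h h' =>
      simp only [map_add, h, h']
      abel
    | tmul t z => simp [S.dOdd_dOdd a b, TensorProduct.tmul_neg]

end SuperCalculus

/-- The calculus of the algebra of functions at a fixed point of the base. -/
def FiberAlg.calculus {n r : ℕ} : SuperCalculus n r (FiberAlg n r) where
  parity := FiberAlg.parity
  dEven := FiberAlg.dp
  dOdd := FiberAlg.dLeft
  parity_parity := FiberAlg.parity_parity
  even_mul {y} hy x := by
    have h := (FiberAlg.add_parity_mul y x).1
    rw [hy, ← two_smul ℝ, smul_mul_assoc, mul_smul_comm] at h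
    exact smul_right_injective _ (two_ne_zero (α := ℝ)) h
  odd_mul {y} hy x := by
    have h := (FiberAlg.add_parity_mul y x).2
    rw [hy, sub_neg_eq_add, ← two_smul ℝ, smul_mul_assoc, mul_smul_comm] at h
    exact smul_right_injective _ (two_ne_zero (α := ℝ)) h
  dEven_mul := FiberAlg.dp_mul
  dOdd_mul := FiberAlg.dLeft_mul
  parity_dEven := FiberAlg.parity_dp
  parity_dOdd := FiberAlg.parity_dLeft
  dEven_dEven := FiberAlg.dp_dp
  dEven_dOdd := FiberAlg.dp_dLeft
  dOdd_dOdd := FiberAlg.dLeft_dLeft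

end BigBracket

end

/-! ### The super calculus of local functions. -/

noncomputable section

namespace BigBracket

section Coordinates

variable {n : ℕ} {M : Type*} [TopologicalSpace M] [ChartedSpace (EuclideanSpace ℝ (Fin n)) M]
variable {F : Type*} [NormedAddCommGroup F] [NormedSpace ℝ F]
  {A : M → Type*} [TopologicalSpace (TotalSpace F A)] [∀ x, TopologicalSpace (A x)]
  [∀ x, AddCommGroup (A x)] [∀ x, Module ℝ (A x)] [FiberBundle F A]

namespace Coords

theorem differentiableAt_ext_symm (c : Coords (n := n) F A) (f : c.Fn) (m : c.U) :
    DifferentiableAt ℝ (c.ext f ∘ c.chart.symm) (c.chart m) :=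
  ((c.contDiffOn_ext_symm f).contDiffAt
    (c.chart.open_target.mem_nhds (c.chart.map_source m.2))).differentiableAt (by simp)

theorem partialX_apply (c : Coords (n := n) F A) (i : Fin n) (f : c.Fn) (m : c.U) :
    c.partialX i f m = c.deriv i (c.ext f) m := rfl

theorem partialX_mul (c : Coords (n := n) F A) (i : Fin n) (f g : c.Fn) :
    c.partialX i (f * g) = c.partialX i f * g + f * c.partialX i g := by
  ext m
  have e : c.ext (f * g) ∘ c.chart.symm =
      (c.ext f ∘ c.chart.symm) * (c.ext g ∘ c.chart.symm) := by
    funext y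
    by_cases h : c.chart.symm y ∈ c.U <;> simp [ext, h]
  change c.deriv i (c.ext (f * g)) m = c.deriv i (c.ext f) m * g m + f m * c.deriv i (c.ext g) m
  simp only [deriv]
  rw [e, fderiv_mul (c.differentiableAt_ext_symm f m) (c.differentiableAt_ext_symm g m)]
  have h : c.chart.symm (c.chart m) = m := c.chart.left_inv m.2
  simp only [Function.comp_apply, h, ext_apply, add_apply, smul_apply, smul_eq_mul]
  ring

theorem partialX_comm (c : Coords (n := n) F A) (i j : Fin n) (f : c.Fn) :
    c.partialX i (c.partialX j f) = c.partialX j (c.partialX i f) := by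
  ext m
  have key : ∀ i j, c.partialX i (c.partialX j f) m =
      fderiv ℝ (fderiv ℝ (c.ext f ∘ c.chart.symm)) (c.chart m) (EuclideanSpace.single i 1)
        (EuclideanSpace.single j 1) := by
    intro i j
    have hm := c.chart.open_target.mem_nhds (c.chart.map_source m.2)
    -- The extension by zero agrees with the derivative only on the chart target. An equality of
    -- germs suffices for the second derivative, whose symmetry is then Schwarz's theorem.
    have e : c.ext (c.partialX j f) ∘ c.chart.symm =ᶠ[nhds (c.chart m)]
        fun y => fderiv ℝ (c.ext f ∘ c.chart.symm) y (EuclideanSpace.single j 1) := by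
      filter_upwards [hm] with y hy
      have h : c.chart.symm y ∈ c.U := c.chart.map_target hy
      have h' := c.ext_apply (c.partialX j f) ⟨_, h⟩
      simp only [Function.comp_apply]
      rw [h', partialX_apply, deriv, c.chart.right_inv hy]
    rw [partialX_apply, deriv, e.fderiv_eq]
    have hd : DifferentiableAt ℝ (fderiv ℝ (c.ext f ∘ c.chart.symm)) (c.chart m) :=
      (((c.contDiffOn_ext_symm f).fderiv_of_isOpen c.chart.open_target
        (m := ∞) (by simp)).contDiffAt hm).differentiableAt (by simp)
    rw [fderiv_clm_apply hd (differentiableAt_const _)]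
    simp
  rw [key, key]
  have hs : IsSymmSndFDerivAt ℝ (c.ext f ∘ c.chart.symm) (c.chart m) :=
    ((c.contDiffOn_ext_symm f).contDiffAt
      (c.chart.open_target.mem_nhds (c.chart.map_source m.2))).isSymmSndFDerivAt
        (by simpa using (WithTop.coe_le_coe.2 le_top : ((2 : ℕ∞) : WithTop ℕ∞) ≤ ∞))
  exact hs _ _

/-- The super calculus of local functions. -/
def calculus (c : Coords (n := n) F A) : SuperCalculus n (finrank ℝ F) c.Loc :=
  FiberAlg.calculus.baseChange c.Fn

theorem calculus_dEven (c : Coords (n := n) F A) : c.calculus.dEven = c.dp := rfl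

theorem calculus_dOdd (c : Coords (n := n) F A) : c.calculus.dOdd = c.dLeft := rfl

theorem dx_tmul (c : Coords (n := n) F A) (i : Fin n) (f : c.Fn) (y : FiberAlg n (finrank ℝ F)) :
    c.dx i (f ⊗ₜ y) = c.partialX i f ⊗ₜ y := rfl

theorem dp_tmul (c : Coords (n := n) F A) (i : Fin n) (f : c.Fn) (y : FiberAlg n (finrank ℝ F)) :
    c.dp i (f ⊗ₜ y) = f ⊗ₜ FiberAlg.dp i y := rfl

theorem dLeft_tmul (c : Coords (n := n) F A) (a : Fin (finrank ℝ F) ⊕ Fin (finrank ℝ F)) (f : c.Fn)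
    (y : FiberAlg n (finrank ℝ F)) : c.dLeft a (f ⊗ₜ y) = f ⊗ₜ FiberAlg.dLeft a y := rfl

theorem parity_tmul (c : Coords (n := n) F A) (f : c.Fn)
    (y : FiberAlg n (finrank ℝ F)) : c.calculus.parity (f ⊗ₜ y) = f ⊗ₜ FiberAlg.parity y := rfl

theorem dRight_eq (c : Coords (n := n) F A) (a : Fin (finrank ℝ F) ⊕ Fin (finrank ℝ F))
    (w : c.Loc) : c.dRight a w = c.calculus.parity (c.dLeft a w) := by
  induction w using TensorProduct.induction_on with
  | zero => simp
  | add x y h h' => simp only [map_add, h, h']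
  | tmul f y => rw [dLeft_tmul, parity_tmul, ← FiberAlg.dRight_eq]; rfl

theorem isHorizontal_dx (c : Coords (n := n) F A) : c.calculus.IsHorizontal c.dx where
  d_mul i x y := by
    induction x using TensorProduct.induction_on with
    | zero => simp
    | add x x' h h' =>
      simp only [map_add, add_mul, h, h']
      abel
    | tmul t z =>
      induction y using TensorProduct.induction_on with
      | zero => simp
      | add y y' h h' =>
        simp only [map_add, mul_add, h, h']
        abel
      | tmul t' z' =>
        simp only [Algebra.TensorProduct.tmul_mul_tmul, dx_tmul, partialX_mul,
          TensorProduct.add_tmul]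
  parity_d i x := by
    induction x using TensorProduct.induction_on with
    | zero => simp
    | add x y h h' => simp only [map_add, h, h']
    | tmul t z => rfl
  d_d i j x := by
    induction x using TensorProduct.induction_on with
    | zero => simp
    | add x y h h' => simp only [map_add, h, h']
    | tmul t z => simp only [dx_tmul, c.partialX_comm i j]
  d_dEven i j x := by
    induction x using TensorProduct.induction_on with
    | zero => simp
    | add x y h h' => simp only [map_add, h, h']
    | tmul t z => rfl
  d_dOdd i a x := by
    induction x using TensorProduct.induction_on with
    | zero => simp
    | add x y h h' => simp only [map_add, h, h']
    | tmul t z => rfl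

/-- The two odd terms of the big bracket are one sum over all odd coordinates, paired by `Sum.swap`,
once right derivatives are written as parities of left derivatives. The abstract calculus thereby
applies. -/
theorem bracket_eq_poisson (c : Coords (n := n) F A) (f g : c.Loc) :
    c.bracket f g = c.calculus.poisson c.dx f g := by
  simp only [bracket, SuperCalculus.poisson, dRight_eq, Fintype.sum_sum_type, Sum.swap_inl,
    Sum.swap_inr, calculus_dEven, calculus_dOdd, Finset.sum_add_distrib]

@[simp] theorem dx_smul (c : Coords (n := n) F A) (i : Fin n) (f : c.Fn) (w : c.Loc) :
    c.dx i (f • w) = c.partialX i f • w + f • c.dx i w := by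
  have e : ∀ (h : c.Fn) (w : c.Loc), h • w = (h ⊗ₜ[ℝ] (1 : FiberAlg n (finrank ℝ F))) * w :=
    fun h w => Algebra.smul_def (A := c.Loc) h w
  rw [e, e, e, c.isHorizontal_dx.d_mul, dx_tmul]

@[simp] theorem dp_smul (c : Coords (n := n) F A) (i : Fin n) (f : c.Fn) (w : c.Loc) :
    c.dp i (f • w) = f • c.dp i w := by
  induction w using TensorProduct.induction_on with
  | zero => simp
  | add x y h h' => simp only [smul_add, map_add, h, h']
  | tmul t z => rfl

@[simp] theorem dLeft_smul (c : Coords (n := n) F A) (a : Fin (finrank ℝ F) ⊕ Fin (finrank ℝ F))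
    (f : c.Fn) (w : c.Loc) : c.dLeft a (f • w) = f • c.dLeft a w := by
  induction w using TensorProduct.induction_on with
  | zero => simp
  | add x y h h' => simp only [smul_add, map_add, h, h']
  | tmul t z => rfl

@[simp] theorem parity_smul (c : Coords (n := n) F A)
    (f : c.Fn) (w : c.Loc) : c.calculus.parity (f • w) = f • c.calculus.parity w := by
  induction w using TensorProduct.induction_on with
  | zero => simp
  | add x y h h' => simp only [smul_add, map_add, h, h']
  | tmul t z => rfl

@[simp] theorem parity_odd (c : Coords (n := n) F A) (a : Fin (finrank ℝ F) ⊕ Fin (finrank ℝ F)) :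
    c.calculus.parity (c.odd a) = -c.odd a := by
  rw [odd, parity_tmul, FiberAlg.parity_odd, TensorProduct.tmul_neg]

@[simp] theorem dLeft_odd (c : Coords (n := n) F A)
    (a b : Fin (finrank ℝ F) ⊕ Fin (finrank ℝ F)) :
    c.dLeft a (c.odd b) = if a = b then 1 else 0 := by
  rw [odd, dLeft_tmul, FiberAlg.dLeft_odd]
  split_ifs
  · rfl
  · rw [TensorProduct.tmul_zero]

@[simp] theorem dp_odd (c : Coords (n := n) F A) (i : Fin n)
    (a : Fin (finrank ℝ F) ⊕ Fin (finrank ℝ F)) : c.dp i (c.odd a) = 0 := by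
  rw [odd, dp_tmul, FiberAlg.dp_odd, TensorProduct.tmul_zero]

@[simp] theorem dx_odd (c : Coords (n := n) F A) (i : Fin n)
    (a : Fin (finrank ℝ F) ⊕ Fin (finrank ℝ F)) : c.dx i (c.odd a) = 0 := by
  have h := c.partialX_mul i 1 1
  rw [mul_one, mul_one, one_mul, left_eq_add] at h
  rw [odd, dx_tmul, h, TensorProduct.zero_tmul]

end Coords

end Coordinates

/-! ### The bigrading -/

namespace FiberAlg

variable {n r : ℕ}

/-- The elements of bidegree `(k, l)`; they vanish if `k` or `l` is negative. -/
def bigraded (k l : ℤ) : Submodule ℝ (FiberAlg n r) :=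
  Submodule.span ℝ {w | ∃ (d : Fin n →₀ ℕ) (a b : List (Fin r)),
    (d.degree + b.length : ℤ) = k ∧ (d.degree + a.length : ℤ) = l ∧ w = monomial d a b}

theorem bigraded_congr {k l k' l' : ℤ} {y : FiberAlg n r} (hy : y ∈ bigraded k l) (hk : k = k')
    (hl : l = l') : y ∈ bigraded k' l' := by
  rwa [← hk, ← hl]

theorem monomial_mem (d : Fin n →₀ ℕ) (a b : List (Fin r)) :
    monomial d a b ∈ bigraded (d.degree + b.length : ℤ) (d.degree + a.length : ℤ) :=
  Submodule.subset_span ⟨d, a, b, rfl, rfl, rfl⟩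

@[simp] theorem monomial_zero_nil_nil : monomial (0 : Fin n →₀ ℕ) ([] : List (Fin r)) [] = 1 := by
  simp only [monomial, List.map_nil, List.prod_nil, mul_one]
  exact map_one equiv.symm

theorem monomial_zero_nil_cons (β : Fin r) (b : List (Fin r)) :
    monomial (0 : Fin n →₀ ℕ) [] (β :: b) = θ β * monomial 0 [] b := by
  have h : (equiv.symm (MvPolynomial.monomial (0 : Fin n →₀ ℕ) (1 : ℝ) ⊗ₜ 1) : FiberAlg n r) = 1 :=
    map_one equiv.symm
  simp only [monomial, h, List.map_nil, List.prod_nil, mul_one, one_mul, List.map_cons,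
    List.prod_cons]

theorem monomial_zero_cons (α : Fin r) (a b : List (Fin r)) :
    monomial (0 : Fin n →₀ ℕ) (α :: a) b = τ α * monomial 0 a b := by
  have h : (equiv.symm (MvPolynomial.monomial (0 : Fin n →₀ ℕ) (1 : ℝ) ⊗ₜ 1) : FiberAlg n r) = 1 :=
    map_one equiv.symm
  simp only [monomial, h, one_mul, List.map_cons, List.prod_cons, mul_assoc]

theorem monomial_add_single (d : Fin n →₀ ℕ) (i : Fin n) (a b : List (Fin r)) :
    monomial (d + Finsupp.single i 1) a b = p i * monomial d a b := by
  have h : (equiv.symm (MvPolynomial.monomial (d + Finsupp.single i 1) (1 : ℝ) ⊗ₜ 1) :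
      FiberAlg n r) = p i * equiv.symm (MvPolynomial.monomial d (1 : ℝ) ⊗ₜ 1) := by
    rw [p, tmul_mul_tmul, one_mul, MvPolynomial.X, MvPolynomial.monomial_mul, one_mul, add_comm]
  simp only [monomial, h, mul_assoc]

/-- Induction on monomials. -/
theorem monomial_induction {C : (Fin n →₀ ℕ) → List (Fin r) → List (Fin r) → Prop}
    (one : C 0 [] []) (θ : ∀ β b, C 0 [] b → C 0 [] (β :: b))
    (τ : ∀ α a b, C 0 a b → C 0 (α :: a) b)
    (p : ∀ d i a b, C d a b → C (d + Finsupp.single i 1) a b) (d : Fin n →₀ ℕ)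
    (a b : List (Fin r)) : C d a b := by
  -- A monomial in the normal order p, τ, θ is rebuilt from its right end: all θ first, then the τ,
  -- then the momenta.
  have h1 : ∀ b, C 0 [] b := fun b => by
    induction b with
    | nil => exact one
    | cons β b h => exact θ β b h
  have h2 : ∀ a, C 0 a b := fun a => by
    induction a with
    | nil => exact h1 b
    | cons α a h => exact τ α a b h
  induction d using Finsupp.induction with
  | zero => exact h2 a
  | single_add i k d _ hk h =>
    clear hk
    induction k with
    | zero => simpa using h
    | succ k ih =>
      have e : Finsupp.single i (k + 1) + d = (Finsupp.single i k + d) + Finsupp.single i 1 := by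
        rw [Finsupp.single_add]
        abel
      rw [e]
      exact p _ _ _ _ ih

theorem one_mem : (1 : FiberAlg n r) ∈ bigraded 0 0 := by
  simpa using monomial_mem (0 : Fin n →₀ ℕ) ([] : List (Fin r)) []

theorem p_mul_mem (i : Fin n) {k l : ℤ} {y : FiberAlg n r} (hy : y ∈ bigraded k l) :
    p i * y ∈ bigraded (k + 1) (l + 1) := by
  induction hy using Submodule.span_induction with
  | mem y hy =>
    obtain ⟨d, a, b, rfl, rfl, rfl⟩ := hy
    rw [← monomial_add_single]
    refine Submodule.subset_span ⟨_, _, _, ?_, ?_, rfl⟩ <;> simp <;> omega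
  | zero => simp
  | add x y _ _ h h' => rw [mul_add]; exact add_mem h h'
  | smul t x _ h => rw [mul_smul_comm]; exact Submodule.smul_mem _ _ h

theorem τ_mul_mem (α : Fin r) {k l : ℤ} {y : FiberAlg n r} (hy : y ∈ bigraded k l) :
    τ α * y ∈ bigraded k (l + 1) := by
  induction hy using Submodule.span_induction with
  | mem y hy =>
    obtain ⟨d, a, b, rfl, rfl, rfl⟩ := hy
    have e : τ α * monomial d a b = monomial d (α :: a) b := by
      have h := odd_mul (Sum.inl α) (equiv.symm (MvPolynomial.monomial d (1 : ℝ) ⊗ₜ 1) :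
        FiberAlg n r)
      rw [parity_tmul, map_one CliffordAlgebra.involute] at h
      simp only [monomial, List.map_cons, List.prod_cons, ← mul_assoc]
      rw [τ, h]
    rw [e]
    refine Submodule.subset_span ⟨_, _, _, ?_, ?_, rfl⟩ <;> simp
    omega
  | zero => simp
  | add x y _ _ h h' => rw [mul_add]; exact add_mem h h'
  | smul t x _ h => rw [mul_smul_comm]; exact Submodule.smul_mem _ _ h

/-- Monomials are eigenvectors of the parity; the eigenvalue itself is irrelevant for membership. -/
theorem parity_mem {k l : ℤ} {y : FiberAlg n r} (hy : y ∈ bigraded k l) :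
    parity y ∈ bigraded k l := by
  have key : ∀ d a b, ∃ t : ℝ, parity (monomial d a b : FiberAlg n r) = t • monomial d a b := by
    intro d a b
    induction d, a, b using monomial_induction with
    | one => exact ⟨1, by simp⟩
    | θ β b h =>
      obtain ⟨t, h⟩ := h
      refine ⟨-t, ?_⟩
      rw [monomial_zero_nil_cons, map_mul, h, θ, parity_odd]
      simp
    | τ α a b h =>
      obtain ⟨t, h⟩ := h
      refine ⟨-t, ?_⟩
      rw [monomial_zero_cons, map_mul, h, τ, parity_odd]
      simp
    | p d i a b h =>
      obtain ⟨t, h⟩ := h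
      refine ⟨t, ?_⟩
      rw [monomial_add_single, map_mul, h, parity_p]
      simp
  induction hy using Submodule.span_induction with
  | mem y hy =>
    obtain ⟨d, a, b, rfl, rfl, rfl⟩ := hy
    obtain ⟨t, ht⟩ := key d a b
    rw [ht]
    exact Submodule.smul_mem _ _ (monomial_mem d a b)
  | zero => simp
  | add x y _ _ h h' => rw [map_add]; exact add_mem h h'
  | smul t x _ h => rw [map_smul]; exact Submodule.smul_mem _ _ h

/-- In normal order θ stands to the right of every τ, so a factor θ on the left has to pass them one
by one. The resulting signs do not matter in a subspace. -/
theorem θ_mul_mem (α : Fin r) {k l : ℤ} {y : FiberAlg n r} (hy : y ∈ bigraded k l) :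
    θ α * y ∈ bigraded (k + 1) l := by
  induction hy using Submodule.span_induction with
  | mem y hy =>
    obtain ⟨d, a, b, rfl, rfl, rfl⟩ := hy
    have h : ∀ d a b, θ α * (monomial d a b : FiberAlg n r) ∈
        bigraded (d.degree + b.length + 1 : ℤ) (d.degree + a.length : ℤ) := by
      intro d a b
      induction d, a, b using monomial_induction with
      | one =>
        rw [← monomial_zero_nil_cons]
        exact Submodule.subset_span ⟨_, _, _, by simp, by simp, rfl⟩
      | θ β b h =>
        rw [← monomial_zero_nil_cons]
        exact Submodule.subset_span ⟨_, _, _, by simp, by simp, rfl⟩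
      | τ β a b h =>
        have e : θ α * monomial (0 : Fin n →₀ ℕ) (β :: a) b =
            -(τ β * (θ α * monomial 0 a b)) := by
          rw [monomial_zero_cons, ← mul_assoc, θ, odd_mul, τ, parity_odd, neg_mul, neg_mul,
            mul_assoc]
        rw [e]
        refine neg_mem ?_
        have h' := τ_mul_mem β h
        rw [List.length_cons]
        push_cast
        rwa [← add_assoc]
      | p d i a b h =>
        have e : θ α * monomial (d + Finsupp.single i 1) a b = p i * (θ α * monomial d a b) := by
          rw [monomial_add_single, ← mul_assoc, ← p_mul, mul_assoc]
        rw [e]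
        have h' := p_mul_mem i h
        refine bigraded_congr h' ?_ ?_ <;> simp <;> omega
    exact h d a b
  | zero => simp
  | add x y _ _ h h' => rw [mul_add]; exact add_mem h h'
  | smul t x _ h => rw [mul_smul_comm]; exact Submodule.smul_mem _ _ h

theorem mul_mem {k l k' l' : ℤ} {x y : FiberAlg n r} (hx : x ∈ bigraded k l)
    (hy : y ∈ bigraded k' l') : x * y ∈ bigraded (k + k') (l + l') := by
  induction hx using Submodule.span_induction with
  | mem x hx =>
    obtain ⟨d, a, b, rfl, rfl, rfl⟩ := hx
    induction d, a, b using monomial_induction with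
    | one => simpa using hy
    | θ β b h =>
      rw [monomial_zero_nil_cons, mul_assoc]
      refine bigraded_congr (θ_mul_mem β h) ?_ ?_ <;> simp
      omega
    | τ α a b h =>
      rw [monomial_zero_cons, mul_assoc]
      refine bigraded_congr (τ_mul_mem α h) ?_ ?_ <;> simp
      omega
    | p d i a b h =>
      rw [monomial_add_single, mul_assoc]
      refine bigraded_congr (p_mul_mem i h) ?_ ?_ <;> simp <;> omega
  | zero => simp
  | add x y _ _ h h' => rw [add_mul]; exact add_mem h h'
  | smul t x _ h => rw [smul_mul_assoc]; exact Submodule.smul_mem _ _ h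

/-- An operator with a Leibniz rule which shifts the bidegree of the generators by `(s, t)` shifts
all bidegrees by `(s, t)`. -/
theorem mem_of_leibniz {D : FiberAlg n r →ₗ[ℝ] FiberAlg n r} {σ : FiberAlg n r → FiberAlg n r}
    (hσ : ∀ i, σ (p i) = p i) (hσ' : ∀ a, σ (odd a) = odd a ∨ σ (odd a) = -odd a)
    (hD : ∀ x y, D (x * y) = D x * y + σ x * D y) (hD1 : D 1 = 0) {s t : ℤ}
    (hp : ∀ i, D (p i) ∈ bigraded (s + 1) (t + 1)) (hτ : ∀ α, D (τ α) ∈ bigraded s (t + 1))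
    (hθ : ∀ α, D (θ α) ∈ bigraded (s + 1) t) {k l : ℤ} {y : FiberAlg n r}
    (hy : y ∈ bigraded k l) : D y ∈ bigraded (s + k) (t + l) := by
  induction hy using Submodule.span_induction with
  | mem y hy =>
    obtain ⟨d, a, b, rfl, rfl, rfl⟩ := hy
    induction d, a, b using monomial_induction with
    | one => simp [hD1]
    | θ β b h =>
      rw [monomial_zero_nil_cons, hD]
      refine add_mem ?_ ?_
      · refine bigraded_congr (mul_mem (hθ β) (monomial_mem 0 [] b)) ?_ ?_ <;> simp
        omega
      · have h' := θ_mul_mem β h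
        have h'' : σ (θ β) * D (monomial 0 [] b) ∈ bigraded
            (s + ((0 : Fin n →₀ ℕ).degree + b.length : ℤ) + 1)
            (t + ((0 : Fin n →₀ ℕ).degree + ([] : List (Fin r)).length : ℤ)) := by
          rcases hσ' (Sum.inr β) with e | e <;> rw [θ, e]
          · exact h'
          · rw [neg_mul]; exact neg_mem h'
        refine bigraded_congr h'' ?_ ?_ <;> simp
        omega
    | τ α a b h =>
      rw [monomial_zero_cons, hD]
      refine add_mem ?_ ?_
      · refine bigraded_congr (mul_mem (hτ α) (monomial_mem 0 a b)) ?_ ?_ <;> simp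
        omega
      · have h' := τ_mul_mem α h
        have h'' : σ (τ α) * D (monomial 0 a b) ∈ bigraded
            (s + ((0 : Fin n →₀ ℕ).degree + b.length : ℤ))
            (t + ((0 : Fin n →₀ ℕ).degree + a.length : ℤ) + 1) := by
          rcases hσ' (Sum.inl α) with e | e <;> rw [τ, e]
          · exact h'
          · rw [neg_mul]; exact neg_mem h'
        refine bigraded_congr h'' ?_ ?_ <;> simp
        omega
    | p d i a b h =>
      rw [monomial_add_single, hD, hσ]
      refine add_mem ?_ ?_
      · refine bigraded_congr (mul_mem (hp i) (monomial_mem d a b)) ?_ ?_ <;> simp <;> omega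
      · refine bigraded_congr (p_mul_mem i h) ?_ ?_ <;> simp <;> omega
  | zero => simp
  | add x y _ _ h h' => rw [map_add]; exact add_mem h h'
  | smul t x _ h => rw [map_smul]; exact Submodule.smul_mem _ _ h

theorem dLeft_inl_mem (α : Fin r) {k l : ℤ} {y : FiberAlg n r} (hy : y ∈ bigraded k l) :
    dLeft (Sum.inl α) y ∈ bigraded k (l - 1) := by
  have h := mem_of_leibniz (s := 0) (t := -1) parity_p (fun a => Or.inr (parity_odd a))
    (dLeft_mul (Sum.inl α)) (by simp) (fun i => by simp) (fun β => ?_) (fun β => by simp [θ]) hy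
  · exact bigraded_congr (h) (by ring) (by ring)
  · rw [τ, dLeft_odd]
    split_ifs
    · exact one_mem
    · exact zero_mem _

theorem dLeft_inr_mem (α : Fin r) {k l : ℤ} {y : FiberAlg n r} (hy : y ∈ bigraded k l) :
    dLeft (Sum.inr α) y ∈ bigraded (k - 1) l := by
  have h := mem_of_leibniz (s := -1) (t := 0) parity_p (fun a => Or.inr (parity_odd a))
    (dLeft_mul (Sum.inr α)) (by simp) (fun i => by simp) (fun β => by simp [τ]) (fun β => ?_) hy
  · exact bigraded_congr (h) (by ring) (by ring)
  · rw [θ, dLeft_odd]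
    split_ifs
    · exact one_mem
    · exact zero_mem _

theorem dp_mem (i : Fin n) {k l : ℤ} {y : FiberAlg n r} (hy : y ∈ bigraded k l) :
    dp i y ∈ bigraded (k - 1) (l - 1) := by
  have h := mem_of_leibniz (s := -1) (t := -1) (σ := id) (fun _ => rfl) (fun a => Or.inl rfl)
    (dp_mul i) (by simp) (fun j => ?_) (fun β => by simp [τ]) (fun β => by simp [θ]) hy
  · exact bigraded_congr (h) (by ring) (by ring)
  · rw [dp_p]
    split_ifs
    · exact one_mem
    · exact zero_mem _

/-- Euler's identity. -/
theorem euler {k l : ℤ} {y : FiberAlg n r} (hy : y ∈ bigraded k l) :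
    ∑ a, odd a * dLeft a y + (2 : ℝ) • ∑ i, p i * dp i y = (k + l : ℝ) • y := by
  -- The Euler operator is an even derivation, so only its weights on the generators count: 1 on odd
  -- coordinates and 2 on momenta.
  have hL : ∀ x y : FiberAlg n r, ∑ a, odd a * dLeft a (x * y) +
      (2 : ℝ) • ∑ i, p i * dp i (x * y) =
      (∑ a, odd a * dLeft a x + (2 : ℝ) • ∑ i, p i * dp i x) * y +
      x * (∑ a, odd a * dLeft a y + (2 : ℝ) • ∑ i, p i * dp i y) := by
    intro x y
    have h1 : ∀ a, odd a * (parity x * dLeft a y) = x * (odd a * dLeft a y) := fun a => by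
      rw [← mul_assoc, odd_mul, parity_parity, mul_assoc]
    have h2 : ∀ i, p i * (x * dp i y) = x * (p i * dp i y) := fun i => by
      rw [← mul_assoc, p_mul, mul_assoc]
    simp only [dLeft_mul, dp_mul, mul_add, add_mul, Finset.sum_add_distrib, Finset.sum_mul,
      Finset.mul_sum, h1, h2, smul_add, mul_assoc, smul_mul_assoc, mul_smul_comm]
    abel
  have hodd : ∀ b, ∑ a, odd a * dLeft a (odd b : FiberAlg n r) +
      (2 : ℝ) • ∑ i, p i * dp i (odd b) = odd b := fun b => by simp
  have hp : ∀ j, ∑ a, odd a * dLeft a (p j : FiberAlg n r) +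
      (2 : ℝ) • ∑ i, p i * dp i (p j) = (2 : ℝ) • p j := fun b => by simp
  induction hy using Submodule.span_induction with
  | mem y hy =>
    obtain ⟨d, a, b, rfl, rfl, rfl⟩ := hy
    induction d, a, b using monomial_induction with
    | one => simp
    | θ β b h =>
      rw [monomial_zero_nil_cons, hL, h, θ, hodd, mul_smul_comm]
      simp only [List.length_cons]
      push_cast
      module
    | τ α a b h =>
      rw [monomial_zero_cons, hL, h, τ, hodd, mul_smul_comm]
      simp only [List.length_cons]
      push_cast
      module
    | p d i a b h =>
      rw [monomial_add_single, hL, h, hp, mul_smul_comm, smul_mul_assoc, ← add_smul]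
      congr 1
      simp
      ring
  | zero => simp
  | add x y _ _ h h' =>
    rw [smul_add, ← h, ← h']
    simp only [map_add, mul_add, Finset.sum_add_distrib, smul_add]
    abel
  | smul t x _ h =>
    rw [smul_comm, ← h]
    simp only [map_smul, mul_smul_comm, Finset.smul_sum, smul_add, smul_comm t]

theorem bigraded_zero_zero {y : FiberAlg n r} (hy : y ∈ bigraded 0 0) :
    ∃ t : ℝ, y = algebraMap ℝ _ t := by
  induction hy using Submodule.span_induction with
  | mem y hy =>
    obtain ⟨d, a, b, hk, hl, rfl⟩ := hy
    have hd : d.degree = 0 := by omega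
    have ha : a.length = 0 := by omega
    have hb : b.length = 0 := by omega
    rw [Finsupp.degree_eq_zero_iff] at hd
    rw [List.length_eq_zero_iff] at ha hb
    subst hd ha hb
    exact ⟨1, by simp⟩
  | zero => exact ⟨0, by simp⟩
  | add x y _ _ h h' =>
    obtain ⟨t, rfl⟩ := h
    obtain ⟨t', rfl⟩ := h'
    exact ⟨t + t', by simp⟩
  | smul t x _ h =>
    obtain ⟨t', rfl⟩ := h
    exact ⟨t * t', by rw [Algebra.smul_def, map_mul]⟩

theorem bigraded_eq_bot {k l : ℤ} (h : k < 0 ∨ l < 0) :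
    (bigraded k l : Submodule ℝ (FiberAlg n r)) = ⊥ := by
  rw [bigraded, Submodule.span_eq_bot]
  rintro y ⟨d, a, b, hk, hl, rfl⟩
  omega

end FiberAlg

end BigBracket

end

noncomputable section

namespace BigBracket

section Coordinates

variable {n : ℕ} {M : Type*} [TopologicalSpace M] [ChartedSpace (EuclideanSpace ℝ (Fin n)) M]
variable {F : Type*} [NormedAddCommGroup F] [NormedSpace ℝ F]
  {A : M → Type*} [TopologicalSpace (TotalSpace F A)] [∀ x, TopologicalSpace (A x)]
  [∀ x, AddCommGroup (A x)] [∀ x, Module ℝ (A x)] [FiberBundle F A]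

namespace Coords

/-! ### Bidegree of local functions -/

/-- The local functions of bidegree `(k, l)`; they vanish if `k` or `l` is negative. -/
def bigraded (c : Coords (n := n) F A) (k l : ℤ) : Submodule ℝ c.Loc :=
  Submodule.span ℝ {w | ∃ (f : c.Fn) (y : FiberAlg n (finrank ℝ F)),
    y ∈ FiberAlg.bigraded k l ∧ w = f ⊗ₜ y}

variable {c : Coords (n := n) F A}

/-- Integer bidegrees are used from here on: derivatives and brackets lower them without case
distinctions, and landing in a negative bidegree means vanishing. -/
theorem bideg_eq (k l : ℕ) : c.bideg k l = c.bigraded k l := by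
  apply le_antisymm
  · refine Submodule.span_le.2 ?_
    rintro w ⟨f, d, a, b, hk, hl, rfl⟩
    refine Submodule.subset_span ⟨f, _, FiberAlg.bigraded_congr (FiberAlg.monomial_mem d a b) ?_ ?_,
      rfl⟩ <;> omega
  · refine Submodule.span_le.2 ?_
    rintro w ⟨f, y, hy, rfl⟩
    change f ⊗ₜ y ∈ c.bideg k l
    induction hy using Submodule.span_induction with
    | mem y hy =>
      obtain ⟨d, a, b, hk, hl, rfl⟩ := hy
      exact Submodule.subset_span ⟨f, d, a, b, by omega, by omega, rfl⟩
    | zero => rw [TensorProduct.tmul_zero]; exact zero_mem _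
    | add x y _ _ h h' => rw [TensorProduct.tmul_add]; exact add_mem h h'
    | smul t x _ h => rw [TensorProduct.tmul_smul]; exact Submodule.smul_mem _ _ h

theorem bigraded_congr {k l k' l' : ℤ} {y : c.Loc} (hy : y ∈ c.bigraded k l) (hk : k = k')
    (hl : l = l') : y ∈ c.bigraded k' l' := by
  rwa [← hk, ← hl]

theorem bigraded_eq_bot {k l : ℤ} (h : k < 0 ∨ l < 0) : c.bigraded k l = ⊥ := by
  rw [bigraded, Submodule.span_eq_bot]
  rintro y ⟨f, y, hy, rfl⟩
  rw [FiberAlg.bigraded_eq_bot h, Submodule.mem_bot] at hy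
  rw [hy, TensorProduct.tmul_zero]

theorem map_mem_bigraded {D : c.Loc →ₗ[ℝ] c.Loc} {k l k' l' : ℤ}
    (hD : ∀ (f : c.Fn), ∀ y ∈ FiberAlg.bigraded k l, D (f ⊗ₜ y) ∈ c.bigraded k' l') {w : c.Loc}
    (hw : w ∈ c.bigraded k l) : D w ∈ c.bigraded k' l' := by
  refine Submodule.span_le (p := (c.bigraded k' l').comap D).2 ?_ hw
  rintro w ⟨f, y, hy, rfl⟩
  exact hD f y hy

theorem tmul_mem {k l : ℤ} (f : c.Fn) {y : FiberAlg n (finrank ℝ F)}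
    (hy : y ∈ FiberAlg.bigraded k l) : f ⊗ₜ y ∈ c.bigraded k l :=
  Submodule.subset_span ⟨f, y, hy, rfl⟩

theorem dLeft_inl_mem (α : Fin (finrank ℝ F)) {k l : ℤ} {w : c.Loc} (hw : w ∈ c.bigraded k l) :
    c.dLeft (Sum.inl α) w ∈ c.bigraded k (l - 1) :=
  map_mem_bigraded (fun f _ hy => tmul_mem f (FiberAlg.dLeft_inl_mem α hy)) hw

theorem dLeft_inr_mem (α : Fin (finrank ℝ F)) {k l : ℤ} {w : c.Loc} (hw : w ∈ c.bigraded k l) :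
    c.dLeft (Sum.inr α) w ∈ c.bigraded (k - 1) l :=
  map_mem_bigraded (fun f _ hy => tmul_mem f (FiberAlg.dLeft_inr_mem α hy)) hw

theorem dp_mem (i : Fin n) {k l : ℤ} {w : c.Loc} (hw : w ∈ c.bigraded k l) :
    c.dp i w ∈ c.bigraded (k - 1) (l - 1) :=
  map_mem_bigraded (fun f _ hy => tmul_mem f (FiberAlg.dp_mem i hy)) hw

theorem dx_mem (i : Fin n) {k l : ℤ} {w : c.Loc} (hw : w ∈ c.bigraded k l) :
    c.dx i w ∈ c.bigraded k l :=
  map_mem_bigraded (fun f _ hy => tmul_mem (c.partialX i f) hy) hw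

theorem parity_mem {k l : ℤ} {w : c.Loc} (hw : w ∈ c.bigraded k l) :
    c.calculus.parity w ∈ c.bigraded k l :=
  map_mem_bigraded (D := c.calculus.parity.toLinearMap)
    (fun f _ hy => tmul_mem f (FiberAlg.parity_mem hy)) hw

theorem smul_mem (f : c.Fn) {k l : ℤ} {w : c.Loc} (hw : w ∈ c.bigraded k l) :
    f • w ∈ c.bigraded k l :=
  map_mem_bigraded (D := LinearMap.lsmul c.Fn c.Loc f |>.restrictScalars ℝ)
    (fun f' _ hy => tmul_mem (f * f') hy) hw

theorem mul_mem {k l k' l' : ℤ} {w w' : c.Loc} (hw : w ∈ c.bigraded k l)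
    (hw' : w' ∈ c.bigraded k' l') : w * w' ∈ c.bigraded (k + k') (l + l') := by
  refine map_mem_bigraded (D := LinearMap.mulRight ℝ w') (fun f y hy => ?_) hw
  refine map_mem_bigraded (D := LinearMap.mulLeft ℝ (f ⊗ₜ y)) (fun f' y' hy' => ?_) hw'
  rw [LinearMap.mulLeft_apply, Algebra.TensorProduct.tmul_mul_tmul]
  exact tmul_mem _ (FiberAlg.mul_mem hy hy')

/-- Every term of the bracket removes one conjugate pair (x, p) or (τ, θ), and each such pair has
total bidegree (1, 1). -/
theorem bracket_mem {k l k' l' : ℤ} {w w' : c.Loc} (hw : w ∈ c.bigraded k l)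
    (hw' : w' ∈ c.bigraded k' l') : c.bracket w w' ∈ c.bigraded (k + k' - 1) (l + l' - 1) := by
  simp only [bracket, dRight_eq]
  refine add_mem (sum_mem fun i _ => sub_mem ?_ ?_) (sum_mem fun α _ => add_mem ?_ ?_)
  · exact bigraded_congr (mul_mem (dx_mem i hw) (dp_mem i hw')) (by ring) (by ring)
  · exact bigraded_congr (mul_mem (dp_mem i hw) (dx_mem i hw')) (by ring) (by ring)
  · exact bigraded_congr (mul_mem (parity_mem (dLeft_inl_mem α hw)) (dLeft_inr_mem α hw'))
      (by ring) (by ring)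
  · exact bigraded_congr (mul_mem (parity_mem (dLeft_inr_mem α hw)) (dLeft_inl_mem α hw'))
      (by ring) (by ring)

theorem τ_mem (α : Fin (finrank ℝ F)) : c.τ α ∈ c.bigraded 0 1 :=
  tmul_mem 1 (y := FiberAlg.τ α) (by simpa using FiberAlg.τ_mul_mem α FiberAlg.one_mem)

theorem θ_mem (α : Fin (finrank ℝ F)) : c.θ α ∈ c.bigraded 1 0 :=
  tmul_mem 1 (y := FiberAlg.θ α) (by simpa using FiberAlg.θ_mul_mem α FiberAlg.one_mem)

variable (c) in
/-- The local functions of total degree `k`. -/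
def graded (k : ℤ) : Submodule ℝ c.Loc := ⨆ i : ℤ, c.bigraded i (k - i)

theorem bigraded_le_graded {i j k : ℤ} (h : i + j = k) : c.bigraded i j ≤ c.graded k := by
  obtain rfl : j = k - i := by omega
  exact le_iSup (fun i => c.bigraded i (k - i)) i

theorem graded_eq_bot {k : ℤ} (h : k < 0) : c.graded k = ⊥ := by
  rw [graded, iSup_eq_bot]
  exact fun i => bigraded_eq_bot (by omega)

theorem graded_induction {k : ℤ} {C : (w : c.Loc) → w ∈ c.graded k → Prop}
    (mem : ∀ i j (h : i + j = k) w (hw : w ∈ c.bigraded i j), C w (bigraded_le_graded h hw))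
    (zero : C 0 (zero_mem _))
    (add : ∀ x y hx hy, C x hx → C y hy → C (x + y) (add_mem hx hy)) {w : c.Loc}
    (hw : w ∈ c.graded k) : C w hw :=
  Submodule.iSup_induction' _ (motive := C) (fun i w hw => mem i (k - i) (by ring) w hw) zero
    (fun x y hx hy => add x y hx hy) hw

theorem dLeft_mem_graded (a : Fin (finrank ℝ F) ⊕ Fin (finrank ℝ F)) {k : ℤ} {w : c.Loc}
    (hw : w ∈ c.graded k) : c.dLeft a w ∈ c.graded (k - 1) := by
  induction hw using graded_induction with
  | mem i j h w hw =>
    rcases a with α | α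
    · exact bigraded_le_graded (by omega) (dLeft_inl_mem α hw)
    · exact bigraded_le_graded (by omega) (dLeft_inr_mem α hw)
  | zero => simp
  | add x y _ _ h h' => rw [map_add]; exact add_mem h h'

theorem dp_mem_graded (i : Fin n) {k : ℤ} {w : c.Loc}
    (hw : w ∈ c.graded k) : c.dp i w ∈ c.graded (k - 2) := by
  induction hw using graded_induction with
  | mem i j h w hw => exact bigraded_le_graded (by omega) (dp_mem _ hw)
  | zero => simp
  | add x y _ _ h h' => rw [map_add]; exact add_mem h h'

theorem bracket_add_left (f f' g : c.Loc) :
    c.bracket (f + f') g = c.bracket f g + c.bracket f' g := by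
  simp only [bracket_eq_poisson, SuperCalculus.poisson_add_left]

theorem bracket_add_right (f g g' : c.Loc) :
    c.bracket f (g + g') = c.bracket f g + c.bracket f g' := by
  simp only [bracket_eq_poisson, SuperCalculus.poisson_add_right]

theorem bracket_smul_left (t : ℝ) (f g : c.Loc) : c.bracket (t • f) g = t • c.bracket f g := by
  simp only [bracket_eq_poisson, SuperCalculus.poisson_smul_left]

theorem bracket_smul_right (t : ℝ) (f g : c.Loc) : c.bracket f (t • g) = t • c.bracket f g := by
  simp only [bracket_eq_poisson, SuperCalculus.poisson_smul_right]

theorem bracket_neg_left (f g : c.Loc) : c.bracket (-f) g = -c.bracket f g := by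
  simp only [bracket_eq_poisson, SuperCalculus.poisson_neg_left]

theorem bracket_neg_right (f g : c.Loc) : c.bracket f (-g) = -c.bracket f g := by
  simp only [bracket_eq_poisson, SuperCalculus.poisson_neg_right]

theorem bracket_sub_left (f f' g : c.Loc) :
    c.bracket (f - f') g = c.bracket f g - c.bracket f' g := by
  rw [sub_eq_add_neg, bracket_add_left, bracket_neg_left, sub_eq_add_neg]

theorem bracket_sub_right (f g g' : c.Loc) :
    c.bracket f (g - g') = c.bracket f g - c.bracket f g' := by
  rw [sub_eq_add_neg, bracket_add_right, bracket_neg_right, sub_eq_add_neg]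

theorem bracket_zero_left (g : c.Loc) : c.bracket 0 g = 0 := by
  simpa using bracket_smul_left 0 0 g

theorem bracket_zero_right (g : c.Loc) : c.bracket g 0 = 0 := by
  simpa using bracket_smul_right 0 g 0

theorem bracket_mem_graded {k l : ℤ} {w w' : c.Loc} (hw : w ∈ c.graded k)
    (hw' : w' ∈ c.graded l) : c.bracket w w' ∈ c.graded (k + l - 2) := by
  induction hw using graded_induction with
  | mem i j h w hw =>
    induction hw' using graded_induction with
    | mem i' j' h' w' hw' => exact bigraded_le_graded (by omega) (bracket_mem hw hw')
    | zero => rw [bracket_zero_right]; exact zero_mem _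
    | add x y _ _ h h' => rw [bracket_add_right]; exact add_mem h h'
  | zero => rw [bracket_zero_left]; exact zero_mem _
  | add x y _ _ h h' => rw [bracket_add_left]; exact add_mem h h'

/-- Euler's identity. -/
theorem euler {k : ℤ} {w : c.Loc} (hw : w ∈ c.graded k) :
    ∑ a, c.odd a * c.dLeft a w + (2 : ℝ) • ∑ i, (1 ⊗ₜ FiberAlg.p i) * c.dp i w = (k : ℝ) • w := by
  induction hw using graded_induction with
  | mem i j h w hw =>
    induction hw using Submodule.span_induction with
    | mem w hw =>
      obtain ⟨f, y, hy, rfl⟩ := hw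
      have e := FiberAlg.euler hy
      rw [← h]
      push_cast
      rw [← TensorProduct.tmul_smul, ← e]
      simp only [odd, dLeft_tmul, dp_tmul, Algebra.TensorProduct.tmul_mul_tmul, one_mul,
        TensorProduct.tmul_add, TensorProduct.tmul_sum, TensorProduct.tmul_smul]
    | zero => simp
    | add x y _ _ h h' =>
      rw [smul_add, ← h, ← h']
      simp only [map_add, mul_add, Finset.sum_add_distrib, smul_add]
      abel
    | smul t x _ h =>
      rw [smul_comm, ← h]
      simp only [map_smul, mul_smul_comm, Finset.smul_sum, smul_add, smul_comm t]
  | zero => simp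
  | add x y _ _ h h' =>
    rw [smul_add, ← h, ← h']
    simp only [map_add, mul_add, Finset.sum_add_distrib, smul_add]
    abel

theorem euler_of_dp_eq_zero {k : ℤ} {w : c.Loc} (hw : w ∈ c.graded k) (hp : ∀ i, c.dp i w = 0) :
    ∑ a, c.odd a * c.dLeft a w = (k : ℝ) • w := by
  have h := euler hw
  simpa [hp] using h

theorem eq_smul_one_of_mem_graded_zero {w : c.Loc} (hw : w ∈ c.graded 0) :
    ∃ f : c.Fn, w = f • (1 : c.Loc) := by
  induction hw using graded_induction with
  | mem i j h w hw =>
    -- Since j = -i, either both degrees are 0 or one of them is negative and the space is zero.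
    by_cases hi : i = 0
    · obtain rfl : j = 0 := by omega
      subst hi
      induction hw using Submodule.span_induction with
      | mem w hw =>
        obtain ⟨f, y, hy, rfl⟩ := hw
        obtain ⟨t, rfl⟩ := FiberAlg.bigraded_zero_zero hy
        refine ⟨t • f, ?_⟩
        rw [Algebra.algebraMap_eq_smul_one, TensorProduct.tmul_smul, TensorProduct.smul_tmul',
          Algebra.TensorProduct.one_def, TensorProduct.smul_tmul', smul_eq_mul, mul_one]
      | zero => exact ⟨0, by simp⟩
      | add x y _ _ h h' =>
        obtain ⟨f, rfl⟩ := h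
        obtain ⟨f', rfl⟩ := h'
        exact ⟨f + f', by rw [add_smul]⟩
      | smul t x _ h =>
        obtain ⟨f, rfl⟩ := h
        exact ⟨t • f, by rw [smul_assoc]⟩
    · rw [bigraded_eq_bot (by omega), Submodule.mem_bot] at hw
      exact ⟨0, by simp [hw]⟩
  | zero => exact ⟨0, by simp⟩
  | add x y _ _ h h' =>
    obtain ⟨f, rfl⟩ := h
    obtain ⟨f', rfl⟩ := h'
    exact ⟨f + f', by rw [add_smul]⟩

/-! ### Sections as functions of degree one -/

theorem coeffOdd_eq {a : Fin (finrank ℝ F) ⊕ Fin (finrank ℝ F)} {w : c.Loc} {f : c.Fn}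
    (h : c.dLeft a w = f • (1 : c.Loc)) : c.coeffOdd a w = f := by
  have hb : FiberAlg.body (1 : FiberAlg n (finrank ℝ F)) = 1 := by
    have e : (FiberAlg.equiv (1 : FiberAlg n (finrank ℝ F))) = 1 ⊗ₜ 1 := map_one _
    simp [FiberAlg.body, e]
  have hc : c.coeffOdd a w = (TensorProduct.rid ℝ c.Fn).toLinearMap
      (LinearMap.lTensor _ FiberAlg.body (c.dLeft a w)) := by
    simp only [coeffOdd, dLeft, LinearMap.lTensor_comp, LinearMap.comp_apply]
  rw [hc, h, Algebra.TensorProduct.one_def, TensorProduct.smul_tmul', smul_eq_mul, mul_one]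
  simp [hb]

theorem ofSec_eq (u : c.SecE) : c.ofSec u =
    ∑ α, u.1 α • c.odd (Sum.inr α) + ∑ α, u.2 α • c.odd (Sum.inl α) := rfl

theorem ofSec_add (u v : c.SecE) : c.ofSec (u + v) = c.ofSec u + c.ofSec v := by
  simp only [ofSec_eq, Prod.fst_add, Prod.snd_add, Pi.add_apply, add_smul, Finset.sum_add_distrib]
  abel

theorem ofSec_smul (f : c.Fn) (u : c.SecE) : c.ofSec (f • u) = f • c.ofSec u := by
  simp only [ofSec_eq, Prod.smul_fst, Prod.smul_snd, Pi.smul_apply, smul_eq_mul, mul_smul,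
    Finset.smul_sum, smul_add]

theorem ofSec_neg (u : c.SecE) : c.ofSec (-u) = -c.ofSec u := by
  rw [← neg_one_smul c.Fn u, ofSec_smul]
  exact neg_one_smul c.Fn (M := c.Loc) _

theorem ofSec_sub (u v : c.SecE) : c.ofSec (u - v) = c.ofSec u - c.ofSec v := by
  rw [sub_eq_add_neg, ofSec_add, ofSec_neg, sub_eq_add_neg]

@[simp] theorem dLeft_inl_ofSec (α : Fin (finrank ℝ F)) (u : c.SecE) :
    c.dLeft (Sum.inl α) (c.ofSec u) = u.2 α • (1 : c.Loc) := by
  simp [ofSec_eq]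

@[simp] theorem dLeft_inr_ofSec (α : Fin (finrank ℝ F)) (u : c.SecE) :
    c.dLeft (Sum.inr α) (c.ofSec u) = u.1 α • (1 : c.Loc) := by
  simp [ofSec_eq]

@[simp] theorem dp_ofSec (i : Fin n) (u : c.SecE) : c.dp i (c.ofSec u) = 0 := by
  simp [ofSec_eq]

theorem parity_ofSec (u : c.SecE) : c.calculus.parity (c.ofSec u) = -c.ofSec u := by
  simp only [ofSec_eq, map_add, map_sum, parity_smul, parity_odd, smul_neg,
    Finset.sum_neg_distrib, neg_add]

theorem toSec_ofSec (u : c.SecE) : c.toSec (c.ofSec u) = u := by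
  have h1 : ∀ α, c.coeffOdd (Sum.inr α) (c.ofSec u) = u.1 α := fun α =>
    coeffOdd_eq (dLeft_inr_ofSec α u)
  have h2 : ∀ α, c.coeffOdd (Sum.inl α) (c.ofSec u) = u.2 α := fun α =>
    coeffOdd_eq (dLeft_inl_ofSec α u)
  simp only [toSec, h1, h2]

theorem ofSec_injective : Function.Injective c.ofSec :=
  Function.LeftInverse.injective toSec_ofSec

/-- A momentum derivative would have degree -1 and hence vanishes, and each odd derivative has
degree 0, so it is a function on the base. Euler's identity rebuilds `w` from these coefficients. -/
theorem ofSec_toSec {w : c.Loc} (hw : w ∈ c.graded 1) : c.ofSec (c.toSec w) = w := by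
  have hp : ∀ i, c.dp i w = 0 := fun i => by
    have h := dp_mem_graded i hw
    rwa [graded_eq_bot (by norm_num), Submodule.mem_bot] at h
  have he := euler_of_dp_eq_zero hw hp
  have hf : ∀ a, c.dLeft a w = c.coeffOdd a w • (1 : c.Loc) := fun a => by
    have h := dLeft_mem_graded a hw
    rw [sub_self] at h
    obtain ⟨f, hf⟩ := eq_smul_one_of_mem_graded_zero h
    rw [coeffOdd_eq hf, hf]
  rw [Int.cast_one, one_smul] at he
  conv_rhs => rw [← he]
  simp only [hf, mul_smul_comm, mul_one, Fintype.sum_sum_type, ofSec_eq, toSec]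
  rw [add_comm]

theorem ofSec_fst_mem (X : c.SecA) : c.ofSec (X, 0) ∈ c.bigraded 1 0 := by
  have e : c.ofSec (X, 0) = ∑ α, X α • c.odd (Sum.inr α) := by simp [ofSec_eq]
  rw [e]
  exact sum_mem fun α _ => smul_mem _ (θ_mem α)

theorem ofSec_snd_mem (ξ : c.SecAdual) : c.ofSec (0, ξ) ∈ c.bigraded 0 1 := by
  have e : c.ofSec (0, ξ) = ∑ α, ξ α • c.odd (Sum.inl α) := by simp [ofSec_eq]
  rw [e]
  exact sum_mem fun α _ => smul_mem _ (τ_mem α)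

theorem ofSec_eq_add (X : c.SecA) (ξ : c.SecAdual) :
    c.ofSec (X, ξ) = c.ofSec (X, 0) + c.ofSec (0, ξ) := by
  simp [ofSec_eq]

theorem ofSec_mem (u : c.SecE) : c.ofSec u ∈ c.graded 1 := by
  obtain ⟨X, ξ⟩ := u
  rw [ofSec_eq_add]
  exact add_mem (bigraded_le_graded (by norm_num) (ofSec_fst_mem X))
    (bigraded_le_graded (by norm_num) (ofSec_snd_mem ξ))

/-- The nested bracket has degree (1 + 3 - 2) + 1 - 2 = 1, so reading it as a section loses nothing.
All later computations with derived brackets take place among functions. -/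
theorem ofSec_dorfman {Θ : c.Loc} (hΘ : Θ ∈ c.graded 3) (u v : c.SecE) :
    c.ofSec (c.dorfman Θ u v) = c.bracket (c.bracket (c.ofSec u) Θ) (c.ofSec v) := by
  have h := bracket_mem_graded (bracket_mem_graded (ofSec_mem u) hΘ) (ofSec_mem v)
  norm_num at h
  exact ofSec_toSec h

theorem toSec_snd_eq_zero {w : c.Loc} (hw : w ∈ c.bigraded 1 0) : (c.toSec w).2 = 0 := by
  funext α
  refine coeffOdd_eq ?_
  have h := dLeft_inl_mem α hw
  rw [bigraded_eq_bot (by omega), Submodule.mem_bot] at h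
  simp [h]

theorem toSec_fst_eq_zero {w : c.Loc} (hw : w ∈ c.bigraded 0 1) : (c.toSec w).1 = 0 := by
  funext α
  refine coeffOdd_eq ?_
  have h := dLeft_inr_mem α hw
  rw [bigraded_eq_bot (by omega), Submodule.mem_bot] at h
  simp [h]

/-- A bidegree count: {{X, γ}, Y} would have bidegree (2, -1) and vanishes, while {{X, μ}, Y} has
bidegree (1, 0) and therefore no A*-component. -/
theorem dorfman_fst {μ γ : c.Loc} (hμ : μ ∈ c.bigraded 1 2) (hγ : γ ∈ c.bigraded 2 1)
    (X Y : c.SecA) : c.dorfman (μ + γ) (X, 0) (Y, 0) = (c.bracketA μ X Y, 0) := by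
  have h0 : c.bracket (c.bracket (c.ofSec (X, 0)) γ) (c.ofSec (Y, 0)) = 0 := by
    have h := bracket_mem (bracket_mem (ofSec_fst_mem X) hγ) (ofSec_fst_mem Y)
    rwa [bigraded_eq_bot (by omega), Submodule.mem_bot] at h
  have h1 := bracket_mem (bracket_mem (ofSec_fst_mem X) hμ) (ofSec_fst_mem Y)
  refine Prod.ext ?_ ?_
  · simp only [bracketA, dorfman, bracket_add_left, bracket_add_right, h0, add_zero]
  · simp only [dorfman, bracket_add_left, bracket_add_right, h0, add_zero]
    exact toSec_snd_eq_zero (bigraded_congr h1 (by norm_num) (by norm_num))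

theorem dorfman_snd {μ γ : c.Loc} (hμ : μ ∈ c.bigraded 1 2) (hγ : γ ∈ c.bigraded 2 1)
    (ξ η : c.SecAdual) : c.dorfman (μ + γ) (0, ξ) (0, η) = (0, c.bracketAdual γ ξ η) := by
  have h0 : c.bracket (c.bracket (c.ofSec (0, ξ)) μ) (c.ofSec (0, η)) = 0 := by
    have h := bracket_mem (bracket_mem (ofSec_snd_mem ξ) hμ) (ofSec_snd_mem η)
    rwa [bigraded_eq_bot (by omega), Submodule.mem_bot] at h
  have h1 := bracket_mem (bracket_mem (ofSec_snd_mem ξ) hγ) (ofSec_snd_mem η)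
  refine Prod.ext ?_ ?_
  · simp only [dorfman, bracket_add_left, bracket_add_right, h0, zero_add]
    exact toSec_fst_eq_zero (bigraded_congr h1 (by norm_num) (by norm_num))
  · simp only [bracketAdual, dorfman, bracket_add_left, bracket_add_right, h0, zero_add]

end Coords

end Coordinates

end BigBracket

end

noncomputable section

namespace BigBracket

section Coordinates

variable {n : ℕ} {M : Type*} [TopologicalSpace M] [ChartedSpace (EuclideanSpace ℝ (Fin n)) M]
variable {F : Type*} [NormedAddCommGroup F] [NormedSpace ℝ F]
  {A : M → Type*} [TopologicalSpace (TotalSpace F A)] [∀ x, TopologicalSpace (A x)]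
  [∀ x, AddCommGroup (A x)] [∀ x, Module ℝ (A x)] [FiberBundle F A]

namespace Coords

/-! ### The Hamiltonian vector field of an endomorphism -/

/-- The function `Q^α_β τ^β θ_α` of a matrix `Q`. -/
def endFn (c : Coords (n := n) F A) (Q : Matrix (Fin (finrank ℝ F)) (Fin (finrank ℝ F)) c.Fn) :
    c.Loc := ∑ α, ∑ β, Q α β • (c.τ β * c.θ α)

/-- The skew-symmetric endomorphism `diag(Q, -ᵗQ)` of `A ⊕ A*`. -/
def endDouble (c : Coords (n := n) F A) (Q : Matrix (Fin (finrank ℝ F)) (Fin (finrank ℝ F)) c.Fn)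
    (u : c.SecE) : c.SecE := (Q *ᵥ u.1, -(Qᵀ *ᵥ u.2))

variable {c : Coords (n := n) F A} {Q : Matrix (Fin (finrank ℝ F)) (Fin (finrank ℝ F)) c.Fn}

theorem loc_neg_mul (x y : c.Loc) : -x * y = -(x * y) := neg_mul x y

theorem loc_mul_neg (x y : c.Loc) : x * -y = -(x * y) := mul_neg x y

theorem loc_smul_neg (f : c.Fn) (x : c.Loc) : f • -x = -(f • x) := smul_neg f x

theorem loc_neg_smul (f : c.Fn) (x : c.Loc) : -f • x = -(f • x) := neg_smul f x

theorem odd_mul_odd (a b : Fin (finrank ℝ F) ⊕ Fin (finrank ℝ F)) :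
    c.odd a * c.odd b = -(c.odd b * c.odd a) := by
  rw [c.calculus.odd_mul (parity_odd c a), parity_odd, loc_neg_mul]

theorem dLeft_mul (a : Fin (finrank ℝ F) ⊕ Fin (finrank ℝ F)) (x y : c.Loc) :
    c.dLeft a (x * y) = c.dLeft a x * y + c.calculus.parity x * c.dLeft a y :=
  c.calculus.dOdd_mul a x y

theorem dp_mul (i : Fin n) (x y : c.Loc) : c.dp i (x * y) = c.dp i x * y + x * c.dp i y :=
  c.calculus.dEven_mul i x y

theorem parity_endFn : c.calculus.parity (c.endFn Q) = c.endFn Q := by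
  simp [endFn, τ, θ, loc_neg_mul, loc_mul_neg]

theorem dp_endFn (i : Fin n) : c.dp i (c.endFn Q) = 0 := by
  simp [endFn, τ, θ, dp_mul]

theorem dLeft_inl_endFn (β : Fin (finrank ℝ F)) :
    c.dLeft (Sum.inl β) (c.endFn Q) = ∑ α, Q α β • c.odd (Sum.inr α) := by
  simp [endFn, τ, θ, dLeft_mul]

theorem dLeft_inr_endFn (α : Fin (finrank ℝ F)) :
    c.dLeft (Sum.inr α) (c.endFn Q) = -∑ β, Q α β • c.odd (Sum.inl β) := by
  simp [endFn, τ, θ, dLeft_mul]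

theorem endFn_mem : c.endFn Q ∈ c.bigraded 1 1 :=
  sum_mem fun α _ => sum_mem fun β _ => smul_mem _
    (bigraded_congr (mul_mem (τ_mem β) (θ_mem α)) (by norm_num) (by norm_num))

theorem bracket_endFn_eq (w : c.Loc) : c.bracket (c.endFn Q) w =
    c.calculus.ham (c.endFn Q) (fun i => c.dx i (c.endFn Q)) w := by
  rw [bracket_eq_poisson, SuperCalculus.poisson_eq_ham dp_endFn]

/-- The bidegree (1, 1) of the endomorphism exactly compensates the shift (-1, -1) of the bracket.
This keeps the contributions of μ and γ apart. -/
theorem bracket_endFn_mem {k l : ℤ} {w : c.Loc} (hw : w ∈ c.bigraded k l) :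
    c.bracket (c.endFn Q) w ∈ c.bigraded k l :=
  bigraded_congr (bracket_mem endFn_mem hw) (by ring) (by ring)

theorem bracket_endFn_mem_graded {k : ℤ} {w : c.Loc} (hw : w ∈ c.graded k) :
    c.bracket (c.endFn Q) w ∈ c.graded k := by
  have h := bracket_mem_graded (bigraded_le_graded (k := 2) (by norm_num) (endFn_mem (Q := Q))) hw
  rwa [add_sub_cancel_left] at h

theorem bracket_endFn_right (w : c.Loc) :
    c.bracket w (c.endFn Q) = -c.bracket (c.endFn Q) w := by
  rw [bracket_eq_poisson, bracket_eq_poisson,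
    SuperCalculus.poisson_antisymm parity_endFn dp_endFn c.isHorizontal_dx]

theorem dp_bracket_endFn (i : Fin n) (w : c.Loc) :
    c.dp i (c.bracket (c.endFn Q) w) = c.bracket (c.endFn Q) (c.dp i w) := by
  rw [bracket_eq_poisson, bracket_eq_poisson]
  exact SuperCalculus.poisson_dEven dp_endFn c.isHorizontal_dx i w

theorem bracket_endFn_bracket (f g : c.Loc) : c.bracket (c.endFn Q) (c.bracket f g) =
    c.bracket (c.bracket (c.endFn Q) f) g + c.bracket f (c.bracket (c.endFn Q) g) := by
  simp only [bracket_eq_poisson]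
  exact SuperCalculus.poisson_poisson parity_endFn dp_endFn c.isHorizontal_dx f g

/-- The Hamiltonian vector field of Q realises -diag(Q, -ᵗQ) on sections. It is tensorial there
because derivatives of Q only multiply momentum derivatives, and sections contain no momenta. -/
theorem bracket_endFn_ofSec (u : c.SecE) :
    c.bracket (c.endFn Q) (c.ofSec u) = -c.ofSec (c.endDouble Q u) := by
  rw [bracket_endFn_eq, SuperCalculus.ham_apply]
  have h1 : ∀ α, (Q *ᵥ u.1) α = ∑ β, Q α β * u.1 β := fun α => rfl
  have h2 : ∀ β, (-(Qᵀ *ᵥ u.2)) β = -∑ α, Q α β * u.2 α := fun β => rfl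
  simp only [calculus_dEven, calculus_dOdd, dp_ofSec, mul_zero, Finset.sum_const_zero, zero_add,
    Fintype.sum_sum_type, Sum.swap_inl, Sum.swap_inr, dLeft_inl_endFn, dLeft_inr_endFn,
    dLeft_inl_ofSec, dLeft_inr_ofSec, mul_smul_comm, mul_one, map_neg, map_sum, parity_smul,
    parity_odd, loc_smul_neg, Finset.sum_neg_distrib, neg_neg]
  simp only [ofSec_eq, endDouble, h1, h2, loc_neg_smul, Finset.sum_neg_distrib,
    neg_add, neg_neg, Finset.smul_sum, Finset.sum_smul, smul_smul]
  congr 1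
  · rw [Finset.sum_comm]
    simp only [mul_comm]
  · rw [Finset.sum_comm]
    simp only [mul_comm]

/-- The sign of the A*-block disappears on squaring, so the same scalar `l` serves for A and for A*.
-/
theorem endDouble_endDouble {l : ℝ} (hQ : Q * Q = l • 1) (u : c.SecE) :
    c.endDouble Q (c.endDouble Q u) = l • u := by
  refine Prod.ext ?_ ?_
  · simp only [endDouble, Matrix.mulVec_mulVec, hQ, Matrix.smul_mulVec, Matrix.one_mulVec,
      Prod.smul_fst]
  · simp only [endDouble, Matrix.mulVec_neg, neg_neg, Matrix.mulVec_mulVec, ← Matrix.transpose_mul,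
      hQ, Matrix.transpose_smul, Matrix.transpose_one, Matrix.smul_mulVec, Matrix.one_mulVec,
      Prod.smul_snd]

theorem ofSec_real_smul (t : ℝ) (u : c.SecE) : c.ofSec (t • u) = t • c.ofSec u := by
  simp only [ofSec_eq, Prod.smul_fst, Prod.smul_snd, Pi.smul_apply, smul_assoc,
    Finset.smul_sum, smul_add]

theorem bracket_endFn_endFn_of_mem {l : ℝ} (hQ : Q * Q = l • 1) {w : c.Loc} (hw : w ∈ c.graded 1) :
    c.bracket (c.endFn Q) (c.bracket (c.endFn Q) w) = l • w := by
  rw [← ofSec_toSec hw, bracket_endFn_ofSec, bracket_neg_right, bracket_endFn_ofSec, neg_neg,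
    endDouble_endDouble hQ, ofSec_real_smul]

variable (c Q) in
/-- The function of degree three which generates the torsion of `diag(Q, -ᵗQ)` as a derived
bracket, when `Q² = l`. -/
def torsionGen (l : ℝ) (Θ : c.Loc) : c.Loc :=
  (2⁻¹ : ℝ) • (c.bracket (c.endFn Q) (c.bracket (c.endFn Q) Θ) - l • Θ)

theorem torsionGen_mem {l : ℝ} {Θ : c.Loc} (hΘ : Θ ∈ c.graded 3) :
    c.torsionGen Q l Θ ∈ c.graded 3 :=
  Submodule.smul_mem _ _ (sub_mem (bracket_endFn_mem_graded (bracket_endFn_mem_graded hΘ))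
    (Submodule.smul_mem _ _ hΘ))

/-- {N, ·} commutes with ∂/∂p_i, and ∂Θ/∂p_i has degree one, where the square of {N, ·} is
multiplication by `l`. Subtracting lΘ removes exactly the momentum part; this is what makes the
torsion a tensor. -/
theorem dp_torsionGen {l : ℝ} (hQ : Q * Q = l • 1) {Θ : c.Loc} (hΘ : Θ ∈ c.graded 3) (i : Fin n) :
    c.dp i (c.torsionGen Q l Θ) = 0 := by
  have h := dp_mem_graded i hΘ
  norm_num at h
  rw [torsionGen, map_smul, map_sub, dp_bracket_endFn, dp_bracket_endFn,
    bracket_endFn_endFn_of_mem hQ h, map_smul, sub_self, smul_zero]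

/-- With D = {N, ·} acting on sections as -𝒩 and D² = l there, two applications of the Leibniz rule
turn {{u, D²Θ}, v} into 3l[u, v] + 2[Du, Dv] - 2D([Du, v] + [u, Dv]). Subtracting l[u, v] and
halving gives the torsion. -/
theorem ofSec_torsion {l : ℝ} (hQ : Q * Q = l • 1) {Θ : c.Loc} (hΘ : Θ ∈ c.graded 3)
    (u v : c.SecE) : c.ofSec (torsion (c.dorfman Θ) (c.endDouble Q) u v) =
      c.bracket (c.bracket (c.ofSec u) (c.torsionGen Q l Θ)) (c.ofSec v) := by
  have hX : ∀ z, c.ofSec (c.endDouble Q z) = -c.bracket (c.endFn Q) (c.ofSec z) := fun z => by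
    rw [bracket_endFn_ofSec, neg_neg]
  have hX2 : ∀ z, c.bracket (c.endFn Q) (c.bracket (c.endFn Q) (c.ofSec z)) = l • c.ofSec z :=
    fun z => bracket_endFn_endFn_of_mem hQ (ofSec_mem z)
  have hb := hX2 (c.dorfman Θ u v)
  rw [ofSec_dorfman hΘ] at hb
  have hu := hX2 u
  have hv := hX2 v
  rw [torsion, ofSec_sub, hX, ofSec_sub, hX, ofSec_add, ofSec_dorfman hΘ, ofSec_dorfman hΘ,
    ofSec_dorfman hΘ, ofSec_dorfman hΘ, hX, hX, torsionGen]
  simp only [bracket_smul_right, bracket_smul_left, bracket_sub_right, bracket_sub_left]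
  generalize c.ofSec u = U at *
  generalize c.ofSec v = V at *
  -- The Leibniz rule, solved for the term in which the derivation hits the generator. As a
  -- rewriting rule it strips both derivations off Θ.
  have leib : ∀ T U V, c.bracket (c.bracket U (c.bracket (c.endFn Q) T)) V =
      c.bracket (c.endFn Q) (c.bracket (c.bracket U T) V) -
        c.bracket (c.bracket (c.bracket (c.endFn Q) U) T) V -
        c.bracket (c.bracket U T) (c.bracket (c.endFn Q) V) := by
    intro T U V
    rw [bracket_endFn_bracket, bracket_endFn_bracket, bracket_add_left]
    abel
  simp only [leib, bracket_sub_right, bracket_neg_left, bracket_neg_right, bracket_add_right,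
    hu, hv, hb, bracket_smul_left, bracket_smul_right]
  module

/-! ### Totally skew-symmetric tensors -/

/-- The components of a section of `A ⊕ A*` in the frame `(e_α, ε^α)`. -/
def comp (u : c.SecE) : Fin (finrank ℝ F) ⊕ Fin (finrank ℝ F) → c.Fn := Sum.elim u.1 u.2

theorem dLeft_swap_ofSec (a : Fin (finrank ℝ F) ⊕ Fin (finrank ℝ F)) (u : c.SecE) :
    c.dLeft a.swap (c.ofSec u) = comp u a • (1 : c.Loc) := by
  rcases a with α | α <;> simp [comp]

theorem smul_one_injective {f g : c.Fn} (h : f • (1 : c.Loc) = g • (1 : c.Loc)) : f = g := by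
  have hb : FiberAlg.body (1 : FiberAlg n (finrank ℝ F)) = 1 := by
    have e : (FiberAlg.equiv (1 : FiberAlg n (finrank ℝ F))) = 1 ⊗ₜ 1 := map_one _
    simp [FiberAlg.body, e]
  have h' := congrArg (fun w => TensorProduct.rid ℝ c.Fn (LinearMap.lTensor _ FiberAlg.body w)) h
  simpa [Algebra.TensorProduct.one_def, TensorProduct.smul_tmul', hb] using h'

theorem pairE_smul_one (u v : c.SecE) :
    c.pairE u v • (1 : c.Loc) = ∑ a, comp v a • c.dLeft a (c.ofSec u) := by
  simp only [pairE, dotProduct, Fintype.sum_sum_type, comp, Sum.elim_inl, Sum.elim_inr,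
    dLeft_inl_ofSec, dLeft_inr_ofSec, smul_smul, ← Finset.sum_smul, ← add_smul]
  congr 2
  exact Finset.sum_congr rfl fun α _ => mul_comm _ _

section Skew

theorem skew_add {w : c.Loc} {T : c.SecE → c.SecE → c.SecE}
    (hT : ∀ u v, c.ofSec (T u v) = c.bracket (c.bracket (c.ofSec u) w) (c.ofSec v))
    (u u' v : c.SecE) : T (u + u') v = T u v + T u' v := by
  refine ofSec_injective ?_
  rw [ofSec_add, hT, hT, hT, ofSec_add, bracket_add_left, bracket_add_left]

variable {w : c.Loc} (hw : w ∈ c.graded 3) (hp : ∀ i, c.dp i w = 0)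
include hw hp

/-- Without momenta in `w`, no coefficient of `u` or `v` is ever differentiated: the derived bracket
is a contraction of second odd derivatives. These anticommute, and all the symmetries below follow
from that. -/
theorem derived_eq (u v : c.SecE) : c.bracket (c.bracket (c.ofSec u) w) (c.ofSec v) =
    -∑ a, ∑ b, (comp u a * comp v b) • c.dLeft b (c.dLeft a w) := by
  have h1 : c.bracket (c.ofSec u) w = ∑ a, comp u a • c.dLeft a w := by
    rw [bracket_eq_poisson, SuperCalculus.poisson, ← SuperCalculus.sum_swap]
    simp [calculus_dEven, calculus_dOdd, hp, dLeft_swap_ofSec]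
  -- Two derivatives lower the degree from 3 to 1, and functions of degree one are odd. This is the
  -- origin of the minus sign in the formula.
  have h2 : ∀ a b, c.calculus.parity (c.dLeft b (c.dLeft a w)) = -c.dLeft b (c.dLeft a w) := by
    intro a b
    have h := dLeft_mem_graded b (dLeft_mem_graded a hw)
    norm_num at h
    rw [← ofSec_toSec h, parity_ofSec]
  have h3 : ∀ a i, c.dp i (c.dLeft a w) = 0 := fun a i => by
    rw [← calculus_dEven, ← calculus_dOdd, c.calculus.dEven_dOdd, calculus_dEven, hp, map_zero]
  rw [h1, bracket_eq_poisson, SuperCalculus.poisson]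
  simp only [calculus_dEven, calculus_dOdd, dp_ofSec, map_sum, dp_smul, h3, smul_zero,
    Finset.sum_const_zero, zero_mul, mul_zero, sub_zero, zero_add, dLeft_swap_ofSec, dLeft_smul,
    parity_smul, h2, mul_smul_comm, mul_one, loc_smul_neg, Finset.sum_neg_distrib, Finset.smul_sum,
    smul_smul]
  rw [Finset.sum_comm]
  simp only [mul_comm]

variable {T : c.SecE → c.SecE → c.SecE}
  (hT : ∀ u v, c.ofSec (T u v) = c.bracket (c.bracket (c.ofSec u) w) (c.ofSec v))
include hT

theorem skew_smul (f : c.Fn) (u v : c.SecE) : T (f • u) v = f • T u v := by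
  refine ofSec_injective ?_
  have h : ∀ a, comp (f • u) a = f * comp u a := by rintro (a | a) <;> simp [comp]
  rw [ofSec_smul, hT, hT, derived_eq hw hp, derived_eq hw hp]
  simp only [h, smul_neg, Finset.smul_sum, smul_smul, mul_assoc]

theorem skew_swap (u v : c.SecE) : T v u = -T u v := by
  refine ofSec_injective ?_
  rw [ofSec_neg, hT, hT, derived_eq hw hp, derived_eq hw hp, Finset.sum_comm]
  congr 1
  simp only [← Finset.sum_neg_distrib, ← loc_smul_neg]
  refine Finset.sum_congr rfl fun a _ => Finset.sum_congr rfl fun b _ => ?_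
  rw [mul_comm, ← calculus_dOdd, c.calculus.dOdd_dOdd, loc_smul_neg]

theorem pairE_smul_one_eq (u v z : c.SecE) : c.pairE (T u v) z • (1 : c.Loc) =
    -∑ a, ∑ b, ∑ d, (comp u a * comp v b * comp z d) • c.dLeft d (c.dLeft b (c.dLeft a w)) := by
  have hs : ∑ d, ∑ a, ∑ b, (comp z d * (comp u a * comp v b)) •
      c.dLeft d (c.dLeft b (c.dLeft a w)) = ∑ a, ∑ b, ∑ d, (comp u a * comp v b * comp z d) •
        c.dLeft d (c.dLeft b (c.dLeft a w)) := by
    rw [Finset.sum_comm]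
    refine Finset.sum_congr rfl fun a _ => ?_
    rw [Finset.sum_comm]
    refine Finset.sum_congr rfl fun b _ => Finset.sum_congr rfl fun d _ => ?_
    rw [mul_comm (comp z d)]
  rw [pairE_smul_one, hT, derived_eq hw hp, ← hs]
  simp only [map_neg, map_sum, dLeft_smul, loc_smul_neg, Finset.smul_sum, smul_smul,
    Finset.sum_neg_distrib]

theorem skew_pairE (u v z : c.SecE) : c.pairE (T u z) v = -c.pairE (T u v) z := by
  refine smul_one_injective (c := c) ?_
  have hn : (-c.pairE (T u v) z) • (1 : c.Loc) = -(c.pairE (T u v) z • (1 : c.Loc)) :=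
    neg_smul (M := c.Loc) _ _
  rw [hn, pairE_smul_one_eq hw hp hT, pairE_smul_one_eq hw hp hT]
  congr 1
  simp only [← Finset.sum_neg_distrib, ← loc_smul_neg]
  refine Finset.sum_congr rfl fun a _ => ?_
  rw [Finset.sum_comm]
  refine Finset.sum_congr rfl fun b _ => Finset.sum_congr rfl fun d _ => ?_
  rw [← calculus_dOdd, c.calculus.dOdd_dOdd, mul_right_comm, loc_smul_neg]

/-- The components of the tensor are minus the third derivatives of `w`. Multiplying back by the odd
coordinates from the innermost derivative outwards, Euler's identity contributes the degrees 1, 2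
and 3, whose product cancels the factor ⅙. -/
theorem tildeE₃_eq : c.tildeE₃ T = -w := by
  have hcomp : ∀ a b, comp (c.frameE a) b = if a = b then 1 else 0 := by
    rintro (a | a) (b | b) <;> simp [comp, frameE, Pi.single_apply, eq_comm]
  have hφ : ∀ a b d, c.pairE (T (c.frameE a) (c.frameE b)) (c.frameE d) • (1 : c.Loc) =
      -c.dLeft d (c.dLeft b (c.dLeft a w)) := by
    intro a b d
    rw [pairE_smul_one_eq hw hp hT]
    simp [hcomp]
  have hpL : ∀ a (y : c.Loc), (∀ i, c.dp i y = 0) → ∀ i, c.dp i (c.dLeft a y) = 0 := by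
    intro a y hy i
    rw [← calculus_dEven, ← calculus_dOdd, c.calculus.dEven_dOdd, calculus_dEven, hy, map_zero]
  have e1 := euler_of_dp_eq_zero hw hp
  have e2 : ∀ a, ∑ b, c.odd b * c.dLeft b (c.dLeft a w) = (2 : ℝ) • c.dLeft a w := fun a => by
    rw [euler_of_dp_eq_zero (dLeft_mem_graded a hw) (hpL a w hp)]
    norm_num
  have e3 : ∀ a b, ∑ d, c.odd d * c.dLeft d (c.dLeft b (c.dLeft a w)) =
      c.dLeft b (c.dLeft a w) := fun a b => by
    rw [euler_of_dp_eq_zero (dLeft_mem_graded b (dLeft_mem_graded a hw))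
      (hpL b _ (hpL a w hp))]
    norm_num
  have e : ∀ a b d, c.pairE (T (c.frameE a) (c.frameE b)) (c.frameE d) •
      (c.odd a * c.odd b * c.odd d) =
        -(c.odd a * (c.odd b * (c.odd d * c.dLeft d (c.dLeft b (c.dLeft a w))))) := by
    intro a b d
    rw [← mul_one (c.odd a * c.odd b * c.odd d), ← mul_smul_comm, hφ]
    simp only [loc_mul_neg, mul_assoc]
  rw [tildeE₃]
  simp only [e, Finset.sum_neg_distrib, ← Finset.mul_sum, e3, e2, mul_smul_comm, ← Finset.smul_sum,
    e1]
  rw [smul_neg, smul_smul, smul_smul]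
  norm_num

end Skew

end Coords

end Coordinates

end BigBracket

end

noncomputable section

namespace BigBracket

section Coordinates

variable {n : ℕ} {M : Type*} [TopologicalSpace M] [ChartedSpace (EuclideanSpace ℝ (Fin n)) M]
variable {F : Type*} [NormedAddCommGroup F] [NormedSpace ℝ F]
  {A : M → Type*} [TopologicalSpace (TotalSpace F A)] [∀ x, TopologicalSpace (A x)]
  [∀ x, AddCommGroup (A x)] [∀ x, Module ℝ (A x)] [FiberBundle F A]

namespace Coords

/-! ### Components of the torsion of `diag(Q, -ᵗQ)` -/

variable {c : Coords (n := n) F A} {Q : Matrix (Fin (finrank ℝ F)) (Fin (finrank ℝ F)) c.Fn}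

theorem toSec_neg (w : c.Loc) : c.toSec (-w) = -c.toSec w := by
  simp only [toSec, map_neg]
  rfl

theorem dorfman_neg_left (Θ : c.Loc) (u v : c.SecE) : c.dorfman Θ (-u) v = -c.dorfman Θ u v := by
  rw [dorfman, ofSec_neg, bracket_neg_left, bracket_neg_left, toSec_neg, dorfman]

theorem dorfman_neg_right (Θ : c.Loc) (u v : c.SecE) : c.dorfman Θ u (-v) = -c.dorfman Θ u v := by
  rw [dorfman, ofSec_neg, bracket_neg_right, toSec_neg, dorfman]

theorem bracketAdual_neg_left (γ : c.Loc) (ξ η : c.SecAdual) :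
    c.bracketAdual γ (-ξ) η = -c.bracketAdual γ ξ η := by
  have h : ((0, -ξ) : c.SecE) = -(0, ξ) := by simp
  rw [bracketAdual, h, dorfman_neg_left]
  rfl

theorem bracketAdual_neg_right (γ : c.Loc) (ξ η : c.SecAdual) :
    c.bracketAdual γ ξ (-η) = -c.bracketAdual γ ξ η := by
  have h : ((0, -η) : c.SecE) = -(0, η) := by simp
  rw [bracketAdual, h, dorfman_neg_right]
  rfl

theorem endDouble_fst (X : c.SecA) : c.endDouble Q (X, 0) = (Q *ᵥ X, 0) := by
  simp [endDouble]

theorem endDouble_snd (ξ : c.SecAdual) : c.endDouble Q (0, ξ) = (0, -(Qᵀ *ᵥ ξ)) := by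
  simp [endDouble]

variable {μ γ : c.Loc} (hμ : μ ∈ c.bigraded 1 2) (hγ : γ ∈ c.bigraded 2 1)
include hμ hγ

theorem torsion_fst (X Y : c.SecA) :
    torsion (c.dorfman (μ + γ)) (c.endDouble Q) (X, 0) (Y, 0) =
      (torsion (c.bracketA μ) (fun X => Q *ᵥ X) X Y, 0) := by
  simp only [torsion, endDouble_fst, dorfman_fst hμ hγ, Prod.mk_add_mk, Prod.mk_sub_mk, add_zero,
    sub_zero]

/-- The torsion is quadratic in the endomorphism, so replacing -ᵗQ by ᵗQ leaves it unchanged. -/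
theorem torsion_snd (ξ η : c.SecAdual) :
    torsion (c.dorfman (μ + γ)) (c.endDouble Q) (0, ξ) (0, η) =
      (0, torsion (c.bracketAdual γ) (fun ξ => Qᵀ *ᵥ ξ) ξ η) := by
  simp only [torsion, endDouble_snd, dorfman_snd hμ hγ, Prod.mk_add_mk, Prod.mk_sub_mk, add_zero,
    sub_zero, bracketAdual_neg_left, bracketAdual_neg_right, Matrix.mulVec_neg, Matrix.mulVec_sub,
    Matrix.mulVec_add]
  congr 1
  abel

variable {l : ℝ} (hQ : Q * Q = l • 1)
include hQ

theorem ofSec_torsion_add (u v : c.SecE) :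
    c.ofSec (torsion (c.dorfman (μ + γ)) (c.endDouble Q) u v) =
      c.bracket (c.bracket (c.ofSec u) (c.torsionGen Q l (μ + γ))) (c.ofSec v) :=
  ofSec_torsion hQ (add_mem (bigraded_le_graded (by norm_num) hμ)
    (bigraded_le_graded (by norm_num) hγ)) u v

/-- A cyclic permutation is a product of two transpositions, and each of them changes the sign. -/
theorem torsion_cyclic (u v z : c.SecE) :
    c.pairE (torsion (c.dorfman (μ + γ)) (c.endDouble Q) u v) z =
      c.pairE (torsion (c.dorfman (μ + γ)) (c.endDouble Q) v z) u := by
  have hΘ : μ + γ ∈ c.graded 3 := add_mem (bigraded_le_graded (by norm_num) hμ)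
    (bigraded_le_graded (by norm_num) hγ)
  have hw := torsionGen_mem (Q := Q) (l := l) hΘ
  have hp := dp_torsionGen hQ hΘ
  have hT := ofSec_torsion hQ hΘ
  have hn : ∀ a b : c.SecE, c.pairE (-a) b = -c.pairE a b := fun a b => by
    simp [pairE, neg_dotProduct, dotProduct_neg, add_comm]
  rw [skew_swap hw hp hT v u, hn, ← skew_pairE hw hp hT]

theorem pairE_torsion (X Y Z : c.SecA) (ξ η ζ : c.SecAdual) :
    c.pairE (torsion (c.dorfman (μ + γ)) (c.endDouble Q) (X, ξ) (Y, η)) (Z, ζ) =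
      torsion (c.bracketA μ) (fun X => Q *ᵥ X) X Y ⬝ᵥ ζ +
      torsion (c.bracketA μ) (fun X => Q *ᵥ X) Y Z ⬝ᵥ ξ +
      torsion (c.bracketA μ) (fun X => Q *ᵥ X) Z X ⬝ᵥ η +
      torsion (c.bracketAdual γ) (fun ξ => Qᵀ *ᵥ ξ) ξ η ⬝ᵥ Z +
      torsion (c.bracketAdual γ) (fun ξ => Qᵀ *ᵥ ξ) η ζ ⬝ᵥ X +
      torsion (c.bracketAdual γ) (fun ξ => Qᵀ *ᵥ ξ) ζ ξ ⬝ᵥ Y := by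
  have hT := ofSec_torsion_add hμ hγ hQ
  -- Additivity in the first argument is enough; cyclic symmetry carries it to the other two.
  have hl := skew_add hT
  have hcyc := torsion_cyclic hμ hγ hQ
  have ha := torsion_fst (Q := Q) hμ hγ
  have hb := torsion_snd (Q := Q) hμ hγ
  generalize torsion (c.dorfman (μ + γ)) (c.endDouble Q) = T at *
  have hs : ∀ (X : c.SecA) (ξ : c.SecAdual), ((X, ξ) : c.SecE) = (X, 0) + (0, ξ) := by simp
  have hpl : ∀ a a' b : c.SecE, c.pairE (a + a') b = c.pairE a b + c.pairE a' b := fun a a' b => by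
    simp only [pairE, Prod.fst_add, Prod.snd_add, add_dotProduct, dotProduct_add]
    abel
  have hadd₁ : ∀ u u' v z, c.pairE (T (u + u') v) z = c.pairE (T u v) z + c.pairE (T u' v) z :=
    fun u u' v z => by rw [hl, hpl]
  have hadd₂ : ∀ u v v' z, c.pairE (T u (v + v')) z = c.pairE (T u v) z + c.pairE (T u v') z :=
    fun u v v' z => by rw [hcyc, hadd₁, ← hcyc, ← hcyc u v' z]
  have hadd₃ : ∀ u v z z', c.pairE (T u v) (z + z') = c.pairE (T u v) z + c.pairE (T u v) z' :=
    fun u v z z' => by rw [hcyc, hadd₂, ← hcyc, ← hcyc u v z']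
  rw [hs X, hs Y, hs Z]
  simp only [hadd₁, hadd₂, hadd₃]
  -- Mixed terms are rotated until the two arguments of the same kind come first. The two unmixed
  -- terms vanish because A and A* are isotropic and their torsions stay inside them.
  rw [hcyc (X, 0) (0, η) (0, ζ), hcyc (0, ξ) (Y, 0) (Z, 0), ← hcyc (Z, 0) (X, 0) (0, η),
    ← hcyc (0, ζ) (0, ξ) (Y, 0)]
  simp only [ha, hb, pairE, dotProduct_zero, zero_dotProduct, add_zero, zero_add]
  rw [dotProduct_comm ζ, dotProduct_comm ξ, dotProduct_comm η]
  abel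

/-- The sum over the frame of A ⊕ A* has eight blocks. The two unmixed blocks vanish, and the other
six form two triples of equal blocks by cyclic symmetry, so the coefficient becomes 3/6 = ½. -/
theorem tildeE₃_torsion :
    c.tildeE₃ (torsion (c.dorfman (μ + γ)) (c.endDouble Q)) =
      c.tildeA (torsion (c.bracketA μ) (fun X => Q *ᵥ X)) +
        c.tildeAdual (torsion (c.bracketAdual γ) (fun ξ => Qᵀ *ᵥ ξ)) := by
  have hcyc := torsion_cyclic hμ hγ hQ
  have ha := torsion_fst (Q := Q) hμ hγ
  have hb := torsion_snd (Q := Q) hμ hγ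
  generalize torsion (c.dorfman (μ + γ)) (c.endDouble Q) = T at *
  generalize torsion (c.bracketA μ) (fun X => Q *ᵥ X) = t at *
  generalize torsion (c.bracketAdual γ) (fun ξ => Qᵀ *ᵥ ξ) = s at *
  have hodd : ∀ a b d, c.odd a * c.odd b * c.odd d = c.odd b * c.odd d * c.odd a := by
    intro a b d
    rw [mul_assoc (c.odd b), odd_mul_odd d a, loc_mul_neg, ← mul_assoc, odd_mul_odd b a,
      loc_neg_mul, neg_neg]
  set φ : Fin (finrank ℝ F) ⊕ Fin (finrank ℝ F) → Fin (finrank ℝ F) ⊕ Fin (finrank ℝ F) →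
      Fin (finrank ℝ F) ⊕ Fin (finrank ℝ F) → c.Loc := fun a b d =>
    c.pairE (T (c.frameE a) (c.frameE b)) (c.frameE d) • (c.odd a * c.odd b * c.odd d) with hφ
  have hφc : ∀ a b d, φ a b d = φ b d a := fun a b d => by
    simp only [hφ]
    rw [hcyc, hodd]
  have h1 : ∀ a b d, φ (Sum.inl a) (Sum.inl b) (Sum.inl d) = 0 := fun a b d => by
    simp [hφ, frameE, ha, pairE]
  have h2 : ∀ a b d, φ (Sum.inr a) (Sum.inr b) (Sum.inr d) = 0 := fun a b d => by
    simp [hφ, frameE, hb, pairE]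
  have h3 : ∀ a b d, φ (Sum.inl a) (Sum.inl b) (Sum.inr d) =
      t (Pi.single a 1) (Pi.single b 1) d • (c.τ a * c.τ b * c.θ d) := fun a b d => by
    simp [hφ, frameE, ha, pairE, τ, θ]
  have h4 : ∀ a b d, φ (Sum.inr a) (Sum.inr b) (Sum.inl d) =
      s (Pi.single a 1) (Pi.single b 1) d • (c.θ a * c.θ b * c.τ d) := fun a b d => by
    simp [hφ, frameE, hb, pairE, τ, θ]
  have hsum : ∀ f : Fin (finrank ℝ F) → Fin (finrank ℝ F) → Fin (finrank ℝ F) → c.Loc,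
      ∑ a, ∑ b, ∑ d, f b d a = ∑ a, ∑ b, ∑ d, f a b d := fun f => by
    rw [Finset.sum_comm]
    exact Finset.sum_congr rfl fun a _ => Finset.sum_comm
  have h5 : ∀ a b d, φ (Sum.inl a) (Sum.inr b) (Sum.inl d) = φ (Sum.inl d) (Sum.inl a) (Sum.inr b) :=
    fun a b d => by rw [hφc, hφc]
  have h6 : ∀ a b d, φ (Sum.inr a) (Sum.inl b) (Sum.inr d) = φ (Sum.inr d) (Sum.inr a) (Sum.inl b) :=
    fun a b d => by rw [hφc, hφc]
  have h7 : ∀ a b d, φ (Sum.inr a) (Sum.inl b) (Sum.inl d) = φ (Sum.inl b) (Sum.inl d) (Sum.inr a) :=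
    fun a b d => hφc _ _ _
  have h8 : ∀ a b d, φ (Sum.inl a) (Sum.inr b) (Sum.inr d) = φ (Sum.inr b) (Sum.inr d) (Sum.inl a) :=
    fun a b d => hφc _ _ _
  have e₁ := hsum fun a b d => φ (Sum.inl a) (Sum.inl b) (Sum.inr d)
  have e₂ := hsum fun a b d => φ (Sum.inl b) (Sum.inl d) (Sum.inr a)
  have e₃ := hsum fun a b d => φ (Sum.inr a) (Sum.inr b) (Sum.inl d)
  have e₄ := hsum fun a b d => φ (Sum.inr b) (Sum.inr d) (Sum.inl a)
  change (1 / 6 : ℝ) • ∑ a, ∑ b, ∑ d, φ a b d = _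
  simp only [tildeA, tildeAdual, ← h3, ← h4]
  simp only [Fintype.sum_sum_type, Finset.sum_add_distrib, h1, h2, h5, h6, h7, h8,
    Finset.sum_const_zero, e₁, e₂, e₃, e₄, zero_add, add_zero]
  module

end Coords

end Coordinates

end BigBracket

end

noncomputable section

namespace BigBracket

section Coordinates

variable {n : ℕ} {M : Type*} [TopologicalSpace M] [ChartedSpace (EuclideanSpace ℝ (Fin n)) M]
variable {F : Type*} [NormedAddCommGroup F] [NormedSpace ℝ F]
  {A : M → Type*} [TopologicalSpace (TotalSpace F A)] [∀ x, TopologicalSpace (A x)]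
  [∀ x, AddCommGroup (A x)] [∀ x, Module ℝ (A x)] [FiberBundle F A]

namespace Coords

/-- Evaluation of functions at a point of the coordinate domain. -/
def evalFn (c : Coords (n := n) F A) (m : c.U) : c.Fn →ₐ[ℝ] ℝ where
  toFun f := f m
  map_one' := rfl
  map_mul' _ _ := rfl
  map_zero' := rfl
  map_add' _ _ := rfl
  commutes' _ := rfl

/-! ### Endomorphisms in a frame -/

theorem map_eq_sum_coeff (c : Coords (n := n) F A) {m : M} (hm : m ∈ c.U) (φ : A m →ₗ[ℝ] ℝ)
    (v : A m) : φ v = ∑ β, c.isFrame.coeff β m v * φ (c.frame β m) := by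
  have hm' : m ∈ c.chart.source := hm
  have h : v = ∑ β, c.isFrame.coeff β m v • c.frame β m := by
    have h4 := (c.isFrame.toBasisAt hm').sum_repr v
    simp only [IsLocalFrameOn.toBasisAt_coe] at h4
    simpa [IsLocalFrameOn.coeff, hm'] using h4.symm
  conv_lhs => rw [h]
  simp only [map_sum, map_smul, smul_eq_mul]

theorem coeff_frame (c : Coords (n := n) F A) {m : M} (hm : m ∈ c.U) (α β : Fin (finrank ℝ F)) :
    c.isFrame.coeff α m (c.frame β m) = if α = β then 1 else 0 := by
  have hm' : m ∈ c.chart.source := hm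
  have h : c.isFrame.coeff α m (c.frame β m) = (c.isFrame.toBasisAt hm').repr
      (c.isFrame.toBasisAt hm' β) α := by simp [IsLocalFrameOn.coeff, hm']
  rw [h, Basis.repr_self, Finsupp.single_apply]
  exact if_congr eq_comm rfl rfl

/-- A and A* are isotropic and preserved, so only the two mixed blocks survive. They agree because
the sign of -ᵗQ cancels that of θτ = -τθ, and together they absorb the factor ½. -/
theorem tildeE₂_endDouble (c : Coords (n := n) F A)
    (Q : Matrix (Fin (finrank ℝ F)) (Fin (finrank ℝ F)) c.Fn) :
    c.tildeE₂ (c.endDouble Q) = c.endFn Q := by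
  have h1 : ∀ α β, c.pairE (c.endDouble Q (c.frameE (Sum.inl α))) (c.frameE (Sum.inl β)) = 0 :=
    fun α β => by simp [pairE, frameE, endDouble]
  have h2 : ∀ α β, c.pairE (c.endDouble Q (c.frameE (Sum.inr α))) (c.frameE (Sum.inr β)) = 0 :=
    fun α β => by simp [pairE, frameE, endDouble]
  have h3 : ∀ α β, c.pairE (c.endDouble Q (c.frameE (Sum.inl α))) (c.frameE (Sum.inr β)) = Q β α :=
    fun α β => by simp [pairE, frameE, endDouble]
  have h4 : ∀ α β, c.pairE (c.endDouble Q (c.frameE (Sum.inr α))) (c.frameE (Sum.inl β)) =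
      -Q α β := fun α β => by simp [pairE, frameE, endDouble]
  have h5 : ∀ α β, (-Q α β) • (c.odd (Sum.inr α) * c.odd (Sum.inl β)) =
      Q α β • (c.τ β * c.θ α) := fun α β => by
    rw [odd_mul_odd, loc_smul_neg, loc_neg_smul, neg_neg]
    rfl
  have h6 : ∑ α, ∑ β, Q β α • (c.odd (Sum.inl α) * c.odd (Sum.inr β)) = c.endFn Q :=
    Finset.sum_comm
  have h7 : ∑ α, ∑ β, Q α β • (c.τ β * c.θ α) = c.endFn Q := rfl
  have h0 : ∀ w : c.Loc, (0 : c.Fn) • w = 0 := fun w => zero_smul _ w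
  simp only [tildeE₂, Fintype.sum_sum_type, h1, h2, h3, h4, h5, h0, Finset.sum_add_distrib,
    Finset.sum_const_zero, zero_add, add_zero, h6, h7]
  module

end Coords

end Coordinates

/-! ### Matrices of bundle endomorphisms with scalar square. -/

section Endomorphisms

variable {n : ℕ} {M : Type*} [TopologicalSpace M] [ChartedSpace (EuclideanSpace ℝ (Fin n)) M]
variable {F : Type*} [NormedAddCommGroup F] [NormedSpace ℝ F]
  {A : M → Type*} [TopologicalSpace (TotalSpace F A)]
  [∀ x, TopologicalSpace (A x)]
  [∀ x, AddCommGroup (A x)] [∀ x, Module ℝ (A x)]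
  [FiberBundle F A] [VectorBundle ℝ F A]
  [∀ x, IsTopologicalAddGroup (A x)] [∀ x, ContinuousSMul ℝ (A x)]

/-- The scalar is κ²ε. It is constant on M, which allows it to pass through every bracket. -/
theorem IsProportionalToAlmostCps.exists_sq {N : EndA (n := n) F A}
    (h : IsProportionalToAlmostCps N) : ∃ l : ℝ, ∀ x (v : A x), N x (N x v) = l • v := by
  obtain ⟨κ, J, ⟨ε, -, hJ⟩, hN⟩ := h
  refine ⟨κ * κ * ε, fun x v => ?_⟩
  rw [hN, hN, map_smul, hJ, smul_smul, smul_smul, mul_assoc]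

variable [FiniteDimensional ℝ F] [ContMDiffVectorBundle ∞ F A (𝓡 n)]

namespace EndA

theorem double_eq (N : EndA (n := n) F A) (c : Coords (n := n) F A) :
    N.double c = c.endDouble (N.mat c) := rfl

theorem doubleFn_eq (N : EndA (n := n) F A) : N.doubleFn = N.fn :=
  funext fun c => c.tildeE₂_endDouble (N.mat c)

theorem mat_mul_mat {N : EndA (n := n) F A} {l : ℝ} (h : ∀ x (v : A x), N x (N x v) = l • v)
    (c : Coords (n := n) F A) : N.mat c * N.mat c = l • 1 := by
  ext α β m
  have h1 : (N.mat c * N.mat c) α β m = ∑ δ, c.isFrame.coeff α m (N m (c.frame δ m)) *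
      c.isFrame.coeff δ m (N m (c.frame β m)) := by
    rw [Matrix.mul_apply]
    exact map_sum (c.evalFn m) _ _
  have h2 := c.map_eq_sum_coeff m.2 ((c.isFrame.coeff α m).comp (N m).toLinearMap)
    (N m (c.frame β m))
  simp only [LinearMap.comp_apply, ContinuousLinearMap.coe_coe, h] at h2
  rw [h1, Finset.sum_congr rfl fun δ _ => mul_comm _ _, ← h2, map_smul, c.coeff_frame m.2,
    Matrix.smul_apply, Matrix.one_apply]
  change _ = l * _
  split_ifs <;> rfl

end EndA

end Endomorphisms

end BigBracket

end

noncomputable section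

namespace BigBracket

/-! ### The fibrewise derivation of an endomorphism -/

namespace FiberAlg

variable {n r : ℕ}

/-- The element `Q^α_β τ^β θ_α`. -/
def matFn (Q : Matrix (Fin r) (Fin r) ℝ) : FiberAlg n r := ∑ α, ∑ β, Q α β • (τ β * θ α)

theorem matFn_add (Q Q' : Matrix (Fin r) (Fin r) ℝ) :
    (matFn (Q + Q') : FiberAlg n r) = matFn Q + matFn Q' := by
  simp [matFn, add_smul, Finset.sum_add_distrib]

theorem matFn_smul (t : ℝ) (Q : Matrix (Fin r) (Fin r) ℝ) :
    (matFn (t • Q) : FiberAlg n r) = t • matFn Q := by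
  simp [matFn, mul_smul, Finset.smul_sum]

theorem matFn_sum {ι : Type*} (s : Finset ι) (Q : ι → Matrix (Fin r) (Fin r) ℝ) :
    (matFn (∑ i ∈ s, Q i) : FiberAlg n r) = ∑ i ∈ s, matFn (Q i) :=
  map_sum (⟨⟨matFn, matFn_add⟩, matFn_smul⟩ : _ →ₗ[ℝ] FiberAlg n r) _ _

theorem parity_matFn (Q : Matrix (Fin r) (Fin r) ℝ) :
    parity (matFn Q : FiberAlg n r) = matFn Q := by
  simp [matFn, τ, θ, parity_odd]

theorem dLeft_inl_matFn (Q : Matrix (Fin r) (Fin r) ℝ) (β : Fin r) :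
    dLeft (Sum.inl β) (matFn Q : FiberAlg n r) = ∑ α, Q α β • θ α := by
  simp [matFn, τ, θ, dLeft_mul, dLeft_odd, parity_odd]

theorem dLeft_inr_matFn (Q : Matrix (Fin r) (Fin r) ℝ) (α : Fin r) :
    dLeft (Sum.inr α) (matFn Q : FiberAlg n r) = -∑ β, Q α β • τ β := by
  simp [matFn, τ, θ, dLeft_mul, dLeft_odd, parity_odd]

/-- The value of the Hamiltonian vector field of `Q^α_β τ^β θ_α`, given the value of `Q` and the
values `Q' i` of its partial derivatives. -/
def matDer (Q : Matrix (Fin r) (Fin r) ℝ) (Q' : Fin n → Matrix (Fin r) (Fin r) ℝ) :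
    FiberAlg n r →ₗ[ℝ] FiberAlg n r := calculus.ham (matFn Q) fun i => matFn (Q' i)

variable (Q : Matrix (Fin r) (Fin r) ℝ) (Q' : Fin n → Matrix (Fin r) (Fin r) ℝ)

theorem matDer_mul (x y : FiberAlg n r) :
    matDer Q Q' (x * y) = matDer Q Q' x * y + x * matDer Q Q' y :=
  calculus.ham_mul (parity_matFn Q) (fun i => parity_matFn (Q' i)) x y

theorem matDer_algebraMap (t : ℝ) : matDer Q Q' (algebraMap ℝ _ t) = 0 := by
  have h := matDer_mul Q Q' 1 1
  rw [mul_one, mul_one, one_mul, left_eq_add] at h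
  rw [Algebra.algebraMap_eq_smul_one, map_smul, h, smul_zero]

theorem matDer_apply (y : FiberAlg n r) : matDer Q Q' y =
    ∑ i, matFn (Q' i) * dp i y + ∑ a, parity (dLeft a (matFn Q)) * dLeft a.swap y :=
  calculus.ham_apply _ _ _

theorem matDer_τ (α : Fin r) : matDer Q Q' (τ α) = ∑ β, Q α β • τ β := by
  rw [matDer_apply]
  simp only [τ, dp_odd, mul_zero, Finset.sum_const_zero, zero_add, Fintype.sum_sum_type,
    Sum.swap_inl, Sum.swap_inr, dLeft_odd, dLeft_inr_matFn, Sum.inl.injEq, reduceCtorEq,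
    if_false, mul_ite, mul_one, Finset.sum_ite_eq', Finset.mem_univ, if_true]
  simp [parity_odd]

theorem matDer_θ (β : Fin r) : matDer Q Q' (θ β) = -∑ α, Q α β • θ α := by
  rw [matDer_apply]
  simp only [θ, dp_odd, mul_zero, Finset.sum_const_zero, zero_add, Fintype.sum_sum_type,
    Sum.swap_inl, Sum.swap_inr, dLeft_odd, dLeft_inl_matFn, Sum.inr.injEq, reduceCtorEq,
    if_false, mul_ite, mul_one, Finset.sum_ite_eq', Finset.mem_univ, if_true, add_zero]
  simp [parity_odd]

theorem matDer_p (j : Fin n) : matDer Q Q' (p j) = matFn (Q' j) := by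
  rw [matDer_apply]
  simp [dp_p, dLeft_p]

/-- On momentum-free elements of bidegree (1, 1) the big bracket is the commutator of matrices, up
to sign. -/
theorem matDer_matFn (R : Matrix (Fin r) (Fin r) ℝ) :
    matDer Q Q' (matFn R) = matFn (R * Q - Q * R) := by
  have h1 : ∑ α, ∑ β, R α β • (matDer Q Q' (τ β) * θ α) =
      (matFn (R * Q) : FiberAlg n r) := by
    simp only [matFn, matDer_τ, Finset.sum_mul, Finset.smul_sum, smul_mul_assoc, smul_smul,
      Matrix.mul_apply, Finset.sum_smul]
    exact Finset.sum_congr rfl fun α _ => Finset.sum_comm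
  have h2 : ∑ α, ∑ β, R α β • (τ β * matDer Q Q' (θ α)) =
      -(matFn (Q * R) : FiberAlg n r) := by
    simp only [matFn, matDer_θ, mul_neg, smul_neg, Finset.sum_neg_distrib, Finset.mul_sum,
      Finset.smul_sum, mul_smul_comm, smul_smul, Matrix.mul_apply, Finset.sum_smul]
    rw [neg_inj, Finset.sum_comm]
    rw [Finset.sum_comm (f := fun α β => ∑ δ, (Q α δ * R δ β) • (τ β * θ α : FiberAlg n r))]
    refine Finset.sum_congr rfl fun β _ => ?_
    rw [Finset.sum_comm]
    simp only [mul_comm]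
  have h3 : matDer Q Q' (matFn R) = ∑ α, ∑ β, (R α β • (matDer Q Q' (τ β) * θ α) +
      R α β • (τ β * matDer Q Q' (θ α))) := by
    conv_lhs => rw [matFn]
    simp only [map_sum, map_smul, matDer_mul, smul_add]
  have h4 : R * Q - Q * R = R * Q + (-1 : ℝ) • (Q * R) := by rw [neg_one_smul, sub_eq_add_neg]
  rw [h3]
  simp only [Finset.sum_add_distrib, h1, h2]
  rw [h4, matFn_add, matFn_smul, neg_one_smul]

/-- Two algebra homomorphisms which agree on the coordinates are equal. -/
theorem algHom_ext {B : Type*} [Ring B] [Algebra ℝ B] {ψ ψ' : FiberAlg n r →ₐ[ℝ] B}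
    (hτ : ∀ α, ψ (τ α) = ψ' (τ α)) (hθ : ∀ α, ψ (θ α) = ψ' (θ α)) (hp : ∀ i, ψ (p i) = ψ' (p i)) :
    ψ = ψ' := by
  refine AlgHom.ext fun x => ?_
  induction x using induction with
  | scalar t => rw [AlgHom.commutes, AlgHom.commutes]
  | p i => exact hp i
  | odd a => exact a.casesOn hτ hθ
  | add x y h h' => rw [map_add, map_add, h, h']
  | mul x y h h' => rw [map_mul, map_mul, h, h']

/-- Both sides obey the Leibniz rule along ψ, so they are compared on generators. The case of τ is
`hT`, that of θ is `hS`. The case of p is `hK`, the transformation law of the derivatives of the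
matrix, where the inhomogeneous part Γ of the transformed momenta yields a commutator. -/
theorem map_matDer {ψ : FiberAlg n r →ₐ[ℝ] FiberAlg n r} {T S R : Matrix (Fin r) (Fin r) ℝ}
    {Γ R' : Fin n → Matrix (Fin r) (Fin r) ℝ} {K : Matrix (Fin n) (Fin n) ℝ}
    (hτ : ∀ α, ψ (τ α) = ∑ β, T α β • τ β) (hθ : ∀ α, ψ (θ α) = ∑ β, S β α • θ β)
    (hp : ∀ j, ψ (p j) = ∑ i, K j i • (p i + matFn (Γ i)))
    (hT : R * T = T * Q) (hS : S * R = Q * S)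
    (hK : ∀ j, S * R' j * T = ∑ i, K j i • (Q' i + (Γ i * Q - Q * Γ i))) (x : FiberAlg n r) :
    ψ (matDer R R' x) = matDer Q Q' (ψ x) := by
  have hs : ∀ g : Fin r → Fin r → Fin r → FiberAlg n r,
      ∑ α, ∑ β, ∑ δ, g α β δ = ∑ δ, ∑ α, ∑ β, g α β δ := fun g =>
    (Finset.sum_congr rfl fun α _ => Finset.sum_comm).trans Finset.sum_comm
  -- Substituting the transformed τ and θ multiplies the matrix by T on the right and by S on the
  -- left.
  have hψ : ∀ P, ψ (matFn P) = matFn (S * P * T) := fun P => by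
    have e : ∀ α β, ψ (P α β • (τ β * θ α)) =
        ∑ δ, ∑ ε, (S δ α * P α β * T β ε) • (τ ε * θ δ : FiberAlg n r) := fun α β => by
      rw [map_smul, map_mul, hτ, hθ, Finset.sum_mul, Finset.smul_sum, Finset.sum_comm]
      refine Finset.sum_congr rfl fun ε _ => ?_
      rw [Finset.mul_sum, Finset.smul_sum]
      refine Finset.sum_congr rfl fun δ _ => ?_
      rw [smul_mul_smul_comm, smul_smul]
      congr 1
      ring
    rw [matFn, map_sum]
    simp only [map_sum, e]
    simp only [matFn, Matrix.mul_apply, Finset.sum_smul, Finset.sum_mul]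
    rw [hs]
    refine Finset.sum_congr rfl fun δ _ => ?_
    rw [hs]
    exact Finset.sum_congr rfl fun ε _ => Finset.sum_comm
  induction x using induction with
  | scalar t => rw [matDer_algebraMap, AlgHom.commutes, matDer_algebraMap, map_zero]
  | p j =>
    rw [matDer_p, hψ, hK, hp, matFn_sum, map_sum]
    simp only [map_smul, map_add, matDer_p, matDer_matFn, matFn_smul, matFn_add]
  | odd a =>
    rcases a with α | α
    · change ψ (matDer R R' (τ α)) = matDer Q Q' (ψ (τ α))
      rw [matDer_τ, hτ]
      simp only [map_sum, map_smul, hτ, matDer_τ, Finset.smul_sum, smul_smul]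
      rw [Finset.sum_comm]
      have h := fun β => congrFun (congrFun hT α) β
      simp only [Matrix.mul_apply] at h
      rw [Finset.sum_comm (f := fun β δ => (T α β * Q β δ) • (τ δ : FiberAlg n r))]
      simp only [← Finset.sum_smul, h]
    · change ψ (matDer R R' (θ α)) = matDer Q Q' (ψ (θ α))
      rw [matDer_θ, hθ]
      simp only [map_neg, map_sum, map_smul, hθ, matDer_θ, Finset.smul_sum, smul_smul, smul_neg,
        Finset.sum_neg_distrib]
      rw [neg_inj, Finset.sum_comm]
      have h := fun β => congrFun (congrFun hS β) α
      simp only [Matrix.mul_apply] at h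
      rw [Finset.sum_comm (f := fun β δ => (S β α * Q δ β) • (θ δ : FiberAlg n r))]
      simp only [← Finset.sum_smul, mul_comm, h]
  | add x y h h' => simp only [map_add, h, h']
  | mul x y h h' => simp only [map_mul, map_add, matDer_mul, h, h']

end FiberAlg

end BigBracket

end

noncomputable section

namespace BigBracket

/-! ### Change of coordinates -/

section Coordinates

variable {n : ℕ} {M : Type*} [TopologicalSpace M] [ChartedSpace (EuclideanSpace ℝ (Fin n)) M]
variable {F : Type*} [NormedAddCommGroup F] [NormedSpace ℝ F]
  {A : M → Type*} [TopologicalSpace (TotalSpace F A)] [∀ x, TopologicalSpace (A x)]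
  [∀ x, AddCommGroup (A x)] [∀ x, Module ℝ (A x)] [FiberBundle F A]

namespace Coords

variable (c c' : Coords (n := n) F A) {m : M}

theorem tendsto_chart_symm (hm : m ∈ c.U) :
    Filter.Tendsto c.chart.symm (nhds (c.chart m)) (nhds m) := by
  have h := c.chart.continuousAt_symm (c.chart.map_source hm)
  rwa [ContinuousAt, c.chart.left_inv hm] at h

theorem deriv_congr (hm : m ∈ c.U) {f g : M → ℝ} (h : f =ᶠ[nhds m] g) (i : Fin n) :
    c.deriv i f m = c.deriv i g m := by
  rw [deriv, deriv, (h.comp_tendsto (c.tendsto_chart_symm hm)).fderiv_eq]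

theorem differentiableAt_comp_symm (hm : m ∈ c.U) {f : M → ℝ}
    (hf : ContMDiffAt (𝓡 n) 𝓘(ℝ, ℝ) ∞ f m) :
    DifferentiableAt ℝ (f ∘ c.chart.symm) (c.chart m) := by
  have hm' := c.chart.map_source hm
  have h : ContMDiffAt (𝓡 n) 𝓘(ℝ, ℝ) ∞ (f ∘ c.chart.symm) (c.chart m) := by
    refine ContMDiffAt.comp _ ?_ (contMDiffAt_symm_of_mem_maximalAtlas c.chart_mem hm')
    rwa [c.chart.left_inv hm]
  exact h.contDiffAt.differentiableAt (by simp)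

theorem deriv_sum_mul (hm : m ∈ c.U) {ι : Type*} (s : Finset ι) {f g : ι → M → ℝ}
    (hf : ∀ k ∈ s, ContMDiffAt (𝓡 n) 𝓘(ℝ, ℝ) ∞ (f k) m)
    (hg : ∀ k ∈ s, ContMDiffAt (𝓡 n) 𝓘(ℝ, ℝ) ∞ (g k) m) (i : Fin n) :
    c.deriv i (fun x => ∑ k ∈ s, f k x * g k x) m =
      ∑ k ∈ s, (c.deriv i (f k) m * g k m + f k m * c.deriv i (g k) m) := by
  have hf' := fun k hk => c.differentiableAt_comp_symm hm (hf k hk)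
  have hg' := fun k hk => c.differentiableAt_comp_symm hm (hg k hk)
  have e : (fun x => ∑ k ∈ s, f k x * g k x) ∘ c.chart.symm =
      fun y => ∑ k ∈ s, ((f k ∘ c.chart.symm) * (g k ∘ c.chart.symm)) y := rfl
  rw [deriv, e, fderiv_fun_sum fun k hk => (hf' k hk).mul (hg' k hk), sum_apply]
  refine Finset.sum_congr rfl fun k hk => ?_
  rw [fderiv_mul (hf' k hk) (hg' k hk)]
  simp only [Function.comp_apply, c.chart.left_inv hm, add_apply, smul_apply, smul_eq_mul, deriv]
  ring

/-- The chain rule for the coordinate vector fields of two charts. -/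
theorem deriv_eq_sum (hm : m ∈ c.U) (hm' : m ∈ c'.U) {f : M → ℝ}
    (hf : ContMDiffAt (𝓡 n) 𝓘(ℝ, ℝ) ∞ f m) (j : Fin n) :
    c'.deriv j f m = ∑ i, c'.deriv j (fun x => c.chart x i) m * c.deriv i f m := by
  have hd : DifferentiableAt ℝ (c.chart ∘ c'.chart.symm) (c'.chart m) := by
    have h : ContMDiffAt (𝓡 n) (𝓡 n) ∞ (c.chart ∘ c'.chart.symm) (c'.chart m) := by
      refine ContMDiffAt.comp _ ?_ (contMDiffAt_symm_of_mem_maximalAtlas c'.chart_mem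
        (c'.chart.map_source hm'))
      rw [c'.chart.left_inv hm']
      exact contMDiffAt_of_mem_maximalAtlas c.chart_mem hm
    exact h.contDiffAt.differentiableAt (by simp)
  have hsource : ∀ᶠ x in nhds m, x ∈ c.chart.source := c.chart.open_source.mem_nhds hm
  have e : f ∘ c'.chart.symm =ᶠ[nhds (c'.chart m)]
      (f ∘ c.chart.symm) ∘ (c.chart ∘ c'.chart.symm) := by
    filter_upwards [(c'.tendsto_chart_symm hm').eventually hsource] with y hy
    simp only [Function.comp_apply, c.chart.left_inv hy]
  have hcm : (c.chart ∘ c'.chart.symm) (c'.chart m) = c.chart m := by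
    rw [Function.comp_apply, c'.chart.left_inv hm']
  have hf' := c.differentiableAt_comp_symm hm hf
  have hi : ∀ i, c'.deriv j (fun x => c.chart x i) m =
      fderiv ℝ (c.chart ∘ c'.chart.symm) (c'.chart m) (EuclideanSpace.single j 1) i := fun i => by
    let pr : EuclideanSpace ℝ (Fin n) →L[ℝ] ℝ := EuclideanSpace.proj i
    have h := (pr.hasFDerivAt.comp _ hd.hasFDerivAt).fderiv
    have e' : (fun x => c.chart x i) ∘ c'.chart.symm = pr ∘ (c.chart ∘ c'.chart.symm) := rfl
    rw [deriv, e', h]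
    rfl
  rw [deriv, e.fderiv_eq, fderiv_comp _ (by rwa [hcm]) hd, hcm]
  simp only [hi]
  simp only [deriv]
  set v := fderiv ℝ (c.chart ∘ c'.chart.symm) (c'.chart m) (EuclideanSpace.single j 1)
  have hv : v = ∑ i, v i • EuclideanSpace.single i (1 : ℝ) := by
    ext k
    simp [Pi.single_apply]
  rw [ContinuousLinearMap.comp_apply]
  change fderiv ℝ (f ∘ c.chart.symm) (c.chart m) v = _
  conv_lhs => rw [hv]
  simp only [map_sum, map_smul, smul_eq_mul]

/-- Restriction of canonical coordinates to an open subset. -/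
def restrict (s : TopologicalSpace.Opens M) : Coords (n := n) F A where
  chart := c.chart.restr s
  chart_mem := restr_mem_maximalAtlas _ c.chart_mem s.2
  frame := c.frame
  isFrame := c.isFrame.mono (by
    rw [c.chart.restr_source]
    exact Set.inter_subset_left)

theorem mem_restrict {s : TopologicalSpace.Opens M} (hm : m ∈ c.U) (hs : m ∈ s) :
    m ∈ (c.restrict s).U := by
  change m ∈ (c.chart.restr s).source
  rw [c.chart.restr_source, s.isOpen.interior_eq]
  exact ⟨hm, hs⟩

theorem coeff_restrict {s : TopologicalSpace.Opens M} (hm : m ∈ c.U) (hs : m ∈ s)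
    (α : Fin (finrank ℝ F)) (v : A m) :
    (c.restrict s).isFrame.coeff α m v = c.isFrame.coeff α m v := by
  rw [c.map_eq_sum_coeff hm, c.map_eq_sum_coeff hm (c.isFrame.coeff α m)]
  refine Finset.sum_congr rfl fun β _ => ?_
  have h : (c.restrict s).isFrame.coeff α m (c.frame β m) = if α = β then 1 else 0 :=
    (c.restrict s).coeff_frame (c.mem_restrict hm hs) α β
  rw [h, c.coeff_frame hm]

/-- The components of a frame in another frame are smooth. -/
theorem contMDiffAt_coeff_frame [VectorBundle ℝ F A] [FiniteDimensional ℝ F]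
    [ContMDiffVectorBundle ∞ F A (𝓡 n)] (hm : m ∈ c.U) (hm' : m ∈ c'.U)
    (α β : Fin (finrank ℝ F)) :
    ContMDiffAt (𝓡 n) 𝓘(ℝ, ℝ) ∞ (fun x => c'.isFrame.coeff α x (c.frame β x)) m := by
  -- `contMDiffOn_coeff` wants a section smooth on the whole chart domain, while the other frame is
  -- smooth only on its own. Restricting to the overlap reconciles the two.
  have hsub : (c'.restrict c.U).chart.source ⊆ c.chart.source := by
    change (c'.chart.restr c.U).source ⊆ _
    rw [c'.chart.restr_source, c.U.isOpen.interior_eq]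
    exact Set.inter_subset_right
  have h1 := contMDiffOn_coeff (c'.restrict c.U) ((c.isFrame.contMDiffOn β).mono hsub) α
  have h2 := h1.contMDiffAt ((c'.restrict c.U).chart.open_source.mem_nhds
    (c'.mem_restrict hm' hm))
  refine h2.congr_of_eventuallyEq ?_
  filter_upwards [c.U.2.mem_nhds hm, c'.U.2.mem_nhds hm'] with x hx hx'
  exact (c'.coeff_restrict hx' hx α _).symm

end Coords

end Coordinates

end BigBracket

end

noncomputable section

namespace BigBracket

/-! ### Global functions -/

section Coordinates

variable {n : ℕ} {M : Type*} [TopologicalSpace M] [ChartedSpace (EuclideanSpace ℝ (Fin n)) M]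
variable {F : Type*} [NormedAddCommGroup F] [NormedSpace ℝ F]
  {A : M → Type*} [TopologicalSpace (TotalSpace F A)] [∀ x, TopologicalSpace (A x)]
  [∀ x, AddCommGroup (A x)] [∀ x, Module ℝ (A x)] [FiberBundle F A]

/-- Globality asserts the existence of a coordinate change for each function separately. By
uniqueness, two global functions share it and can be added. -/
theorem IsCoordChange.unique {c c' : Coords (n := n) F A} {m : M}
    {ψ ψ' : FiberAlg n (finrank ℝ F) →ₐ[ℝ] FiberAlg n (finrank ℝ F)}
    (h : IsCoordChange c c' m ψ) (h' : IsCoordChange c c' m ψ') : ψ = ψ' :=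
  FiberAlg.algHom_ext (fun α => by rw [h.map_τ, h'.map_τ]) (fun α => by rw [h.map_θ, h'.map_θ])
    fun j => by rw [h.map_p, h'.map_p]

namespace Family.IsGlobal

theorem add {f g : Family (n := n) F A} (hf : f.IsGlobal) (hg : g.IsGlobal) :
    (f + g).IsGlobal := fun c c' m h h' => by
  obtain ⟨ψ, hψ, e⟩ := hf c c' m h h'
  obtain ⟨ψ', hψ', e'⟩ := hg c c' m h h'
  obtain rfl := hψ.unique hψ'
  exact ⟨ψ, hψ, by rw [Pi.add_apply, Pi.add_apply, map_add, map_add, map_add, e, e']⟩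

theorem smul {f : Family (n := n) F A} (t : ℝ) (hf : f.IsGlobal) : (t • f).IsGlobal :=
  fun c c' m h h' => by
    obtain ⟨ψ, hψ, e⟩ := hf c c' m h h'
    exact ⟨ψ, hψ, by rw [Pi.smul_apply, Pi.smul_apply, map_smul, map_smul, map_smul, e]⟩

end Family.IsGlobal

namespace Coords

variable (c : Coords (n := n) F A) (m : c.U)

theorem eval_tmul (f : c.Fn) (y : FiberAlg n (finrank ℝ F)) : c.eval m (f ⊗ₜ y) = f m • y := rfl

theorem eval_smul (f : c.Fn) (w : c.Loc) : c.eval m (f • w) = f m • c.eval m w := by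
  induction w using TensorProduct.induction_on with
  | zero => simp
  | add x y h h' => simp only [smul_add, map_add, h, h']
  | tmul t z =>
    rw [TensorProduct.smul_tmul', eval_tmul, eval_tmul, smul_smul]
    rfl

theorem eval_mul (w w' : c.Loc) : c.eval m (w * w') = c.eval m w * c.eval m w' := by
  induction w using TensorProduct.induction_on with
  | zero => simp
  | add x y h h' => simp only [add_mul, map_add, h, h']
  | tmul f y =>
    induction w' using TensorProduct.induction_on with
    | zero => simp
    | add x y h h' => simp only [mul_add, map_add, h, h']
    | tmul f' y' =>
      rw [Algebra.TensorProduct.tmul_mul_tmul, eval_tmul, eval_tmul, eval_tmul,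
        smul_mul_smul_comm]
      rfl

theorem eval_odd (a : Fin (finrank ℝ F) ⊕ Fin (finrank ℝ F)) :
    c.eval m (c.odd a) = FiberAlg.odd a := by
  rw [odd, eval_tmul]
  exact one_smul _ _

theorem eval_dp (i : Fin n) (w : c.Loc) : c.eval m (c.dp i w) = FiberAlg.dp i (c.eval m w) := by
  induction w using TensorProduct.induction_on with
  | zero => simp
  | add x y h h' => simp only [map_add, h, h']
  | tmul f y => rw [dp_tmul, eval_tmul, eval_tmul, map_smul]

theorem eval_dLeft (a : Fin (finrank ℝ F) ⊕ Fin (finrank ℝ F)) (w : c.Loc) :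
    c.eval m (c.dLeft a w) = FiberAlg.dLeft a (c.eval m w) := by
  induction w using TensorProduct.induction_on with
  | zero => simp
  | add x y h h' => simp only [map_add, h, h']
  | tmul f y => rw [dLeft_tmul, eval_tmul, eval_tmul, map_smul]

theorem eval_parity (w : c.Loc) :
    c.eval m (c.calculus.parity w) = FiberAlg.parity (c.eval m w) := by
  induction w using TensorProduct.induction_on with
  | zero => simp
  | add x y h h' => simp only [map_add, h, h']
  | tmul f y => rw [parity_tmul, eval_tmul, eval_tmul, map_smul]

variable {c} (Q : Matrix (Fin (finrank ℝ F)) (Fin (finrank ℝ F)) c.Fn)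

theorem eval_endFn : c.eval m (c.endFn Q) = FiberAlg.matFn (Matrix.of fun α β => Q α β m) := by
  simp only [endFn, map_sum, eval_smul, eval_mul, τ, θ, eval_odd]
  rfl

theorem dx_endFn (i : Fin n) :
    c.dx i (c.endFn Q) = c.endFn (Matrix.of fun α β => c.partialX i (Q α β)) := by
  have h : ∀ β α, c.dx i (c.τ β * c.θ α) = 0 := fun β α => by
    rw [c.isHorizontal_dx.d_mul, τ, θ, dx_odd, dx_odd, zero_mul, mul_zero, add_zero]
  simp [endFn, h]

/-- Since N has no momenta, `w` is not differentiated along the base. The value of the bracket at a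
point therefore depends only on the value of `w` there, so globality can be checked point by point.
-/
theorem eval_bracket_endFn (w : c.Loc) : c.eval m (c.bracket (c.endFn Q) w) =
    FiberAlg.matDer (Matrix.of fun α β => Q α β m)
      (fun i => Matrix.of fun α β => c.partialX i (Q α β) m) (c.eval m w) := by
  refine Eq.trans ?_ (FiberAlg.matDer_apply _ _ _).symm
  rw [bracket_endFn_eq, SuperCalculus.ham_apply]
  simp only [map_add, map_sum, eval_mul, eval_parity, calculus_dEven, calculus_dOdd, eval_dp,
    eval_dLeft, dx_endFn, eval_endFn, Matrix.of_apply]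

/-- The matrix `T^α_β` of the change of frames `e_β = T^α_β e'_α`. -/
def transition (c c' : Coords (n := n) F A) (x : M) :
    Matrix (Fin (finrank ℝ F)) (Fin (finrank ℝ F)) ℝ :=
  fun α β => c'.isFrame.coeff α x (c.frame β x)

theorem transition_mul_transition (c c' : Coords (n := n) F A) {m : M} (hm : m ∈ c.U)
    (hm' : m ∈ c'.U) : c.transition c' m * c'.transition c m = 1 := by
  ext α β
  have h := c.map_eq_sum_coeff hm (c'.isFrame.coeff α m) (c'.frame β m)
  rw [c'.coeff_frame hm'] at h
  rw [Matrix.mul_apply, Matrix.one_apply, h]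
  exact Finset.sum_congr rfl fun δ _ => mul_comm _ _

end Coords

end Coordinates

/-! ### Invariance of the bracket with an endomorphism under changes of coordinates. -/

section Endomorphisms

variable {n : ℕ} {M : Type*} [TopologicalSpace M] [ChartedSpace (EuclideanSpace ℝ (Fin n)) M]
variable {F : Type*} [NormedAddCommGroup F] [NormedSpace ℝ F]
  {A : M → Type*} [TopologicalSpace (TotalSpace F A)]
  [∀ x, TopologicalSpace (A x)]
  [∀ x, AddCommGroup (A x)] [∀ x, Module ℝ (A x)]
  [FiberBundle F A] [VectorBundle ℝ F A]
  [∀ x, IsTopologicalAddGroup (A x)] [∀ x, ContinuousSMul ℝ (A x)]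

namespace EndA

variable (N : EndA (n := n) F A) (c c' : Coords (n := n) F A) {m : M}

/-- The matrix of `N` at a point, as a family of real functions on `M`. -/
def coeffAt (x : M) : Matrix (Fin (finrank ℝ F)) (Fin (finrank ℝ F)) ℝ :=
  fun α β => c.isFrame.coeff α x (N x (c.frame β x))

theorem coeffAt_mul_transition (hm : m ∈ c.U) (hm' : m ∈ c'.U) :
    N.coeffAt c' m * c.transition c' m = c.transition c' m * N.coeffAt c m := by
  ext α β
  have h := c.map_eq_sum_coeff hm (c'.isFrame.coeff α m) (N m (c.frame β m))
  have h' := c'.map_eq_sum_coeff hm' ((c'.isFrame.coeff α m).comp (N m).toLinearMap)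
    (c.frame β m)
  simp only [LinearMap.comp_apply, ContinuousLinearMap.coe_coe] at h'
  rw [Matrix.mul_apply, Matrix.mul_apply]
  simp only [coeffAt, Coords.transition]
  rw [Finset.sum_congr rfl fun δ _ => mul_comm _ _, ← h', h]
  exact Finset.sum_congr rfl fun δ _ => mul_comm _ _

variable [FiniteDimensional ℝ F] [ContMDiffVectorBundle ∞ F A (𝓡 n)]

theorem mat_apply (x : c.U) (α β : Fin (finrank ℝ F)) : N.mat c α β x = N.coeffAt c x α β := rfl

theorem contMDiffAt_coeffAt (hm : m ∈ c.U) (α β : Fin (finrank ℝ F)) :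
    ContMDiffAt (𝓡 n) 𝓘(ℝ, ℝ) ∞ (fun x => N.coeffAt c x α β) m :=
  (contMDiffOn_coeff c (N.contMDiff.contMDiffOn.clm_bundle_apply (c.isFrame.contMDiffOn β))
    α).contMDiffAt (c.chart.open_source.mem_nhds hm)

theorem partialX_mat (hm : m ∈ c.U) (i : Fin n) (α β : Fin (finrank ℝ F)) :
    c.partialX i (N.mat c α β) ⟨m, hm⟩ = c.deriv i (fun x => N.coeffAt c x α β) m := by
  rw [Coords.partialX_apply]
  refine c.deriv_congr hm ?_ i
  filter_upwards [c.U.isOpen.mem_nhds hm] with x hx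
  exact c.ext_apply (N.mat c α β) ⟨x, hx⟩

end EndA

variable [FiniteDimensional ℝ F] [ContMDiffVectorBundle ∞ F A (𝓡 n)]

/-- The coordinate change that works for `f` also intertwines the two fibrewise derivations. The
rule for the partial derivatives of the matrices comes from differentiating RT = TQ, where Q and R
are the matrices of N in the two frames. -/
theorem Family.IsGlobal.fn_bracket {f : Family (n := n) F A} (hf : f.IsGlobal)
    (N : EndA (n := n) F A) : (N.fn.bracket f).IsGlobal := by
  intro c c' m h h'
  obtain ⟨ψ, hψ, e⟩ := hf c c' m h h'
  refine ⟨ψ, hψ, ?_⟩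
  change ψ (c'.eval ⟨m, h'⟩ (c'.bracket (c'.endFn (N.mat c')) (f c'))) =
    c.eval ⟨m, h⟩ (c.bracket (c.endFn (N.mat c)) (f c))
  rw [Coords.eval_bracket_endFn, Coords.eval_bracket_endFn, ← e]
  simp only [EndA.partialX_mat, EndA.mat_apply]
  have hST := c'.transition_mul_transition c h' h
  have hRT := N.coeffAt_mul_transition c c' h h'
  have hSR := N.coeffAt_mul_transition c' c h' h
  have hτ := hψ.map_τ
  have hθ := hψ.map_θ
  have hp := hψ.map_p
  set T := c.transition c' m
  set S := c'.transition c m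
  set Q := N.coeffAt c m
  set R := N.coeffAt c' m
  set T' : Fin n → Matrix (Fin (finrank ℝ F)) (Fin (finrank ℝ F)) ℝ := fun i α β =>
    c.deriv i (fun x => c.transition c' x α β) m
  set Q' : Fin n → Matrix (Fin (finrank ℝ F)) (Fin (finrank ℝ F)) ℝ := fun i α β =>
    c.deriv i (fun x => N.coeffAt c x α β) m
  set R' : Fin n → Matrix (Fin (finrank ℝ F)) (Fin (finrank ℝ F)) ℝ := fun i α β =>
    c.deriv i (fun x => N.coeffAt c' x α β) m
  have hder : ∀ i, R' i * T + R * T' i = T' i * Q + T * Q' i := by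
    intro i
    ext α β
    have hl := c.deriv_sum_mul h Finset.univ (fun δ _ => N.contMDiffAt_coeffAt c' h' α δ)
      (fun δ _ => c.contMDiffAt_coeff_frame c' h h' δ β) i
    have hr := c.deriv_sum_mul h Finset.univ (fun δ _ => c.contMDiffAt_coeff_frame c' h h' α δ)
      (fun δ _ => N.contMDiffAt_coeffAt c h δ β) i
    have heq : (fun x => ∑ δ, N.coeffAt c' x α δ * c'.isFrame.coeff δ x (c.frame β x)) =ᶠ[nhds m]
        fun x => ∑ δ, c'.isFrame.coeff α x (c.frame δ x) * N.coeffAt c x δ β := by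
      filter_upwards [c.U.isOpen.mem_nhds h, c'.U.isOpen.mem_nhds h'] with x hx hx'
      exact congrFun (congrFun (N.coeffAt_mul_transition c c' hx hx') α) β
    rw [c.deriv_congr h heq, hr, Finset.sum_add_distrib, Finset.sum_add_distrib] at hl
    exact hl.symm
  -- Γ is read off from the transformation of the momenta: its entries are S^δ_α ∂T^α_β/∂x^i.
  refine FiberAlg.map_matDer (T := T) (S := S) (Γ := fun i => S * T' i)
    (K := fun j i => c'.deriv j (fun x => c.chart x i) m) Q Q' hτ hθ ?_ hRT hSR.symm ?_ _
  · intro j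
    rw [hp]
    refine Finset.sum_congr rfl fun i _ => ?_
    rw [FiberAlg.matFn, Finset.sum_comm]
    rfl
  · intro j
    have h1 : Matrix.of (fun α β => c'.deriv j (fun x => N.coeffAt c' x α β) m) =
        ∑ i, c'.deriv j (fun x => c.chart x i) m • R' i := by
      ext α β
      rw [Matrix.of_apply, c.deriv_eq_sum c' h h' (N.contMDiffAt_coeffAt c' h' α β), Matrix.sum_apply]
      rfl
    -- The derivative of RT = TQ is multiplied on the left by S = T⁻¹ and simplified by SR = QS.
    have h2 : ∀ i, S * R' i * T = Q' i + (S * T' i * Q - Q * (S * T' i)) := fun i => by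
      have h3 : R' i * T = T' i * Q + T * Q' i - R * T' i := eq_sub_of_add_eq (hder i)
      rw [Matrix.mul_assoc, h3, Matrix.mul_sub, Matrix.mul_add, ← Matrix.mul_assoc S T, hST,
        Matrix.one_mul, ← Matrix.mul_assoc S R, ← hSR, Matrix.mul_assoc, Matrix.mul_assoc]
      abel
    rw [h1, Matrix.mul_sum, Matrix.sum_mul]
    refine Finset.sum_congr rfl fun i _ => ?_
    rw [Matrix.mul_smul, Matrix.smul_mul, h2]

end Endomorphisms

end BigBracket

end

/-! ### The torsions as global functions of degree three. -/

noncomputable section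

namespace BigBracket

section Endomorphisms

variable {n : ℕ} {M : Type*} [TopologicalSpace M] [ChartedSpace (EuclideanSpace ℝ (Fin n)) M]
variable {F : Type*} [NormedAddCommGroup F] [NormedSpace ℝ F]
  {A : M → Type*} [TopologicalSpace (TotalSpace F A)]
  [∀ x, TopologicalSpace (A x)]
  [∀ x, AddCommGroup (A x)] [∀ x, Module ℝ (A x)]
  [FiberBundle F A]

theorem mem_𝒜_of_mem_𝒜bi {i j k : ℕ} (h : i + j = k) {f : Family (n := n) F A}
    (hf : f ∈ 𝒜bi F A i j) : f ∈ 𝒜 F A k :=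
  ⟨hf.1, fun c => le_iSup₂_of_le (f := fun (ij : ℕ × ℕ)
    (_ : ij ∈ Finset.HasAntidiagonal.antidiagonal k) => c.bideg ij.1 ij.2) (i, j)
    (Finset.HasAntidiagonal.mem_antidiagonal.2 h) le_rfl (hf.2 c)⟩

theorem add_mem_𝒜 {k : ℕ} {f g : Family (n := n) F A} (hf : f ∈ 𝒜 F A k) (hg : g ∈ 𝒜 F A k) :
    f + g ∈ 𝒜 F A k :=
  ⟨hf.1.add hg.1, fun c => add_mem (hf.2 c) (hg.2 c)⟩

theorem smul_mem_𝒜bi {k l : ℕ} (t : ℝ) {f : Family (n := n) F A} (hf : f ∈ 𝒜bi F A k l) :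
    t • f ∈ 𝒜bi F A k l :=
  ⟨hf.1.smul t, fun c => Submodule.smul_mem _ t (hf.2 c)⟩

theorem add_mem_𝒜bi {k l : ℕ} {f g : Family (n := n) F A} (hf : f ∈ 𝒜bi F A k l)
    (hg : g ∈ 𝒜bi F A k l) : f + g ∈ 𝒜bi F A k l :=
  ⟨hf.1.add hg.1, fun c => add_mem (hf.2 c) (hg.2 c)⟩

variable [VectorBundle ℝ F A]
  [∀ x, IsTopologicalAddGroup (A x)] [∀ x, ContinuousSMul ℝ (A x)]
  [FiniteDimensional ℝ F] [ContMDiffVectorBundle ∞ F A (𝓡 n)]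

namespace EndA

variable (N : EndA (n := n) F A)

theorem fn_bracket_fn (Θ : Family (n := n) F A) :
    (N.fn.bracket Θ).bracket N.fn = (-1 : ℝ) • N.fn.bracket (N.fn.bracket Θ) := by
  funext c
  change c.bracket (c.bracket (c.endFn (N.mat c)) (Θ c)) (c.endFn (N.mat c)) =
    (-1 : ℝ) • c.bracket (c.endFn (N.mat c)) (c.bracket (c.endFn (N.mat c)) (Θ c))
  rw [Coords.bracket_endFn_right]
  module

theorem fn_bracket_mem_𝒜bi {k l : ℕ} {f : Family (n := n) F A} (hf : f ∈ 𝒜bi F A k l) :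
    N.fn.bracket f ∈ 𝒜bi F A k l := by
  refine ⟨hf.1.fn_bracket N, fun c => ?_⟩
  have h := hf.2 c
  rw [Coords.bideg_eq] at h ⊢
  exact Coords.bracket_endFn_mem h

/-- The function `½ (l f - {N, {N, f}})`. -/
def torsionFn (l : ℝ) (f : Family (n := n) F A) : Family (n := n) F A :=
  (2⁻¹ : ℝ) • (l • f + (-1 : ℝ) • N.fn.bracket (N.fn.bracket f))

theorem torsionFn_apply (l : ℝ) (f : Family (n := n) F A) (c : Coords (n := n) F A) :
    N.torsionFn l f c = -c.torsionGen (N.mat c) l (f c) := by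
  change (2⁻¹ : ℝ) • (l • f c + (-1 : ℝ) • c.bracket (c.endFn (N.mat c))
    (c.bracket (c.endFn (N.mat c)) (f c))) = _
  rw [Coords.torsionGen]
  module

variable {N}

theorem torsionFn_mem {k m : ℕ} (l : ℝ) {f : Family (n := n) F A} (hf : f ∈ 𝒜bi F A k m) :
    N.torsionFn l f ∈ 𝒜bi F A k m :=
  smul_mem_𝒜bi _ (add_mem_𝒜bi (smul_mem_𝒜bi _ hf)
    (smul_mem_𝒜bi _ (N.fn_bracket_mem_𝒜bi (N.fn_bracket_mem_𝒜bi hf))))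

theorem torsionFn_add (l : ℝ) (f g : Family (n := n) F A) :
    N.torsionFn l (f + g) = N.torsionFn l f + N.torsionFn l g := by
  funext c
  change N.torsionFn l (f + g) c = N.torsionFn l f c + N.torsionFn l g c
  simp only [torsionFn_apply, Coords.torsionGen, Pi.add_apply, Coords.bracket_add_right]
  module

/-- Antisymmetry gives -{N, {N, μ + γ}}, and the two summands keep the bidegrees (1, 2) and (2, 1)
of μ and γ. -/
theorem fn_bracket_bracket_fn_mem {μ γ : Family (n := n) F A} (hμ : μ ∈ 𝒜bi F A 1 2)
    (hγ : γ ∈ 𝒜bi F A 2 1) : (N.fn.bracket (μ + γ)).bracket N.fn ∈ 𝒜 F A 3 := by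
  have h : (N.fn.bracket (μ + γ)).bracket N.fn =
      (-1 : ℝ) • N.fn.bracket (N.fn.bracket μ) + (-1 : ℝ) • N.fn.bracket (N.fn.bracket γ) := by
    rw [← N.fn_bracket_fn, ← N.fn_bracket_fn]
    funext c
    simp only [Family.bracket, Pi.add_apply, Coords.bracket_add_left, Coords.bracket_add_right]
  have h12 := smul_mem_𝒜bi (-1) (N.fn_bracket_mem_𝒜bi (N.fn_bracket_mem_𝒜bi hμ))
  have h21 := smul_mem_𝒜bi (-1) (N.fn_bracket_mem_𝒜bi (N.fn_bracket_mem_𝒜bi hγ))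
  rw [h]
  exact add_mem_𝒜 (mem_𝒜_of_mem_𝒜bi (by norm_num) h12) (mem_𝒜_of_mem_𝒜bi (by norm_num) h21)

variable {l : ℝ} (hN : ∀ x (v : A x), N x (N x v) = l • v) {c : Coords (n := n) F A}
include hN

theorem tildeE₃_torsion {μ γ : c.Loc} (hμ : μ ∈ c.bigraded 1 2) (hγ : γ ∈ c.bigraded 2 1) :
    c.tildeE₃ (torsion (c.dorfman (μ + γ)) (N.double c)) =
      -c.torsionGen (N.mat c) l (μ + γ) := by
  have hΘ : μ + γ ∈ c.graded 3 := add_mem (Coords.bigraded_le_graded (by norm_num) hμ)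
    (Coords.bigraded_le_graded (by norm_num) hγ)
  have hQ := mat_mul_mat hN c
  exact Coords.tildeE₃_eq (Coords.torsionGen_mem hΘ) (Coords.dp_torsionGen hQ hΘ)
    (Coords.ofSec_torsion hQ hΘ)

/-- This is the case γ = 0 of the statement on the double, where the A*-torsion disappears. No
separate computation on A is needed. -/
theorem tildeA_torsion {μ : c.Loc} (hμ : μ ∈ c.bigraded 1 2) :
    c.tildeA (torsion (c.bracketA μ) (N.onA c)) = -c.torsionGen (N.mat c) l μ := by
  have h0 : (0 : c.Loc) ∈ c.bigraded 2 1 := zero_mem _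
  have h1 := tildeE₃_torsion hN hμ h0
  have h2 := Coords.tildeE₃_torsion hμ h0 (mat_mul_mat hN c)
  have h3 : ∀ ξ η, c.bracketAdual 0 ξ η = 0 := fun ξ η => by
    simp only [Coords.bracketAdual, Coords.dorfman, Coords.bracket_zero_right,
      Coords.bracket_zero_left, Coords.toSec, map_zero]
    rfl
  have h4 : c.tildeAdual (torsion (c.bracketAdual 0) (fun ξ => (N.mat c)ᵀ *ᵥ ξ)) = 0 := by
    simp [Coords.tildeAdual, torsion, h3]
  rw [h4, add_zero] at h2
  rw [add_zero] at h1
  rw [← h1]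
  rw [add_zero] at h2
  exact h2.symm

theorem tildeAdual_torsion {γ : c.Loc} (hγ : γ ∈ c.bigraded 2 1) :
    c.tildeAdual (torsion (c.bracketAdual γ) (N.transpose c)) =
      -c.torsionGen (N.mat c) l γ := by
  have h0 : (0 : c.Loc) ∈ c.bigraded 1 2 := zero_mem _
  have h1 := tildeE₃_torsion hN h0 hγ
  have h2 := Coords.tildeE₃_torsion h0 hγ (mat_mul_mat hN c)
  have h3 : ∀ X Y, c.bracketA 0 X Y = 0 := fun ξ η => by
    simp only [Coords.bracketA, Coords.dorfman, Coords.bracket_zero_right,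
      Coords.bracket_zero_left, Coords.toSec, map_zero]
    rfl
  have h4 : c.tildeA (torsion (c.bracketA 0) (fun X => N.mat c *ᵥ X)) = 0 := by
    simp [Coords.tildeA, torsion, h3]
  rw [h4, zero_add, zero_add] at h2
  rw [zero_add] at h1
  rw [← h1]
  exact h2.symm

theorem torsion_skew {Θ : c.Loc} (hΘ : Θ ∈ c.graded 3) (f : c.Fn) (u u' v w : c.SecE) :
    torsion (c.dorfman Θ) (N.double c) (u + u') v =
        torsion (c.dorfman Θ) (N.double c) u v + torsion (c.dorfman Θ) (N.double c) u' v ∧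
      torsion (c.dorfman Θ) (N.double c) (f • u) v =
        f • torsion (c.dorfman Θ) (N.double c) u v ∧
      torsion (c.dorfman Θ) (N.double c) v u = -torsion (c.dorfman Θ) (N.double c) u v ∧
      c.pairE (torsion (c.dorfman Θ) (N.double c) u w) v =
        -c.pairE (torsion (c.dorfman Θ) (N.double c) u v) w := by
  have hQ := mat_mul_mat hN c
  have hw := Coords.torsionGen_mem (Q := N.mat c) (l := l) hΘ
  have hp := Coords.dp_torsionGen hQ hΘ
  have hT := Coords.ofSec_torsion hQ hΘ
  rw [double_eq]
  exact ⟨Coords.skew_add hT u u' v, Coords.skew_smul hw hp hT f u v,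
    Coords.skew_swap hw hp hT u v, Coords.skew_pairE hw hp hT u v w⟩

/-- The left side is defined through a frame. The right side is made of iterated brackets with N,
hence it is global and of bidegree (1, 2) like μ. -/
theorem torsionAFn_eq {μ : Family (n := n) F A} (hμ : μ ∈ 𝒜bi F A 1 2) :
    N.torsionAFn μ = N.torsionFn l μ := funext fun c => by
  have h := hμ.2 c
  rw [Coords.bideg_eq] at h
  rw [torsionFn_apply]
  exact tildeA_torsion hN h

theorem torsionAdualFn_eq {γ : Family (n := n) F A} (hγ : γ ∈ 𝒜bi F A 2 1) :
    N.torsionAdualFn γ = N.torsionFn l γ := funext fun c => by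
  have h := hγ.2 c
  rw [Coords.bideg_eq] at h
  rw [torsionFn_apply]
  exact tildeAdual_torsion hN h

theorem torsionDoubleFn_eq {μ γ : Family (n := n) F A} (hμ : μ ∈ 𝒜bi F A 1 2)
    (hγ : γ ∈ 𝒜bi F A 2 1) :
    N.torsionDoubleFn (μ + γ) = N.torsionAFn μ + N.torsionAdualFn γ := by
  rw [torsionAFn_eq hN hμ, torsionAdualFn_eq hN hγ, ← torsionFn_add]
  funext c
  have h1 := hμ.2 c
  have h2 := hγ.2 c
  rw [Coords.bideg_eq] at h1 h2
  rw [torsionFn_apply]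
  exact tildeE₃_torsion hN h1 h2

end EndA

end Endomorphisms

end BigBracket

end

/-! ### Assembly of the theorem. -/

theorem theorem4p2 {n : ℕ} {M : Type*} [TopologicalSpace M]
    [ChartedSpace (EuclideanSpace ℝ (Fin n)) M] [IsManifold (𝓡 n) ∞ M]
    {F : Type*} [NormedAddCommGroup F] [NormedSpace ℝ F] [FiniteDimensional ℝ F]
    {A : M → Type*} [TopologicalSpace (TotalSpace F A)] [∀ x, TopologicalSpace (A x)]
    [∀ x, AddCommGroup (A x)] [∀ x, Module ℝ (A x)] [FiberBundle F A] [VectorBundle ℝ F A]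
    [∀ x, IsTopologicalAddGroup (A x)] [∀ x, ContinuousSMul ℝ (A x)]
    [ContMDiffVectorBundle ∞ F A (𝓡 n)]
    (μ γ : BigBracket.Family (n := n) F A) (hμγ : BigBracket.IsLieBialgebroid μ γ)
    (N : BigBracket.EndA (n := n) F A) :
    -- (i)
    ((N.doubleFn.bracket (μ + γ)).bracket N.doubleFn ∈ BigBracket.𝒜 F A 3 ∧
      (N.doubleFn.bracket (μ + γ)).bracket N.doubleFn = (N.fn.bracket (μ + γ)).bracket N.fn) ∧
    -- (ii)
    (BigBracket.IsProportionalToAlmostCps N →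
      -- the torsion of `𝒩` is a skew-symmetric 3-tensor
      (∀ (c : BigBracket.Coords (n := n) F A) (f : c.Fn) (u u' v w : c.SecE),
        N.torsionDouble (μ + γ) c (u + u') v =
          N.torsionDouble (μ + γ) c u v + N.torsionDouble (μ + γ) c u' v ∧
        N.torsionDouble (μ + γ) c (f • u) v = f • N.torsionDouble (μ + γ) c u v ∧
        N.torsionDouble (μ + γ) c v u = -N.torsionDouble (μ + γ) c u v ∧
        c.pairE (N.torsionDouble (μ + γ) c u w) v =
          -c.pairE (N.torsionDouble (μ + γ) c u v) w) ∧
      -- equality of functions in `𝒜³`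
      N.torsionDoubleFn (μ + γ) ∈ BigBracket.𝒜 F A 3 ∧
      N.torsionAFn μ ∈ BigBracket.𝒜 F A 3 ∧
      N.torsionAdualFn γ ∈ BigBracket.𝒜 F A 3 ∧
      N.torsionDoubleFn (μ + γ) = N.torsionAFn μ + N.torsionAdualFn γ ∧
      -- explicit form
      ∀ (c : BigBracket.Coords (n := n) F A) (X Y Z : c.SecA) (ξ η ζ : c.SecAdual),
        c.pairE (N.torsionDouble (μ + γ) c (X, ξ) (Y, η)) (Z, ζ) =
          N.torsionA μ c X Y ⬝ᵥ ζ + N.torsionA μ c Y Z ⬝ᵥ ξ + N.torsionA μ c Z X ⬝ᵥ η +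
          N.torsionAdual γ c ξ η ⬝ᵥ Z + N.torsionAdual γ c η ζ ⬝ᵥ X +
          N.torsionAdual γ c ζ ξ ⬝ᵥ Y) := by
  have hμ : ∀ c, μ c ∈ c.bigraded 1 2 := fun c => by
    have h := hμγ.mem_μ.2 c
    rwa [BigBracket.Coords.bideg_eq] at h
  have hγ : ∀ c, γ c ∈ c.bigraded 2 1 := fun c => by
    have h := hμγ.mem_γ.2 c
    rwa [BigBracket.Coords.bideg_eq] at h
  -- After this substitution both sides of the equality in (i) coincide, and only membership in
  -- degree 3 has to be shown.
  rw [N.doubleFn_eq]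
  refine ⟨⟨BigBracket.EndA.fn_bracket_bracket_fn_mem hμγ.mem_μ hμγ.mem_γ, rfl⟩, fun hcps => ?_⟩
  obtain ⟨l, hl⟩ := hcps.exists_sq
  have hE := BigBracket.EndA.torsionDoubleFn_eq hl hμγ.mem_μ hμγ.mem_γ
  have h12 : N.torsionAFn μ ∈ BigBracket.𝒜 F A 3 := by
    rw [BigBracket.EndA.torsionAFn_eq hl hμγ.mem_μ]
    exact BigBracket.mem_𝒜_of_mem_𝒜bi (by norm_num)
      (BigBracket.EndA.torsionFn_mem l hμγ.mem_μ)
  have h21 : N.torsionAdualFn γ ∈ BigBracket.𝒜 F A 3 := by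
    rw [BigBracket.EndA.torsionAdualFn_eq hl hμγ.mem_γ]
    exact BigBracket.mem_𝒜_of_mem_𝒜bi (by norm_num)
      (BigBracket.EndA.torsionFn_mem l hμγ.mem_γ)
  refine ⟨fun c f u u' v w => ?_, ?_, h12, h21, hE, fun c X Y Z ξ η ζ => ?_⟩
  · exact BigBracket.EndA.torsion_skew hl
      (add_mem (BigBracket.Coords.bigraded_le_graded (by norm_num) (hμ c))
        (BigBracket.Coords.bigraded_le_graded (by norm_num) (hγ c))) f u u' v w
  · rw [hE]
    exact BigBracket.add_mem_𝒜 h12 h21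
  · exact BigBracket.Coords.pairE_torsion (hμ c) (hγ c) (BigBracket.EndA.mat_mul_mat hl c)
      X Y Z ξ η ζ
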